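/- Let $\mathbb{F}_q$ be a finite field of odd characteristic with $q$ elements, $K=\mathbb{F}_q(t)$, $\gamma\in\mathbb{F}_q^\times$ and $a\geq 1$ an integer. Let $E_{a,\gamma}$ be the elliptic curve over $K$ given by $$y^2=x(x+16\gamma)\left(x+\wp_a(t)^2\right),\qquad \wp_a(t)=t^{q^a}-t .$$ For a place $v$ of $K$ let $d_v$ be its degree and $\mathbb{F}_v$ its residue field. The $L$-function of $E_{a,\gamma}$ is the power series $$L(E_{a,\gamma},T)=\prod_{v\text{ good}}\left(1-a_vT^{d_v}+q^{d_v}T^{2d_v}\right)^{-1}\prod_{v\text{ bad}}\left(1-a_vT^{d_v}\right)^{-1}\in\mathbb{Z}[[T]],$$ the products being over the places $v$ of $K$ (including $\infty$) of good, resp. bad, reduction, where $a_v=q^{d_v}+1-|\widetilde{E}_v(\mathbb{F}_v)|$ if $v$ is good ($\widetilde{E}_v$ being the reduction at $v$ of a minimal integral model), and $a_v=0$, $1$, $-1$ if the reduction at $v$ is additive, split multiplicative, nonsplit multiplicative, respectively. Fix a nontrivial additive character $\psi:\mathbb{F}_q\to\mathbb{C}^\times$. A place $v\neq 0,\infty$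 corresponds to a monic irreducible polynomial $B_v\in\mathbb{F}_q[t]$ of degree $d_v$, $B_v\neq t$; let $\beta_v\in\mathbb{F}_v=\mathbb{F}_q[t]/(B_v)$ be the class of $t$, and put $$\mathbf{Kl}_\gamma(v)=-\sum_{x\in\mathbb{F}_v^\times}\psi\left(\mathrm{Tr}_{\mathbb{F}_v/\mathbb{F}_q}\left(x+\frac{\gamma\beta_v^2}{x}\right)\right).$$ Let $\mathbf{kl}_\gamma(v),\mathbf{kl}'_\gamma(v)$ be the two complex numbers, unique up to order, with $$\mathbf{kl}_\gamma(v)+\mathbf{kl}'_\gamma(v)=\mathbf{Kl}_\gamma(v),\qquad \mathbf{kl}_\gamma(v)\,\mathbf{kl}'_\gamma(v)=q^{d_v}.$$ These are complex conjugate algebraic integers of absolute value $q^{d_v/2}$, and there is $\theta_v\in(0,\pi)$ such that $\mathbf{Kl}_\gamma(v)=2q^{d_v/2}\cos\theta_v$. Let $P_q(a)$ be the (finite) set of places $v\neq 0,\infty$ of $K$ whose degree $d_v$ divides $a$. Then the Euler product defining $L(E_{a,\gamma},T)$ converges in $\mathbb{Z}[[T]]$, and $$L(E_{a,\gamma},T)=\prod_{v\in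 P_q(a)}\left(1-q^{d_v}T^{d_v}\right)\left(1-\mathbf{kl}_\gamma(v)^2T^{d_v}\right)\left(1-\mathbf{kl}'_\gamma(v)^2T^{d_v}\right)$$ $$\phantom{L(E_{a,\gamma},T)}=\prod_{v\in P_q(a)}\left(1-(qT)^{d_v}\right)\left(1-e^{2i\theta_v}(qT)^{d_v}\right)\left(1-e^{-2i\theta_v}(qT)^{d_v}\right).$$ -/

import Mathlib

open scoped PowerSeries.WithPiTopology

namespace ArtinSchreierL

noncomputable section

/-! ### Places of the rational function field `F(t)` -/

/-- A finite place of `F(t)`, identified with a monic irreducible polynomial of `F[t]`. -/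
structure FinitePlace (F : Type*) [Field F] where
  /-- the monic irreducible polynomial -/
  poly : Polynomial F
  monic : poly.Monic
  irreducible : Irreducible poly

/-- A place of `F(t)`: a finite place or the place `∞`. -/
inductive Place (F : Type*) [Field F] where
  | finite (v : FinitePlace F) : Place F
  | infinity : Place F

section Places

variable {F : Type*} [Field F]

/-- The degree of a finite place. -/
def FinitePlace.degree (v : FinitePlace F) : ℕ := v.poly.natDegree

/-- The nonzero prime ideal of `F[t]` generated by the polynomial of a finite place. -/
def FinitePlace.primeIdeal (v : FinitePlace F) :
    IsDedekindDomain.HeightOneSpectrum (Polynomial F) where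
  asIdeal := Ideal.span {v.poly}
  isPrime := (Ideal.span_singleton_prime v.irreducible.ne_zero).2 v.irreducible.prime
  ne_bot := fun h => v.irreducible.ne_zero (Ideal.span_singleton_eq_bot.1 h)

/-- The degree of a place (the place `∞` has degree `1`). -/
def Place.degree : Place F → ℕ
  | .finite v => v.degree
  | .infinity => 1

open Classical in
/-- The normalised (multiplicatively written) discrete valuation of `F(t)` at a place. -/
def Place.valuation : Place F → Valuation (RatFunc F) (WithZero (Multiplicative ℤ))
  | .finite v => v.primeIdeal.valuation (RatFunc F)
  | .infinity => RatFunc.inftyValuation F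

/-- The local ring of a place: the discrete valuation ring of the elements of `F(t)` that are
integral at the place. -/
abbrev Place.localRing (v : Place F) : ValuationSubring (RatFunc F) :=
  v.valuation.valuationSubring

instance (v : Place F) : v.valuation.IsNontrivial := by
  cases v with
  | finite v => exact inferInstanceAs (v.primeIdeal.valuation (RatFunc F)).IsNontrivial
  | infinity =>
    classical
    unfold Place.valuation
    infer_instance

instance (v : Place F) : IsDiscreteValuationRing v.localRing := by
  infer_instance

end Places

/-! ### The `L`-function of a Weierstrass curve over `F(t)` -/

section LFunction

variable {F : Type*} [Field F]

/-- The Euler factor at `v` of the curve `W`: the inverse in `ℤ⟦T⟧` of `P_v(T ^ deg v)`, where `P_v`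
is computed on a minimal integral model of `W` at `v`, and `P_v(T)` is
`1 - a_v T + q_v T ^ 2` with `q_v` the number of elements of the residue field and
`a_v = q_v + 1 - #W(F_v)` at a place of good reduction,
`1 - T` at a place of split multiplicative reduction,
`1 + T` at a place of nonsplit multiplicative reduction, and
`1` at a place of additive reduction. -/
def eulerFactor (W : WeierstrassCurve (RatFunc F)) (v : Place F) : PowerSeries ℤ :=
  PowerSeries.invOfUnit
    (Polynomial.expand ℤ v.degree (W.localPolynomial v.localRing) : PowerSeries ℤ) 1

/-- The `L`-function `L(W, T)`, the product in `ℤ⟦T⟧` of the Euler factors at all places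
of `F(t)`. -/
def LFunction (W : WeierstrassCurve (RatFunc F)) : PowerSeries ℤ :=
  ∏' v : Place F, eulerFactor W v

/-- The polynomial `℘_a(t) = t ^ (q ^ a) - t`, with `q = #F`, as an element of `F(t)`. -/
def wp (F : Type*) [Field F] (a : ℕ) : RatFunc F :=
  RatFunc.X ^ (Nat.card F ^ a) - RatFunc.X

/-- The curve `y² = x (x + 16 γ) (x + ℘_a(t)²) = x³ + (16 γ + ℘_a²) x² + 16 γ ℘_a² x`
over `F(t)`. -/
def curve (a : ℕ) (γ : F) : WeierstrassCurve (RatFunc F) where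
  a₁ := 0
  a₂ := 16 * RatFunc.C γ + wp F a ^ 2
  a₃ := 0
  a₄ := 16 * RatFunc.C γ * wp F a ^ 2
  a₆ := 0

end LFunction

/-! ### Kloosterman sums -/

/-- The Kloosterman sum `- ∑_{x ≠ 0} ψ (x + α / x)` over a finite field. -/
def kloostermanSum {k : Type*} [Field k] [Finite k] (ψ : AddChar k ℂ) (α : k) : ℂ :=
  letI : Fintype kˣ := Fintype.ofFinite kˣ;
  -∑ x : kˣ, ψ ((x : k) + α / (x : k))

section Kloosterman

variable {F : Type*} [Field F]

instance (v : FinitePlace F) : Fact (Irreducible v.poly) := ⟨v.irreducible⟩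

/-- The residue field `F[t] / (B_v)` of a finite place `v`. -/
abbrev FinitePlace.residueField (v : FinitePlace F) : Type _ := AdjoinRoot v.poly

instance [Finite F] (v : FinitePlace F) : Finite v.residueField :=
  have := v.monic.finite_adjoinRoot
  Module.finite_of_finite F

/-- The lift `ψ ∘ Tr` of an additive character of `F` to the residue field of a finite place. -/
def liftChar (ψ : AddChar F ℂ) (v : FinitePlace F) : AddChar v.residueField ℂ :=
  ψ.compAddMonoidHom (Algebra.trace F v.residueField).toAddMonoidHom

/-- The sum `Kl_γ(v)`: the Kloosterman sum over the residue field of `v`, with respect to the lifted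
character, with parameter `γ β_v²`, where `β_v` is the class of `t`, a root of `B_v`. -/
def kl [Finite F] (ψ : AddChar F ℂ) (γ : F) (v : FinitePlace F) : ℂ :=
  kloostermanSum (liftChar ψ v)
    (algebraMap F v.residueField γ * AdjoinRoot.root v.poly ^ 2)

/-- The set of places `v ≠ 0, ∞` whose degree divides `a`. -/
def placesDividing (F : Type*) [Field F] (a : ℕ) : Set (FinitePlace F) :=
  {v | v.poly ≠ Polynomial.X ∧ v.degree ∣ a}

theorem placesDividing_finite (F : Type*) [Field F] [Finite F] {a : ℕ} (ha : 1 ≤ a) :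
    (placesDividing F a).Finite := by
  have h : (Polynomial.degreeLT F (a + 1) : Set (Polynomial F)).Finite := by
    have : Finite (Polynomial.degreeLT F (a + 1)) :=
      Finite.of_equiv _ (Polynomial.degreeLTEquiv F (a + 1)).symm.toEquiv
    exact Set.finite_coe_iff.1 this
  refine Set.Finite.of_finite_image (f := FinitePlace.poly) (h.subset ?_) ?_
  · rintro _ ⟨v, hv, rfl⟩
    have h1 : v.poly.natDegree ≤ a := Nat.le_of_dvd ha hv.2
    refine Polynomial.mem_degreeLT.2 (lt_of_le_of_lt Polynomial.degree_le_natDegree ?_)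
    exact_mod_cast Nat.lt_succ_of_le h1
  · rintro ⟨p, _, _⟩ _ ⟨q, _, _⟩ _ h
    cases h
    rfl

end Kloosterman

end

end ArtinSchreierL

namespace ArtinSchreierL

noncomputable section

/-! ### Places, and the points of finite extensions lying over them -/

section PlaceCounting

open Polynomial

variable {F : Type*} [Field F]

/-! The formula is an identity between power series with constant term 1, so it suffices to compare
power sums, that is, the coefficients of logarithmic derivatives. The `n`-th power sum of the local
factors at the finite places, regrouped over the points `x` of the extension `k` of degree `n`, is
the sum over `x` of minus `legendreSum (16 γ) (w²)` at `w = x^(q^a) - x`. This holds at bad fibres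
too: finite bad reduction is always multiplicative, and the same character sum gives the sign of the
node (`exists_localPolynomial_roots`). The place `∞` is split multiplicative and contributes 1
(`localPolynomial_infinity`).

By orthogonality of characters, the sum of `f (x^(q^a) - x)` over `x` is the sum of the Fourier
transform of `f` over the `c` fixed by the `q^a`-power map, i.e. over the points above the places of
degree dividing `a` (`sum_comp_pow_sub`). For `f w = legendreSum (16 γ) (w²)` the transform is 1 at
`c = 0`, which cancels `∞`, and `Kl (γ c²)² - #k` elsewhere (`sum_legendreSum`,
`sum_legendreSum_mul_addChar_mul`). By Hasse–Davenport, `Kl` over `k` is `ω^m + ω'^m` with `(ω ω')^m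
= #k`, so the transform is `(ω²)^m + (ω'²)^m + #k`: the power sum of the right-hand side. Both
Hasse–Davenport relations, for Kloosterman sums and for Legendre sums, come from one statement on
multiplicative functions of monic polynomials whose generating series is quadratic
(`sum_extension_eq_neg`). `sum_places_eq` and `map_LFunction_eq` assemble this.

The statement on absolute values is Weil's bound. It is proved by Stepanov's method in Bombieri's
form on the Artin–Schreier curves `z^q - z + c = x + α / x`, which bounds from above the number of
`x` with a given trace of `x + α / x` (`card_mul_card_le`). The total of these numbers is known, so
upper bounds alone control the sum; letting the extension grow removes the constants. The angle
avoids `0` and `π` because a Kloosterman sum is 1 modulo a prime above the characteristic, so its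
square is not `4 q` (`kloostermanSum_sq_ne`). -/

theorem FinitePlace.ext_poly {v w : FinitePlace F} (h : v.poly = w.poly) : v = w := by
  cases v; cases w; cases h; rfl

theorem FinitePlace.degree_pos (v : FinitePlace F) : 0 < v.degree :=
  v.irreducible.natDegree_pos

section Finite

variable [Finite F]

theorem finite_setOf_natDegree_le (N : ℕ) : {p : F[X] | p.natDegree ≤ N}.Finite := by
  have : Finite (degreeLT F (N + 1)) :=
    Finite.of_equiv _ (degreeLTEquiv F (N + 1)).symm.toEquiv
  refine (Set.finite_coe_iff.1 this).subset fun p (hp : p.natDegree ≤ N) => ?_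
  refine mem_degreeLT.2 (lt_of_le_of_lt degree_le_natDegree ?_)
  exact_mod_cast Nat.lt_succ_of_le hp

theorem finite_setOf_degree_le (N : ℕ) : {v : FinitePlace F | v.degree ≤ N}.Finite :=
  Set.Finite.of_finite_image (f := FinitePlace.poly)
    ((finite_setOf_natDegree_le N).subset (by rintro _ ⟨v, hv, rfl⟩; exact hv))
    fun _ _ _ _ h => FinitePlace.ext_poly h

variable (F) in
/-- The finite places of degree at most `N`. -/
def placesUpTo (N : ℕ) : Finset (FinitePlace F) := (finite_setOf_degree_le N).toFinset

@[simp] theorem mem_placesUpTo {N : ℕ} {v : FinitePlace F} :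
    v ∈ placesUpTo F N ↔ v.degree ≤ N := by
  simp [placesUpTo]

variable (F) in
/-- The monic polynomials of degree `n`. -/
def monics (n : ℕ) : Finset F[X] :=
  (Set.Finite.subset (t := {p | p.Monic ∧ p.natDegree = n}) (finite_setOf_natDegree_le n)
    fun _ hp => hp.2.le).toFinset

@[simp] theorem mem_monics {n : ℕ} {p : F[X]} : p ∈ monics F n ↔ p.Monic ∧ p.natDegree = n := by
  simp [monics]

end Finite

section Specialisation

variable {k : Type*} [Field k] [Algebra F k]

theorem finrank_residueField (v : FinitePlace F) : Module.finrank F v.residueField = v.degree := by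
  have := (AdjoinRoot.powerBasis v.irreducible.ne_zero).finrank
  rwa [AdjoinRoot.powerBasis_dim] at this

variable [Finite k]

variable (F) in
/-- The place of `F(t)` at which `t` specialises to `x`. -/
def placeOf (x : k) : FinitePlace F where
  poly := minpoly F x
  monic := minpoly.monic (Algebra.IsIntegral.isIntegral x)
  irreducible := minpoly.irreducible (Algebra.IsIntegral.isIntegral x)

theorem placeOf_eq_iff (v : FinitePlace F) (x : k) :
    placeOf F x = v ↔ aeval x v.poly = 0 := by
  refine ⟨fun h => h ▸ minpoly.aeval F x, fun h => FinitePlace.ext_poly ?_⟩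
  exact (minpoly.eq_of_irreducible_of_monic v.irreducible h v.monic).symm

theorem degree_placeOf_dvd (x : k) : (placeOf F x).degree ∣ Module.finrank F k :=
  minpoly.degree_dvd (Algebra.IsIntegral.isIntegral x)

/-- The specialisations `t ↦ x` at a place are the embeddings of its residue field. -/
def algHomEquivPlaceOf (v : FinitePlace F) :
    (v.residueField →ₐ[F] k) ≃ {x : k // placeOf F x = v} where
  toFun f := ⟨f (AdjoinRoot.root v.poly), by
    rw [placeOf_eq_iff, aeval_algHom_apply, AdjoinRoot.aeval_eq, AdjoinRoot.mk_self, map_zero]⟩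
  invFun x := AdjoinRoot.liftAlgHom v.poly (Algebra.ofId F k) x.1
    ((placeOf_eq_iff v x.1).1 x.2)
  left_inv f := by ext; simp
  right_inv x := Subtype.ext (AdjoinRoot.liftAlgHom_root _ _ _ _)

/-- Points over `v` are embeddings of the residue field; when its degree divides that of `k`, the
number of embeddings is that degree. -/
theorem card_placeOf_eq (v : FinitePlace F) (h : v.degree ∣ Module.finrank F k) :
    Nat.card {x : k // placeOf F x = v} = v.degree := by
  rw [← Nat.card_congr (algHomEquivPlaceOf v), ← finrank_residueField]
  exact FiniteField.natCard_algHom_of_finrank_dvd (by rwa [finrank_residueField])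

/-- A sum over a finite extension of a function of the place below. -/
theorem sum_placeOf [Finite F] [Fintype k] {M : Type*} [AddCommMonoid M] (g : FinitePlace F → M) {N : ℕ}
    (hN : Module.finrank F k ≤ N) :
    ∑ x : k, g (placeOf F x) =
      ∑ v ∈ placesUpTo F N with v.degree ∣ Module.finrank F k, v.degree • g v := by
  classical
  rw [← Finset.sum_fiberwise_of_maps_to (s := Finset.univ)
    (t := {v ∈ placesUpTo F N | v.degree ∣ Module.finrank F k}) (g := fun x : k => placeOf F x)]
  · refine Finset.sum_congr rfl fun v hv => ?_
    rw [Finset.sum_congr rfl (g := fun _ => g v) (fun x hx => by rw [(Finset.mem_filter.1 hx).2]),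
      Finset.sum_const, ← card_placeOf_eq v (Finset.mem_filter.1 hv).2, Nat.card_eq_fintype_card,
      Fintype.card_subtype]
  · intro x _
    simp only [Finset.mem_filter, mem_placesUpTo]
    exact ⟨(Nat.le_of_dvd Module.finrank_pos (degree_placeOf_dvd x)).trans hN,
      degree_placeOf_dvd x⟩

end Specialisation

end PlaceCounting

/-! ### Generating series of multiplicative functions on monic polynomials -/

section Multiplicative

open Polynomial

variable {F : Type*} [Field F] {R : Type*} [CommRing R]

/-- A function on polynomials that is multiplicative on monic polynomials. -/
structure IsMonicMul (Λ : F[X] → R) : Prop where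
  map_one : Λ 1 = 1
  map_mul : ∀ f g : F[X], f.Monic → g.Monic → Λ (f * g) = Λ f * Λ g

theorem IsMonicMul.map_pow {Λ : F[X] → R} (h : IsMonicMul Λ) {f : F[X]} (hf : f.Monic) (n : ℕ) :
    Λ (f ^ n) = Λ f ^ n := by
  induction n with
  | zero => simp [h.map_one]
  | succ n ih => rw [pow_succ, h.map_mul _ _ (hf.pow n) hf, ih, pow_succ]

variable [Finite F]

/-- For fixed `v`, the number of `j ≥ 1` with `v^j ∣ f` is the multiplicity of `v` in `f`, so this
is the degree of the factorisation of `f`. The cut-offs at `deg f` lose nothing. -/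
theorem sum_multiplicity_eq {f : F[X]} (hf : f.Monic) :
    ∑ v ∈ placesUpTo F f.natDegree, ∑ j ∈ Finset.Icc 1 f.natDegree,
      (open Classical in if v.poly ^ j ∣ f then v.degree else 0) = f.natDegree := by
  classical
  set n := f.natDegree with hn
  have hf0 : f ≠ 0 := hf.ne_zero
  have h1 : ∀ v ∈ placesUpTo F n, ∑ j ∈ Finset.Icc 1 n,
      (if v.poly ^ j ∣ f then v.degree else 0) =
      (UniqueFactorizationMonoid.normalizedFactors f).count v.poly * v.poly.natDegree := by
    intro v _
    set c := (UniqueFactorizationMonoid.normalizedFactors f).count v.poly with hc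
    have hem : emultiplicity v.poly f = c := by
      rw [UniqueFactorizationMonoid.emultiplicity_eq_count_normalizedFactors v.irreducible hf0,
        v.monic.normalize_eq_self]
    have hdvd : ∀ j, v.poly ^ j ∣ f ↔ j ≤ c := by
      intro j
      rw [pow_dvd_iff_le_emultiplicity, hem, Nat.cast_le]
    have hcn : c ≤ n := by
      have h2 := natDegree_le_of_dvd ((hdvd c).2 le_rfl) hf0
      rw [natDegree_pow] at h2
      exact (Nat.le_mul_of_pos_right c v.degree_pos).trans h2
    simp only [hdvd]
    rw [← Finset.sum_filter, Finset.sum_const, smul_eq_mul]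
    congr 1
    rw [show {j ∈ Finset.Icc 1 n | j ≤ c} = Finset.Icc 1 c by ext; simp; omega]
    simp
  rw [Finset.sum_congr rfl h1]
  have h3 : ∀ p ∈ UniqueFactorizationMonoid.normalizedFactors f, p.Monic ∧ Irreducible p := by
    intro p hp
    have hi := UniqueFactorizationMonoid.irreducible_of_normalized_factor p hp
    exact ⟨by rw [← UniqueFactorizationMonoid.normalize_normalized_factor p hp]
              exact monic_normalize hi.ne_zero, hi⟩
  have h4 : n = ((UniqueFactorizationMonoid.normalizedFactors f).map natDegree).sum := by
    rw [← natDegree_multiset_prod' _ , hn]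
    · rw [UniqueFactorizationMonoid.prod_normalizedFactors_eq hf0, hf.normalize_eq_self]
    · rw [Multiset.map_congr rfl (fun p hp => (h3 p hp).1.leadingCoeff)]
      simp
  conv_rhs => rw [h4, Finset.sum_multiset_map_count]
  rw [← Finset.sum_image (s := placesUpTo F n) (g := FinitePlace.poly)
    (f := fun p => (UniqueFactorizationMonoid.normalizedFactors f).count p * p.natDegree)
    (fun v _ w _ h => FinitePlace.ext_poly h)]
  symm
  refine Finset.sum_subset (fun p hp => ?_) (fun p _ hp => ?_)
  · rw [Multiset.mem_toFinset] at hp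
    refine Finset.mem_image.2 ⟨⟨p, (h3 p hp).1, (h3 p hp).2⟩, ?_, rfl⟩
    exact mem_placesUpTo.2 (natDegree_le_of_dvd
      (UniqueFactorizationMonoid.dvd_of_mem_normalizedFactors hp) hf0)
  · rw [Multiset.mem_toFinset, ← Multiset.count_eq_zero] at hp
    rw [hp, zero_smul]

theorem filter_degree_dvd {i N : ℕ} (hi : 0 < i) (hN : i ≤ N) :
    {v ∈ placesUpTo F N | v.degree ∣ i} = {v ∈ placesUpTo F i | v.degree ∣ i} := by
  ext v
  simp only [Finset.mem_filter, mem_placesUpTo]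
  exact ⟨fun h => ⟨Nat.le_of_dvd hi h.2, h.2⟩, fun h => ⟨h.1.trans hN, h.2⟩⟩

/-- The sum of `Λ` over the monic polynomials of degree `n`. -/
def monicSum (Λ : F[X] → R) (n : ℕ) : R := ∑ f ∈ monics F n, Λ f

/-- The sum of `deg v * Λ (v) ^ (n / deg v)` over the finite places `v` of degree dividing `n`. -/
def powerSum (Λ : F[X] → R) (n : ℕ) : R :=
  ∑ v ∈ placesUpTo F n with v.degree ∣ n, (v.degree : R) * Λ v.poly ^ (n / v.degree)

theorem monicSum_zero {Λ : F[X] → R} (h : IsMonicMul Λ) : monicSum Λ 0 = 1 := by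
  have : monics F 0 = {1} := by
    ext p
    simp only [mem_monics, Finset.mem_singleton]
    exact ⟨fun hp => hp.1.natDegree_eq_zero.1 hp.2, fun hp => hp ▸ ⟨monic_one, natDegree_one⟩⟩
  rw [monicSum, this, Finset.sum_singleton, h.map_one]

open Classical in
theorem sum_monics_dvd {Λ : F[X] → R} (h : IsMonicMul Λ) {g : F[X]} (hg : g.Monic) (n : ℕ) :
    ∑ f ∈ monics F n with g ∣ f, Λ f =
      if g.natDegree ≤ n then Λ g * monicSum Λ (n - g.natDegree) else 0 := by
  split_ifs with hn
  · rw [monicSum, Finset.mul_sum]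
    symm
    refine Finset.sum_bij (fun f _ => g * f) ?_ ?_ ?_ ?_
    · intro f hf
      rw [mem_monics] at hf
      refine Finset.mem_filter.2 ⟨mem_monics.2 ⟨hg.mul hf.1, ?_⟩, dvd_mul_right _ _⟩
      rw [hg.natDegree_mul hf.1, hf.2]; omega
    · intro a _ b _ hab
      exact mul_left_cancel₀ hg.ne_zero hab
    · intro f hf
      obtain ⟨hf, u, rfl⟩ := Finset.mem_filter.1 hf
      rw [mem_monics] at hf
      have hu := hg.of_mul_monic_left hf.1
      refine ⟨u, mem_monics.2 ⟨hu, ?_⟩, rfl⟩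
      rw [← hf.2, hg.natDegree_mul hu]; omega
    · intro f hf
      rw [h.map_mul _ _ hg (mem_monics.1 hf).1]
  · refine Finset.sum_eq_zero fun f hf => absurd ?_ hn
    obtain ⟨hf, hd⟩ := Finset.mem_filter.1 hf
    rw [mem_monics] at hf
    exact hf.2 ▸ natDegree_le_of_dvd hd hf.1.ne_zero

/-- The identity `T L' = L · (T L' / L)` for the generating series of a multiplicative function. -/
theorem natCast_mul_monicSum {Λ : F[X] → R} (h : IsMonicMul Λ) (n : ℕ) :
    (n : R) * monicSum Λ n = ∑ i ∈ Finset.Icc 1 n, powerSum Λ i * monicSum Λ (n - i) := by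
  classical
  -- The factor `n = deg f` is spread over the prime powers `v^j` dividing `f`. After exchanging
  -- sums, the multiples of `v^j` contribute to the index `i = j * deg v`.
  have h1 : (n : R) * monicSum Λ n = ∑ f ∈ monics F n, ∑ v ∈ placesUpTo F n,
      ∑ j ∈ Finset.Icc 1 n, if v.poly ^ j ∣ f then (v.degree : R) * Λ f else 0 := by
    rw [monicSum, Finset.mul_sum]
    refine Finset.sum_congr rfl fun f hf => ?_
    obtain ⟨hf, hn⟩ := mem_monics.1 hf
    have := sum_multiplicity_eq hf
    rw [hn] at this
    conv_lhs => rw [← this]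
    push_cast
    simp only [Finset.sum_mul, ite_mul, zero_mul]
  rw [h1, Finset.sum_comm]
  have h2 : ∀ v ∈ placesUpTo F n, ∑ f ∈ monics F n, ∑ j ∈ Finset.Icc 1 n,
      (if v.poly ^ j ∣ f then (v.degree : R) * Λ f else 0) =
      ∑ i ∈ Finset.Icc 1 n with v.degree ∣ i,
        (v.degree : R) * Λ v.poly ^ (i / v.degree) * monicSum Λ (n - i) := by
    intro v _
    rw [Finset.sum_comm]
    have h3 : ∀ j, ∑ f ∈ monics F n, (if v.poly ^ j ∣ f then (v.degree : R) * Λ f else 0) =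
        if j * v.degree ≤ n then
          (v.degree : R) * Λ v.poly ^ j * monicSum Λ (n - j * v.degree) else 0 := by
      intro j
      rw [← Finset.sum_filter, ← Finset.mul_sum, sum_monics_dvd h (v.monic.pow j),
        v.monic.natDegree_pow, h.map_pow v.monic, mul_ite, mul_zero, mul_assoc]
      rfl
    rw [Finset.sum_congr rfl fun j _ => h3 j, ← Finset.sum_filter]
    have hd := v.degree_pos
    refine Finset.sum_nbij' (fun j => j * v.degree) (fun i => i / v.degree) ?_ ?_ ?_ ?_ ?_
    · intro j hj
      simp only [Finset.mem_filter, Finset.mem_Icc] at hj ⊢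
      exact ⟨⟨Nat.mul_pos hj.1.1 hd, hj.2⟩, dvd_mul_left _ _⟩
    · intro i hi
      simp only [Finset.mem_filter, Finset.mem_Icc] at hi ⊢
      rw [Nat.div_mul_cancel hi.2]
      exact ⟨⟨Nat.div_pos (Nat.le_of_dvd hi.1.1 hi.2) hd, (Nat.div_le_self _ _).trans hi.1.2⟩,
        hi.1.2⟩
    · intro j _
      exact Nat.mul_div_cancel _ hd
    · intro i hi
      exact Nat.div_mul_cancel (Finset.mem_filter.1 hi).2
    · intro j _
      rw [Nat.mul_div_cancel _ hd]
  rw [Finset.sum_congr rfl h2]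
  simp only [Finset.sum_filter]
  rw [Finset.sum_comm]
  refine Finset.sum_congr rfl fun i hi => ?_
  rw [Finset.mem_Icc] at hi
  rw [← Finset.sum_filter, filter_degree_dvd hi.1 hi.2, powerSum, Finset.sum_mul]

/-- If the generating series of a multiplicative function is `(1 - ω T) (1 - ω' T)`, then its power
sums are `-(ω ^ n + ω' ^ n)`. -/
theorem powerSum_eq_neg {Λ : F[X] → R} (h : IsMonicMul Λ)
    (hc : ∀ n, 3 ≤ n → monicSum Λ n = 0) {ω ω' : R} (h1 : ω + ω' = -monicSum Λ 1)
    (h2 : ω * ω' = monicSum Λ 2) {n : ℕ} (hn : 1 ≤ n) :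
    powerSum Λ n = -(ω ^ n + ω' ^ n) := by
  have h0 := monicSum_zero h
  have e1 : powerSum Λ 1 = monicSum Λ 1 := by
    have := natCast_mul_monicSum h 1
    simpa [h0] using this.symm
  have e2 : 2 * monicSum Λ 2 = powerSum Λ 1 * monicSum Λ 1 + powerSum Λ 2 := by
    have := natCast_mul_monicSum h 2
    rw [Finset.sum_Icc_succ_top (by norm_num)] at this
    simpa [h0] using this
  -- From degree 3 on the left side of the identity vanishes and only its last three terms survive:
  -- this is Newton's recurrence for two roots.
  have hrec : ∀ m, powerSum Λ (m + 3) =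
      -(monicSum Λ 1 * powerSum Λ (m + 2) + monicSum Λ 2 * powerSum Λ (m + 1)) := by
    intro m
    have h3 := natCast_mul_monicSum h (m + 3)
    rw [hc _ (by omega), mul_zero, Finset.sum_Icc_succ_top (by omega),
      Finset.sum_Icc_succ_top (by omega), Finset.sum_Icc_succ_top (by omega),
      Finset.sum_eq_zero, show m + 3 - (m + 1) = 2 by omega, show m + 3 - (m + 1 + 1) = 1 by omega,
      show m + 3 - (m + 2 + 1) = 0 by omega, h0] at h3
    · linear_combination -h3
    · intro i hi
      rw [Finset.mem_Icc] at hi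
      rw [hc _ (by omega), mul_zero]
  have key : ∀ m, powerSum Λ (m + 1) = -(ω ^ (m + 1) + ω' ^ (m + 1)) ∧
      powerSum Λ (m + 2) = -(ω ^ (m + 2) + ω' ^ (m + 2)) := by
    intro m
    induction m with
    | zero =>
      refine ⟨by linear_combination e1 + h1, ?_⟩
      rw [e1] at e2
      linear_combination -e2 - 2 * h2 + (ω + ω' - monicSum Λ 1) * h1
    | succ m ih =>
      refine ⟨ih.2, ?_⟩
      rw [show m + 1 + 2 = m + 3 by ring, hrec, ih.1, ih.2, ← h2,
        show monicSum Λ 1 = -(ω + ω') by rw [h1, neg_neg]]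
      ring
  obtain ⟨m, rfl⟩ := Nat.exists_eq_add_of_le' hn
  exact (key m).1

/-- The Hasse–Davenport relation for multiplicative functions with quadratic generating series. -/
theorem sum_extension_eq_neg {Λ : F[X] → R} (h : IsMonicMul Λ)
    (hc : ∀ n, 3 ≤ n → monicSum Λ n = 0) {ω ω' : R} (h1 : ω + ω' = -monicSum Λ 1)
    (h2 : ω * ω' = monicSum Λ 2) {k : Type*} [Field k] [Algebra F k] [Fintype k] :
    ∑ x : k, Λ (minpoly F x) ^ (Module.finrank F k / (minpoly F x).natDegree) =
      -(ω ^ Module.finrank F k + ω' ^ Module.finrank F k) := by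
  rw [← powerSum_eq_neg h hc h1 h2 Module.finrank_pos, powerSum]
  simp only [← nsmul_eq_mul]
  exact sum_placeOf (F := F) (k := k) (fun v => Λ v.poly ^ (Module.finrank F k / v.degree)) le_rfl

theorem sum_monics_one {M : Type*} [AddCommMonoid M] [Fintype F] (g : F[X] → M) :
    ∑ f ∈ monics F 1, g f = ∑ b : F, g (X - C b) := by
  symm
  refine Finset.sum_bij (fun b _ => X - C b) ?_ ?_ ?_ (fun _ _ => rfl)
  · intro b _
    exact mem_monics.2 ⟨monic_X_sub_C b, natDegree_X_sub_C b⟩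
  · intro a _ b _ hab
    simpa using hab
  · intro f hf
    obtain ⟨hf, hd⟩ := mem_monics.1 hf
    refine ⟨-f.coeff 0, Finset.mem_univ _, ?_⟩
    rw [map_neg, sub_neg_eq_add]
    exact (hf.eq_X_add_C hd).symm

theorem sum_monics_two {M : Type*} [AddCommMonoid M] [Fintype F] (g : F[X] → M) :
    ∑ f ∈ monics F 2, g f = ∑ c : F, ∑ b : F, g (X ^ 2 + C b * X + C c) := by
  rw [← Finset.sum_product']
  symm
  refine Finset.sum_bij (fun b _ => X ^ 2 + C b.2 * X + C b.1) ?_ ?_ ?_ (fun _ _ => rfl)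
  · intro b _
    refine mem_monics.2 ⟨by monicity!, by compute_degree!⟩
  · intro a _ b _ hab
    refine Prod.ext ?_ ?_
    · simpa using congr_arg (coeff · 0) hab
    · simpa [coeff_X, coeff_C] using congr_arg (coeff · 1) hab
  · intro f hf
    obtain ⟨hf, hd⟩ := mem_monics.1 hf
    refine ⟨(f.coeff 0, f.coeff 1), Finset.mem_univ _, ?_⟩
    have h2 : f.coeff 2 = 1 := by rw [← hd]; exact hf
    conv_rhs => rw [f.as_sum_range_C_mul_X_pow, hd]
    simp only [Finset.sum_range_succ, Finset.sum_range_zero, h2]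
    simp; ring

end Multiplicative

/-! ### Traces of `x` and `1 / x` in terms of the minimal polynomial of `x` -/

section Trace

open Polynomial

variable {F k : Type*} [Field F] [Field k] [Algebra F k]

theorem natDegree_minpoly_inv_le [FiniteDimensional F k] (x : k) :
    (minpoly F x⁻¹).natDegree ≤ (minpoly F x).natDegree := by
  rcases eq_or_ne x 0 with rfl | hx
  · simp
  let : Invertible x := invertibleOfNonzero hx
  have hroot : aeval x⁻¹ (minpoly F x).reverse = 0 := by
    rw [← invOf_eq_inv x, aeval_def, eval₂_reverse_eq_zero_iff, ← aeval_def, minpoly.aeval]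
  refine (natDegree_le_of_dvd (minpoly.dvd F _ hroot) ?_).trans (reverse_natDegree_le _)
  rw [Ne, reverse_eq_zero]
  exact minpoly.ne_zero (Algebra.IsIntegral.isIntegral x)

theorem natDegree_minpoly_inv [FiniteDimensional F k] (x : k) :
    (minpoly F x⁻¹).natDegree = (minpoly F x).natDegree :=
  (natDegree_minpoly_inv_le x).antisymm (by simpa using natDegree_minpoly_inv_le (F := F) x⁻¹)

/-- The minimal polynomial of `x⁻¹` is the reverse of that of `x`, divided by its constant
coefficient. This lets the trace of `α / x` be read off the low coefficients of `minpoly F x`. -/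
theorem nextCoeff_minpoly_inv [FiniteDimensional F k] {x : k} (hx : x ≠ 0) :
    (minpoly F x⁻¹).nextCoeff = (minpoly F x).coeff 1 / (minpoly F x).coeff 0 := by
  have hint := Algebra.IsIntegral.isIntegral (R := F) x
  have h0 : (minpoly F x).coeff 0 ≠ 0 := minpoly.coeff_zero_ne_zero hint hx
  have hd : (minpoly F x).reverse.natDegree = (minpoly F x).natDegree := by
    rw [reverse_natDegree, natTrailingDegree_eq_zero.2 (Or.inr h0), Nat.sub_zero]
  let : Invertible x := invertibleOfNonzero hx
  have hroot : aeval x⁻¹ (C ((minpoly F x).coeff 0)⁻¹ * (minpoly F x).reverse) = 0 := by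
    have h1 : aeval x⁻¹ (minpoly F x).reverse = 0 := by
      rw [← invOf_eq_inv x, aeval_def, eval₂_reverse_eq_zero_iff, ← aeval_def, minpoly.aeval]
    rw [map_mul, h1, mul_zero]
  have hmonic : (C ((minpoly F x).coeff 0)⁻¹ * (minpoly F x).reverse).Monic := by
    rw [Monic, leadingCoeff_mul, leadingCoeff_C, reverse_leadingCoeff, trailingCoeff,
      natTrailingDegree_eq_zero.2 (Or.inr h0), inv_mul_cancel₀ h0]
  have hnd : (C ((minpoly F x).coeff 0)⁻¹ * (minpoly F x).reverse).natDegree =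
      (minpoly F x).natDegree := by
    rw [natDegree_C_mul (inv_ne_zero h0), hd]
  have heq : minpoly F x⁻¹ = C ((minpoly F x).coeff 0)⁻¹ * (minpoly F x).reverse := by
    have hm' := minpoly.monic (Algebra.IsIntegral.isIntegral (R := F) x⁻¹)
    refine (eq_of_monic_of_dvd_of_natDegree_le hm' hmonic (minpoly.dvd F _ hroot) ?_).symm
    rw [hnd, natDegree_minpoly_inv]
  have hpos : 0 < (minpoly F x).natDegree := minpoly.natDegree_pos hint
  rw [heq, nextCoeff_C_mul, nextCoeff_of_natDegree_pos (by rwa [hd]), hd, coeff_reverse,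
    revAt_le (Nat.sub_le _ _), Nat.sub_sub_self hpos]
  field_simp

theorem finrank_div_natDegree_minpoly [FiniteDimensional F k] (x : k) :
    Module.finrank F k / (minpoly F x).natDegree =
      Module.finrank (IntermediateField.adjoin F {x}) k := by
  have hint := Algebra.IsIntegral.isIntegral (R := F) x
  rw [← Module.finrank_mul_finrank F (IntermediateField.adjoin F {x}) k,
    IntermediateField.adjoin.finrank hint, Nat.mul_div_cancel_left _ (minpoly.natDegree_pos hint)]

theorem trace_eq_mul_nextCoeff [FiniteDimensional F k] (x : k) :
    Algebra.trace F k x = (Module.finrank F k / (minpoly F x).natDegree : ℕ) *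
      -(minpoly F x).nextCoeff := by
  rw [finrank_div_natDegree_minpoly, trace_eq_finrank_mul_minpoly_nextCoeff]

theorem trace_inv_eq [FiniteDimensional F k] {x : k} (hx : x ≠ 0) :
    Algebra.trace F k x⁻¹ = (Module.finrank F k / (minpoly F x).natDegree : ℕ) *
      -((minpoly F x).coeff 1 / (minpoly F x).coeff 0) := by
  rw [trace_eq_mul_nextCoeff, natDegree_minpoly_inv, nextCoeff_minpoly_inv hx]

end Trace

/-! ### The Hasse–Davenport relation for Kloosterman sums -/

section Kloosterman

open Polynomial

/-- The composition of an additive character with the trace of a field extension. -/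
def traceChar {F : Type*} [Field F] (ψ : AddChar F ℂ) (k : Type*) [Field k] [Algebra F k] :
    AddChar k ℂ :=
  ψ.compAddMonoidHom (Algebra.trace F k).toAddMonoidHom

theorem traceChar_apply {F : Type*} [Field F] (ψ : AddChar F ℂ) {k : Type*} [Field k]
    [Algebra F k] (x : k) : traceChar ψ k x = ψ (Algebra.trace F k x) := rfl

theorem traceChar_ne_one {F : Type*} [Field F] [Finite F] {ψ : AddChar F ℂ} (hψ : ψ ≠ 1)
    (k : Type*) [Field k] [Algebra F k] [Finite k] : traceChar ψ k ≠ 1 := by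
  obtain ⟨a, ha⟩ := AddChar.ne_one_iff.1 hψ
  obtain ⟨x, rfl⟩ := Algebra.trace_surjective F k a
  exact AddChar.ne_one_iff.2 ⟨x, ha⟩

theorem kloostermanSum_eq {k : Type*} [Field k] [Fintype k] [DecidableEq k] (ψ : AddChar k ℂ)
    (α : k) : kloostermanSum ψ α = -∑ x : k, if x = 0 then 0 else ψ (x + α / x) := by
  rw [kloostermanSum, neg_inj]
  symm
  simp only [← ite_not _ _ (0 : ℂ)]
  rw [← Finset.sum_filter]
  refine Finset.sum_bij' (fun x hx => Units.mk0 x (Finset.mem_filter.1 hx).2) (fun x _ => (x : k))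
    ?_ ?_ ?_ ?_ ?_ <;> simp

variable {F : Type*} [Field F]

open Classical in
/-- The multiplicative function on polynomials with generating series the `L`-function of a
Kloosterman sum. -/
def kloostermanLambda (ψ : AddChar F ℂ) (α : F) (f : F[X]) : ℂ :=
  if f.coeff 0 = 0 then 0 else ψ (-f.nextCoeff - α * (f.coeff 1 / f.coeff 0))

/-- Both `nextCoeff` and the logarithmic derivative at 0, `coeff 1 / coeff 0`, turn products of
monic polynomials into sums. -/
theorem isMonicMul_kloostermanLambda (ψ : AddChar F ℂ) (α : F) :
    IsMonicMul (kloostermanLambda ψ α) where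
  map_one := by simp [kloostermanLambda, coeff_one, nextCoeff]
  map_mul f g hf hg := by
    simp only [kloostermanLambda, mul_coeff_zero, mul_coeff_one, hf.nextCoeff_mul hg, mul_eq_zero]
    by_cases h1 : f.coeff 0 = 0
    · simp [h1]
    by_cases h2 : g.coeff 0 = 0
    · simp [h2]
    rw [if_neg (by simp [h1, h2]), if_neg h1, if_neg h2, ← AddChar.map_add_eq_mul]
    congr 1
    field_simp
    ring

theorem kloostermanLambda_minpoly [Finite F] (ψ : AddChar F ℂ) (α : F) {k : Type*} [Field k]
    [Algebra F k] [Finite k] [DecidableEq k] (x : k) :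
    kloostermanLambda ψ α (minpoly F x) ^ (Module.finrank F k / (minpoly F x).natDegree) =
      if x = 0 then 0 else traceChar ψ k (x + algebraMap F k α / x) := by
  have hint := Algebra.IsIntegral.isIntegral (R := F) x
  have hm : Module.finrank F k / (minpoly F x).natDegree ≠ 0 := by
    rw [finrank_div_natDegree_minpoly]
    exact Module.finrank_pos.ne'
  split_ifs with hx
  · rw [kloostermanLambda, if_pos (by simp [hx]), zero_pow hm]
  · rw [kloostermanLambda, if_neg (minpoly.coeff_zero_ne_zero hint hx), ← AddChar.map_nsmul_eq_pow,
      traceChar_apply, map_add, div_eq_mul_inv (algebraMap F k α), ← Algebra.smul_def, LinearMap.map_smul, trace_inv_eq hx,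
      trace_eq_mul_nextCoeff, smul_eq_mul, nsmul_eq_mul]
    congr 1
    ring

variable [Finite F]

theorem monicSum_kloostermanLambda_one (ψ : AddChar F ℂ) (α : F) :
    monicSum (kloostermanLambda ψ α) 1 = -kloostermanSum ψ α := by
  classical
  let := Fintype.ofFinite F
  rw [monicSum, sum_monics_one, kloostermanSum_eq, neg_neg]
  refine Finset.sum_congr rfl fun b _ => ?_
  simp only [kloostermanLambda, coeff_sub, coeff_X_zero, coeff_C_zero, zero_sub, neg_eq_zero,
    nextCoeff_X_sub_C, coeff_X_one, coeff_C_succ, sub_zero]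
  split_ifs
  · rfl
  · congr 1
    field_simp
    ring

/-- On `X² + b X + c` with `c ≠ 0` the value is `ψ (-b (1 + α / c))`. The sum over `b` vanishes
unless `c = -α`, where all `q` terms are 1. -/
theorem monicSum_kloostermanLambda_two {ψ : AddChar F ℂ} (hψ : ψ ≠ 1) {α : F} (hα : α ≠ 0) :
    monicSum (kloostermanLambda ψ α) 2 = Nat.card F := by
  classical
  let := Fintype.ofFinite F
  rw [monicSum, sum_monics_two, Finset.sum_eq_single (-α)]
  · rw [Nat.card_eq_fintype_card, Finset.sum_congr rfl (g := fun _ => (1 : ℂ)), Finset.sum_const]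
    · simp
    · intro b _
      have hd : (X ^ 2 + C b * X + C (-α)).natDegree = 2 := by compute_degree!
      rw [kloostermanLambda, if_neg (by simpa using hα), nextCoeff_of_natDegree_pos (by omega), hd]
      simp [coeff_X, coeff_C, -map_neg]
      field_simp
      simp
  · intro c _ hc
    by_cases hc0 : c = 0
    · refine Finset.sum_eq_zero fun b _ => ?_
      simp [kloostermanLambda, hc0]
    have h1 : ∀ b : F, kloostermanLambda ψ α (X ^ 2 + C b * X + C c) =
        AddChar.mulShift ψ (-(1 + α / c)) b := by
      intro b
      have hd : (X ^ 2 + C b * X + C c).natDegree = 2 := by compute_degree!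
      rw [kloostermanLambda, if_neg (by simpa using hc0), nextCoeff_of_natDegree_pos (by omega), hd,
        AddChar.mulShift_apply]
      congr 1
      simp [coeff_X, coeff_C]
      ring
    rw [Finset.sum_congr rfl fun b _ => h1 b]
    refine AddChar.sum_eq_zero_of_ne_one (AddChar.IsPrimitive.of_ne_one hψ ?_)
    rw [neg_ne_zero]
    intro h
    apply hc
    field_simp at h
    linear_combination h
  · simp

/-- Adding `a X^(n-1)` permutes the monic polynomials of degree `n`. As `n - 1 ≥ 2` it leaves the
coefficients 0 and 1 alone, so it only multiplies each value by a constant, different from 1 for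
suitable `a`. -/
theorem monicSum_kloostermanLambda_of_three_le {ψ : AddChar F ℂ} (hψ : ψ ≠ 1) (α : F) {n : ℕ}
    (hn : 3 ≤ n) : monicSum (kloostermanLambda ψ α) n = 0 := by
  classical
  obtain ⟨a, ha⟩ := AddChar.ne_one_iff.1 hψ
  have key : monicSum (kloostermanLambda ψ α) n = ψ a * monicSum (kloostermanLambda ψ α) n := by
    rw [monicSum, Finset.mul_sum]
    have hdeg : ∀ (f : F[X]) (b : F), f ∈ monics F n → f + C b * X ^ (n - 1) ∈ monics F n := by
      intro f b hf
      obtain ⟨hf, hd⟩ := mem_monics.1 hf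
      have hlt : (C b * X ^ (n - 1)).degree < f.degree := by
        refine (degree_C_mul_X_pow_le _ _).trans_lt ?_
        rw [degree_eq_natDegree hf.ne_zero, hd]
        exact_mod_cast (by omega : n - 1 < n)
      exact mem_monics.2 ⟨hf.add_of_left hlt, by
        rw [natDegree_add_eq_left_of_degree_lt hlt, hd]⟩
    refine Finset.sum_nbij' (fun f => f + C a * X ^ (n - 1)) (fun f => f + C (-a) * X ^ (n - 1))
      (fun f hf => hdeg f _ hf) (fun f hf => hdeg f _ hf) ?_ ?_ ?_
    · intro f _; simp
    · intro f _; simp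
    · intro f hf
      have h1 := (mem_monics.1 hf).2
      have h2 := (mem_monics.1 (hdeg f a hf)).2
      have e0 : (f + C a * X ^ (n - 1)).coeff 0 = f.coeff 0 := by
        simp [coeff_X_pow, show (0 : ℕ) ≠ n - 1 by omega]
      have e1 : (f + C a * X ^ (n - 1)).coeff 1 = f.coeff 1 := by
        simp [coeff_X_pow, show (1 : ℕ) ≠ n - 1 by omega]
      have e2 : (f + C a * X ^ (n - 1)).nextCoeff = f.nextCoeff + a := by
        rw [nextCoeff_of_natDegree_pos (by omega), nextCoeff_of_natDegree_pos (by omega), h1, h2]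
        simp
      rw [kloostermanLambda, kloostermanLambda, e0, e1, e2]
      split_ifs
      · simp
      · rw [← AddChar.map_add_eq_mul]
        congr 1
        ring
  have : (ψ a - 1) * monicSum (kloostermanLambda ψ α) n = 0 := by linear_combination -key
  exact (mul_eq_zero.1 this).resolve_left (sub_ne_zero.2 ha)

/-- The Hasse–Davenport relation for Kloosterman sums. -/
theorem kloostermanSum_extension {ψ : AddChar F ℂ} (hψ : ψ ≠ 1) {α : F} (hα : α ≠ 0) {ω ω' : ℂ}
    (h1 : ω + ω' = kloostermanSum ψ α) (h2 : ω * ω' = Nat.card F)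
    (k : Type*) [Field k] [Algebra F k] [Finite k] :
    kloostermanSum (traceChar ψ k) (algebraMap F k α) =
      ω ^ Module.finrank F k + ω' ^ Module.finrank F k := by
  classical
  let := Fintype.ofFinite k
  have := sum_extension_eq_neg (isMonicMul_kloostermanLambda ψ α)
    (fun n hn => monicSum_kloostermanLambda_of_three_le hψ α hn)
    (by rw [h1, monicSum_kloostermanLambda_one, neg_neg])
    (by rw [h2, monicSum_kloostermanLambda_two hψ hα]) (k := k)
  rw [kloostermanSum_eq, ← neg_eq_iff_eq_neg.2 this]
  simp only [kloostermanLambda_minpoly]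

end Kloosterman

/-! ### Laurent expansions at infinity on the Artin–Schreier curve -/

section CurveAtInfinity

open Polynomial Polynomial.Bivariate WithZero

/-- Terms of pairwise distinct valuations cannot cancel, so the largest one dominates. -/
theorem exists_valuation_sum_eq_exp {L : Type*} [Field L]
    (v : Valuation L (WithZero (Multiplicative ℤ))) {ι : Type*} {s : Finset ι} (hs : s.Nonempty) {f : ι → L} {w : ι → ℕ}
    (hf : ∀ i ∈ s, v (f i) = exp (w i : ℤ)) (hw : Set.InjOn w s) :
    ∃ j ∈ s, v (∑ i ∈ s, f i) = exp (w j : ℤ) ∧ ∀ i ∈ s, w i ≤ w j := by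
  classical
  obtain ⟨j, hj, hmax⟩ := s.exists_max_image w hs
  refine ⟨j, hj, ?_, hmax⟩
  rw [← hf j hj]
  refine v.map_sum_eq_of_lt hj fun i hi => ?_
  rw [Finset.mem_sdiff, Finset.mem_singleton] at hi
  rw [hf i hi.1, hf j hj, exp_lt_exp]
  exact_mod_cast lt_of_le_of_ne (hmax i hi.1) fun h => hi.2 (hw hi.1 hj h)

variable {F : Type*} [Field F]

theorem valuation_algebraMap_eq_one {a : F} (ha : a ≠ 0) :
    Valued.v (algebraMap F (LaurentSeries F) a) = (1 : WithZero (Multiplicative ℤ)) := by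
  have h : ∀ b : F, Valued.v (algebraMap F (LaurentSeries F) b) ≤ (1 : WithZero (Multiplicative ℤ)) := by
    intro b
    rw [LaurentSeries.val_le_one_iff_eq_coe]
    exact ⟨PowerSeries.C b, by simp [LaurentSeries.algebraMap_apply]⟩
  refine (h a).antisymm ?_
  have h1 := h a⁻¹
  rw [map_inv₀, map_inv₀] at h1
  exact (inv_le_one₀ (zero_lt_iff.2 ((_root_.map_ne_zero _).2 ((_root_.map_ne_zero _).2 ha)))).1 h1

/-- The Laurent expansion at infinity of a root of `x² - P x + α` with a pole of the order of
that of `P`. -/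
theorem exists_root_laurentSeries (α : F) {P : LaurentSeries F} {n : ℕ} (hn : 0 < n)
    (hP : Valued.v P = exp (n : ℤ)) :
    ∃ x : LaurentSeries F, Valued.v x = exp (n : ℤ) ∧ x ^ 2 - P * x + algebraMap F _ α = 0 := by
  have hP0 : P ≠ 0 := by
    rintro rfl
    rw [map_zero] at hP
    exact exp_ne_zero hP.symm
  set s : LaurentSeries F := algebraMap F _ α / P ^ 2 with hs
  have hvs : Valued.v s < (1 : WithZero (Multiplicative ℤ)) := by
    rcases eq_or_ne α 0 with h0 | h0
    · simp [hs, h0]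
    rw [hs, map_div₀, valuation_algebraMap_eq_one h0, map_pow, hP, ← exp_nsmul, one_div, ← exp_neg,
      ← exp_zero, exp_lt_exp]
    simp; omega
  obtain ⟨S, hS⟩ := (LaurentSeries.val_le_one_iff_eq_coe F s).1 hvs.le
  have hS0 : PowerSeries.constantCoeff S = 0 := by
    have h1 : Valued.v (S : LaurentSeries F) ≤ exp (-((1 : ℕ) : ℤ)) := by
      rw [hS]
      rw [← WithZero.lt_mul_exp_iff_le exp_ne_zero]
      simpa [← exp_add] using hvs
    rw [← PowerSeries.coeff_zero_eq_constantCoeff_apply]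
    exact (LaurentSeries.intValuation_le_iff_coeff_lt_eq_zero F S).1 h1 0 one_pos
  have hsub : PowerSeries.HasSubst S := PowerSeries.HasSubst.of_constantCoeff_zero' hS0
  -- With `s = α / P²`, putting `x = P (1 - s c)` turns the quadratic equation into `c = 1 + s c²`,
  -- which the Catalan series solves in every characteristic.
  set c : PowerSeries F := (PowerSeries.catalanSeries.map (Nat.castRingHom F)).subst S with hc
  have hcc : c ^ 2 * S + 1 = c := by
    have h1 := congr_arg (fun f => (PowerSeries.map (Nat.castRingHom F) f).subst S)
      PowerSeries.catalanSeries_sq_mul_X_add_one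
    simp only [map_add, map_mul, map_pow, PowerSeries.map_X, map_one] at h1
    rw [PowerSeries.subst_add hsub, PowerSeries.subst_mul hsub, PowerSeries.subst_pow hsub,
      PowerSeries.subst_X hsub] at h1
    have h2 : PowerSeries.subst S (1 : PowerSeries F) = (1 : PowerSeries F) := by
      rw [← PowerSeries.coe_substAlgHom hsub, map_one]
    rwa [h2] at h1
  set c' : LaurentSeries F := (c : LaurentSeries F) with hc'
  have hcc' : c' ^ 2 * s + 1 = c' := by
    have := congr_arg (fun f : PowerSeries F => (f : LaurentSeries F)) hcc
    simpa [hS] using this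
  have hvc : Valued.v c' ≤ (1 : WithZero (Multiplicative ℤ)) :=
    (LaurentSeries.val_le_one_iff_eq_coe F c').2 ⟨c, rfl⟩
  have hvsc : Valued.v (s * c') < (1 : WithZero (Multiplicative ℤ)) := by
    rw [map_mul]
    exact mul_lt_one_of_lt_of_le hvs hvc
  refine ⟨P * (1 - s * c'), ?_, ?_⟩
  · rw [map_mul, hP, Valuation.map_sub_eq_of_lt_left, map_one, mul_one]
    rwa [map_one]
  · have h1 : algebraMap F (LaurentSeries F) α = s * P ^ 2 := by
      rw [hs, div_mul_cancel₀ _ (pow_ne_zero 2 hP0)]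
    rw [h1]
    linear_combination s * P ^ 2 * hcc'

/-- The lower order terms of `artinSchreierPoly`. -/
def artinSchreierTail (q : ℕ) (α c : F) : F[X][Y] :=
  -(C ((X : F[X]) ^ (q - 1)) * X) - C ((X : F[X]) ^ (q + 1) - C c * X ^ q + C α * X ^ (q - 1))

/-- The equation satisfied by `y = x z` if `z ^ q - z + c = x + α / x`. -/
def artinSchreierPoly (q : ℕ) (α c : F) : F[X][Y] := X ^ q + artinSchreierTail q α c

theorem degree_artinSchreierTail {q : ℕ} (hq : 2 ≤ q) (α c : F) :
    (artinSchreierTail q α c).degree < (q : ℕ) := by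
  refine (degree_sub_le _ _).trans_lt (max_lt ?_ ?_)
  · rw [degree_neg]
    exact (degree_C_mul_X_le _).trans_lt (by exact_mod_cast (by omega : 1 < q))
  · exact degree_C_le.trans_lt (by exact_mod_cast (by omega : 0 < q))

theorem monic_artinSchreierPoly {q : ℕ} (hq : 2 ≤ q) (α c : F) :
    (artinSchreierPoly q α c).Monic :=
  monic_X_pow_add (degree_artinSchreierTail hq α c)

theorem natDegree_artinSchreierPoly {q : ℕ} (hq : 2 ≤ q) (α c : F) :
    (artinSchreierPoly q α c).natDegree = q := by
  rw [artinSchreierPoly, natDegree_add_eq_left_of_degree_lt, natDegree_X_pow]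
  rw [degree_X_pow]
  exact degree_artinSchreierTail hq α c

theorem aevalAeval_artinSchreierPoly {A : Type*} [Field A] [Algebra F A] {q : ℕ} (hq : 2 ≤ q)
    (α c : F) {x z : A} (hx : x ≠ 0)
    (h : z ^ q - z + algebraMap F A c = x + algebraMap F A α / x) :
    aevalAeval x (x * z) (artinSchreierPoly q α c) = 0 := by
  obtain ⟨q, rfl⟩ := Nat.exists_eq_add_of_le' hq
  simp only [artinSchreierPoly, artinSchreierTail, map_add, map_sub, map_mul, map_neg, map_pow, aevalAeval_Y,
    aevalAeval_C, aeval_X, aeval_C, show q + 2 - 1 = q + 1 by omega]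
  have h2 : x * (z ^ (q + 2) - z + algebraMap F A c) = x ^ 2 + algebraMap F A α := by
    rw [h]; field_simp
  linear_combination x ^ (q + 1) * h2

/-- With `1 / z` as parameter at infinity, `x` is the root with a pole of order `q`, and `y = x z`
has a pole of order `q + 1`. These coprime orders make the monomials `x^i y^j` with `j < q`
distinguishable by their poles, and `y` is integral over `F[x]`. -/
theorem exists_laurentSeries_point {q : ℕ} (hq : 2 ≤ q) (α c : F) :
    ∃ x y : LaurentSeries F, Valued.v x = exp (q : ℤ) ∧ Valued.v y = exp ((q + 1 : ℕ) : ℤ) ∧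
      aevalAeval x y (artinSchreierPoly q α c) = 0 := by
  set z : LaurentSeries F := HahnSeries.single (-1) 1 with hz
  have hvz : Valued.v z = exp (1 : ℤ) := by
    rw [hz, LaurentSeries.valuation_single_zpow, neg_neg]
  have hP : Valued.v (z ^ q - z + algebraMap F _ c) = exp (q : ℤ) := by
    have h1 : Valued.v (z ^ q) = exp (q : ℤ) := by
      rw [map_pow, hvz, ← exp_nsmul]; simp
    have h2 : Valued.v (z ^ q - z) = exp (q : ℤ) := by
      rw [Valuation.map_sub_eq_of_lt_left, h1]
      rw [h1, hvz, exp_lt_exp]; exact_mod_cast (by omega : 1 < q)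
    rw [Valuation.map_add_eq_of_lt_left, h2]
    rw [h2]
    rcases eq_or_ne c 0 with h0 | h0
    · rw [h0, map_zero, map_zero]; exact exp_pos
    · rw [valuation_algebraMap_eq_one h0, ← exp_zero, exp_lt_exp]; exact_mod_cast (by omega : 0 < q)
  obtain ⟨x, hvx, hx⟩ := exists_root_laurentSeries α (by omega : 0 < q) hP
  have hx0 : x ≠ 0 := by
    rintro rfl
    rw [map_zero] at hvx
    exact exp_ne_zero hvx.symm
  refine ⟨x, x * z, hvx, ?_, aevalAeval_artinSchreierPoly hq α c hx0 ?_⟩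
  · rw [map_mul, hvx, hvz, ← exp_add]; norm_cast
  · field_simp
    linear_combination -hx

variable {q : ℕ} {x y : LaurentSeries F}

theorem valuation_monomial (hx : Valued.v x = exp (q : ℤ)) (hy : Valued.v y = exp ((q + 1 : ℕ) : ℤ))
    {a : F} (ha : a ≠ 0) (i j : ℕ) :
    Valued.v (algebraMap F _ a * x ^ i * y ^ j) = exp ((q * i + (q + 1) * j : ℕ) : ℤ) := by
  rw [map_mul, map_mul, valuation_algebraMap_eq_one ha, map_pow, map_pow, hx, hy, ← exp_nsmul,
    ← exp_nsmul, one_mul, ← exp_add]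
  congr 1
  simp
  ring

theorem weight_injective {i j i' j' : ℕ} (hj : j < q) (hj' : j' < q)
    (h : q * i + (q + 1) * j = q * i' + (q + 1) * j') : i = i' ∧ j = j' := by
  have h1 : j = j' := by
    have h2 : (q * (i + j) + j) % q = (q * (i' + j') + j') % q := by
      congr 1; linarith
    rwa [Nat.mul_add_mod, Nat.mul_add_mod, Nat.mod_eq_of_lt hj, Nat.mod_eq_of_lt hj'] at h2
  subst h1
  exact ⟨Nat.eq_of_mul_eq_mul_left (by omega) (by omega : q * i = q * i'), rfl⟩

/-- The pole order at infinity of a reduced polynomial in `x` and `y`. -/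
theorem exists_valuation_aevalAeval (hx : Valued.v x = exp (q : ℤ))
    (hy : Valued.v y = exp ((q + 1 : ℕ) : ℤ)) {p : F[X][Y]} (hp : p ≠ 0) (hd : p.natDegree < q) :
    ∃ w : ℕ, Valued.v (aevalAeval x y p) = exp (w : ℤ) ∧ ∀ j, q * (p.coeff j).natDegree ≤ w := by
  set s : Finset ((_ : ℕ) × ℕ) := p.support.sigma fun j => (p.coeff j).support with hs
  have hsum : aevalAeval x y p =
      ∑ u ∈ s, algebraMap F _ ((p.coeff u.1).coeff u.2) * x ^ u.2 * y ^ u.1 := by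
    conv_lhs => rw [p.as_sum_support_C_mul_X_pow, map_sum]
    rw [hs, Finset.sum_sigma]
    refine Finset.sum_congr rfl fun j _ => ?_
    rw [map_mul, map_pow, aevalAeval_C, aevalAeval_Y, (p.coeff j).as_sum_support_C_mul_X_pow,
      map_sum, Finset.sum_mul, ← (p.coeff j).as_sum_support_C_mul_X_pow]
    simp
  have hj : ∀ u ∈ s, u.1 < q := fun u hu =>
    (le_natDegree_of_mem_supp _ (Finset.mem_sigma.1 hu).1).trans_lt hd
  have hne : s.Nonempty := by
    obtain ⟨j, hj⟩ := nonempty_support_iff.2 hp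
    obtain ⟨i, hi⟩ := nonempty_support_iff.2 (mem_support_iff.1 hj)
    exact ⟨⟨j, i⟩, Finset.mem_sigma.2 ⟨hj, hi⟩⟩
  obtain ⟨u, hu, h1, h2⟩ := exists_valuation_sum_eq_exp Valued.v hne
    (f := fun u : (_ : ℕ) × ℕ => algebraMap F (LaurentSeries F) ((p.coeff u.1).coeff u.2) *
      x ^ u.2 * y ^ u.1) (w := fun u => q * u.2 + (q + 1) * u.1)
    (fun u hu => valuation_monomial hx hy (mem_support_iff.1 (Finset.mem_sigma.1 hu).2) _ _)
    (by
      rintro ⟨j, i⟩ hu ⟨j', i'⟩ hu' h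
      obtain ⟨rfl, rfl⟩ := weight_injective (hj _ hu) (hj _ hu') h
      rfl)
  refine ⟨_, hsum ▸ h1, fun j => ?_⟩
  rcases eq_or_ne (p.coeff j) 0 with h0 | h0
  · simp [h0]
  · have := h2 ⟨j, (p.coeff j).natDegree⟩ (Finset.mem_sigma.2
      ⟨mem_support_iff.2 h0, natDegree_mem_support_of_nonzero h0⟩)
    exact (Nat.le_add_right _ _).trans this

end CurveAtInfinity

/-! ### Stepanov's method in Bombieri's form -/

section Stepanov

open Polynomial Polynomial.Bivariate WithZero

variable {F : Type*} [Field F]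

/-- A monomial in `x` and `y` with a pole of order `w` at infinity, if `q ^ 2 ≤ w`. -/
def poleMonomial (F : Type*) [Field F] (q w : ℕ) : F[X][Y] :=
  C ((X : F[X]) ^ (w / q - w % q)) * X ^ (w % q)

/-- Writing `w = q i + (q + 1) j` forces `j = w % q` and `i = w / q - j`. The condition `q² ≤ w`
gives `w / q ≥ q > j`, so the truncated subtraction is a true one. -/
theorem valuation_poleMonomial {q w : ℕ} {x y : LaurentSeries F} (hx : Valued.v x = exp (q : ℤ))
    (hy : Valued.v y = exp ((q + 1 : ℕ) : ℤ)) (hq : 0 < q) (hw : q ^ 2 ≤ w) :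
    Valued.v (aevalAeval x y (poleMonomial F q w)) = exp (w : ℤ) := by
  have h1 := valuation_monomial hx hy (one_ne_zero (α := F)) (w / q - w % q) (w % q)
  rw [map_one, one_mul] at h1
  rw [poleMonomial, map_mul, aevalAeval_C, map_pow, map_pow, aeval_X, aevalAeval_Y, h1]
  have h2 : q ≤ w / q := (Nat.le_div_iff_mul_le hq).2 (by rwa [sq] at hw)
  have h3 := Nat.mod_lt w hq
  have h4 := Nat.div_add_mod w q
  congr 2
  obtain ⟨d, hd⟩ := Nat.exists_eq_add_of_le (h3.le.trans h2)
  rw [hd, Nat.add_sub_cancel_left]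
  rw [hd] at h4
  linarith

theorem natDegree_modByMonic_lt_card {q : ℕ} (hq : 2 ≤ q) (α c : F) (p : F[X][Y]) :
    (p %ₘ artinSchreierPoly q α c).natDegree < q := by
  have h := natDegree_modByMonic_lt p (monic_artinSchreierPoly hq α c) (by
    intro h
    have := natDegree_artinSchreierPoly hq α c
    rw [h, natDegree_one] at this
    omega)
  rwa [natDegree_artinSchreierPoly hq] at h

theorem aevalAeval_modByMonic {A : Type*} [Field A] [Algebra F A] {q : ℕ}
    {α c : F} {x y : A} (h : aevalAeval x y (artinSchreierPoly q α c) = 0) (p : F[X][Y]) :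
    aevalAeval x y (p %ₘ artinSchreierPoly q α c) = aevalAeval x y p := by
  conv_rhs => rw [← modByMonic_add_div p (artinSchreierPoly q α c)]
  rw [map_add, map_mul, h, zero_mul, add_zero]

theorem aevalAeval_eq_eval₂ {A : Type*} [Field A] [Algebra F A] (x y : A) (p : F[X][Y]) :
    aevalAeval x y p = eval₂ (aeval x : F[X] →ₐ[F] A).toRingHom y p := by
  have h : ((aevalAeval x y : F[X][Y] →ₐ[F] A) : F[X][Y] →+* A) =
      eval₂RingHom (aeval x : F[X] →ₐ[F] A).toRingHom y := by
    ext <;> simp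
  exact congr($h p)

theorem valuation_lt_one_of_coeff {f : LaurentSeries F} {N : ℕ} (h : Valued.v f ≤ exp (N : ℤ))
    (h0 : ∀ n : ℕ, n ≤ N → f.coeff (-(n : ℤ)) = 0) :
    Valued.v f < (1 : WithZero (Multiplicative ℤ)) := by
  have h1 : Valued.v f ≤ exp (-(1 : ℤ)) := by
    rw [LaurentSeries.valuation_le_iff_coeff_lt_eq_zero]
    intro n hn
    by_cases hN : n < -(N : ℤ)
    · exact LaurentSeries.coeff_zero_of_lt_valuation F (D := -(N : ℤ)) (by rwa [neg_neg]) hN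
    · obtain ⟨m, rfl⟩ : ∃ m : ℕ, n = -(m : ℤ) := ⟨n.natAbs, by omega⟩
      exact h0 m (by omega)
  refine h1.trans_lt ?_
  rw [← exp_zero, exp_lt_exp]
  norm_num

/-- The coefficients of a nontrivial relation between the products `e_t ^ R * e_s`. -/
theorem exists_relation {q : ℕ} (hq : 2 ≤ q) (α c : F) {a b R : ℕ}
    (hab : (q ^ 2 + b) * R + (q ^ 2 + a) + 1 < a * b) :
    ∃ u : Fin a × Fin b → F, u ≠ 0 ∧ artinSchreierPoly q α c ∣
      ∑ i, C (C (u i)) * (poleMonomial F q (q ^ 2 + i.2) ^ R * poleMonomial F q (q ^ 2 + i.1)) := by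
  obtain ⟨x, y, hx, hy, hxy⟩ := exists_laurentSeries_point hq α c
  set N := (q ^ 2 + b) * R + (q ^ 2 + a) with hN
  set e : Fin a × Fin b → F[X][Y] := fun i =>
    poleMonomial F q (q ^ 2 + i.2) ^ R * poleMonomial F q (q ^ 2 + i.1) with he
  -- The `N + 1` linear conditions kill the coefficients of orders `-N` to `0` at infinity, the
  -- constant term included. There are more unknowns than conditions.
  set M : Matrix (Fin (N + 1)) (Fin a × Fin b) F :=
    fun n i => (aevalAeval x y (e i)).coeff (-(n : ℤ)) with hM
  have hker : LinearMap.ker M.mulVecLin ≠ ⊥ := by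
    apply LinearMap.ker_ne_bot_of_finrank_lt
    simpa using hab
  obtain ⟨u, hu, hu0⟩ := Submodule.exists_mem_ne_zero_of_ne_bot hker
  refine ⟨u, hu0, ?_⟩
  change _ ∣ ∑ i, C (C (u i)) * e i
  set H := ∑ i, C (C (u i)) * e i with hH
  have hev : aevalAeval x y H = ∑ i, algebraMap F _ (u i) * aevalAeval x y (e i) := by
    rw [hH, map_sum]
    refine Finset.sum_congr rfl fun i _ => ?_
    rw [map_mul, aevalAeval_C, aeval_C]
  have hle : Valued.v (aevalAeval x y H) ≤ exp (N : ℤ) := by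
    rw [hev]
    refine Valuation.map_sum_le _ fun i _ => ?_
    have h1 : Valued.v (algebraMap F (LaurentSeries F) (u i)) ≤
        (1 : WithZero (Multiplicative ℤ)) := by
      rcases eq_or_ne (u i) 0 with h0 | h0
      · simp [h0]
      · exact (valuation_algebraMap_eq_one h0).le
    have h2 : Valued.v (aevalAeval x y (e i)) ≤ exp (N : ℤ) := by
      rw [he]
      simp only [map_mul, map_pow]
      rw [valuation_poleMonomial hx hy (by omega) (Nat.le_add_right _ _),
        valuation_poleMonomial hx hy (by omega) (Nat.le_add_right _ _), ← exp_nsmul, ← exp_add,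
        exp_le_exp, nsmul_eq_mul]
      have h3 : R * (q ^ 2 + (i.2 : ℕ)) + (q ^ 2 + (i.1 : ℕ)) ≤ N := by
        rw [hN, mul_comm R]
        gcongr <;> omega
      exact_mod_cast h3
    rw [map_mul]
    exact (mul_le_of_le_one_left' h1).trans h2
  have hcoeff : ∀ n : ℕ, n ≤ N → (aevalAeval x y H).coeff (-(n : ℤ)) = 0 := by
    intro n hn
    have h1 := congr_fun (LinearMap.mem_ker.1 hu) ⟨n, by omega⟩
    rw [Pi.zero_apply] at h1
    rw [hev, HahnSeries.coeff_sum, ← h1, Matrix.mulVecLin_apply, Matrix.mulVec, dotProduct]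
    refine Finset.sum_congr rfl fun i _ => ?_
    rw [LaurentSeries.algebraMap_apply, HahnSeries.C_mul_eq_smul, HahnSeries.coeff_smul,
      smul_eq_mul]
    exact mul_comm _ _
  have hlt := valuation_lt_one_of_coeff hle hcoeff
  -- A nonzero reduced polynomial in `x` and `y` has valuation `exp w` with `w ≥ 0`, hence no zero
  -- at infinity; so this combination, which vanishes there, is zero on the curve.
  rw [← modByMonic_eq_zero_iff_dvd (monic_artinSchreierPoly hq α c)]
  by_contra h0
  obtain ⟨w, hw, -⟩ := exists_valuation_aevalAeval hx hy h0 (natDegree_modByMonic_lt_card hq α c H)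
  rw [aevalAeval_modByMonic hxy] at hw
  rw [hw, ← exp_zero, exp_lt_exp] at hlt
  omega

/-- With the exponent `R` moved to the other factor, the pole orders `(q² + s) R + (q² + t)` with `t
< b ≤ R` are pairwise distinct: division by `R` recovers `s` and `t`. So the new combination is
nonzero on the curve, and its pole order bounds the degrees of its reduced coefficients. -/
theorem exists_coeff_modByMonic {q : ℕ} (hq : 2 ≤ q) (α c : F) {a b R : ℕ} (hb : b ≤ R)
    {u : Fin a × Fin b → F} (hu : u ≠ 0) :
    ∃ j, ((∑ i, C (C (u i)) * (poleMonomial F q (q ^ 2 + i.2) *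
      poleMonomial F q (q ^ 2 + i.1) ^ R)) %ₘ artinSchreierPoly q α c).coeff j ≠ 0 ∧
      q * (((∑ i, C (C (u i)) * (poleMonomial F q (q ^ 2 + i.2) *
      poleMonomial F q (q ^ 2 + i.1) ^ R)) %ₘ artinSchreierPoly q α c).coeff j).natDegree ≤
        (q ^ 2 + a) * R + (q ^ 2 + b) := by
  classical
  obtain ⟨x, y, hx, hy, hxy⟩ := exists_laurentSeries_point hq α c
  set G := ∑ i, C (C (u i)) * (poleMonomial F q (q ^ 2 + i.2) *
      poleMonomial F q (q ^ 2 + i.1) ^ R) with hG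
  have hev : aevalAeval x y G = ∑ i with u i ≠ 0, algebraMap F _ (u i) *
      (aevalAeval x y (poleMonomial F q (q ^ 2 + i.2)) *
        aevalAeval x y (poleMonomial F q (q ^ 2 + i.1)) ^ R) := by
    rw [hG, map_sum, Finset.sum_filter]
    refine Finset.sum_congr rfl fun i _ => ?_
    split_ifs with h
    · simp only [map_mul, map_pow, aevalAeval_C, aeval_C]
    · simp [not_not.1 h]
  obtain ⟨i, hi, hv, -⟩ := exists_valuation_sum_eq_exp (L := LaurentSeries F) Valued.v
    (s := {i | u i ≠ 0})
    (f := fun i => algebraMap F _ (u i) * (aevalAeval x y (poleMonomial F q (q ^ 2 + i.2)) *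
        aevalAeval x y (poleMonomial F q (q ^ 2 + i.1)) ^ R))
    (w := fun i => (q ^ 2 + i.1) * R + (q ^ 2 + i.2))
    (by
      obtain ⟨i, hi⟩ := Function.ne_iff.1 hu
      exact ⟨i, by simpa using hi⟩)
    (by
      intro i hi
      rw [map_mul, map_mul, map_pow, valuation_algebraMap_eq_one (by simpa using hi),
        valuation_poleMonomial hx hy (by omega) (Nat.le_add_right _ _),
        valuation_poleMonomial hx hy (by omega) (Nat.le_add_right _ _), ← exp_nsmul, one_mul,
        ← exp_add]
      congr 1
      push_cast
      rw [nsmul_eq_mul]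
      ring)
    (by
      rintro ⟨s, t⟩ - ⟨s', t'⟩ - h
      have h1 : (s : ℕ) * R + t = s' * R + t' := by
        simp only at h
        linarith
      have ht : (t : ℕ) < R := t.2.trans_le hb
      have ht' : (t' : ℕ) < R := t'.2.trans_le hb
      have h2 : (t : ℕ) = t' := by
        have := congr_arg (· % R) h1
        simpa [Nat.mod_eq_of_lt, ht, ht'] using this
      have h3 : (s : ℕ) = s' := by
        rw [h2, Nat.add_right_cancel_iff] at h1
        exact Nat.eq_of_mul_eq_mul_right (by omega) h1
      exact Prod.ext (Fin.ext h3) (Fin.ext h2))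
  rw [← hev, ← aevalAeval_modByMonic hxy] at hv
  have h0 : G %ₘ artinSchreierPoly q α c ≠ 0 := by
    intro h
    rw [h, map_zero, map_zero] at hv
    exact exp_ne_zero hv.symm
  obtain ⟨w, hw, hj⟩ := exists_valuation_aevalAeval hx hy h0 (natDegree_modByMonic_lt_card hq α c G)
  rw [hv, exp_inj] at hw
  obtain ⟨j, hj0⟩ : ∃ j, (G %ₘ artinSchreierPoly q α c).coeff j ≠ 0 := by
    by_contra! h
    exact h0 (Polynomial.ext h)
  refine ⟨j, hj0, (hj j).trans ?_⟩
  rw [← Nat.cast_inj (R := ℤ).1 hw]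
  gcongr <;> omega

/-- Stepanov's bound for the number of specialisations of `x` over which the Artin–Schreier curve
has all its points rational. -/
theorem card_mul_card_le [Finite F] (α c : F) {r : ℕ}
    (hr : 2 * Nat.card F ^ 2 + 1 < Nat.card F ^ r) {k : Type*} [Field k] [Algebra F k] [Finite k]
    (hk : Module.finrank F k = 2 * r) (S : Finset k)
    (hS : ∀ x ∈ S, ∃ T : Finset k, T.card = Nat.card F ∧
      ∀ y ∈ T, aevalAeval x y (artinSchreierPoly (Nat.card F) α c) = 0) :
    Nat.card F * S.card ≤ (Nat.card F ^ r) ^ 2 + (2 * Nat.card F ^ 2 + 5) * Nat.card F ^ r := by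
  classical
  let := Fintype.ofFinite F
  set q := Nat.card F with hqdef
  have hq : 2 ≤ q := Finite.one_lt_card
  set R := q ^ r with hR
  -- With `b = R`, this `a` makes `a b` exceed the number of conditions, since `R > 2 q² + 1`, while
  -- the resulting pole bound stays at `R²` plus a multiple of `R`.
  set a := R + q ^ 2 + 3 with ha
  obtain ⟨u, hu, hdvd⟩ := exists_relation hq α c (a := a) (b := R) (R := R) (by
    rw [ha]; nlinarith)
  obtain ⟨j, hj0, hj⟩ := exists_coeff_modByMonic hq α c le_rfl hu
  set G := ∑ i, C (C (u i)) * (poleMonomial F q (q ^ 2 + i.2) *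
      poleMonomial F q (q ^ 2 + i.1) ^ R) with hG
  set p := (G %ₘ artinSchreierPoly q α c).coeff j with hp
  set φ : k →ₐ[F] k := FiniteField.frobeniusAlgHom F k ^ r with hφ
  have hφ_apply : ∀ z, φ z = z ^ R := by
    intro z
    rw [hφ, AlgHom.coe_pow, FiniteField.coe_frobeniusAlgHom, pow_iterate, hR, hqdef,
      Nat.card_eq_fintype_card]
  have hRR : ∀ z : k, (z ^ R) ^ R = z := by
    intro z
    let := Fintype.ofFinite k
    rw [← pow_mul, ← pow_add, ← two_mul, ← hk, hqdef, ← Module.natCard_eq_pow_finrank,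
      Nat.card_eq_fintype_card, FiniteField.pow_card]
  -- On `k`, which has `R²` elements, raising to the power `R` is an involution fixing `F`. It takes
  -- the value of `G` to that of the vanishing combination of `exists_relation`.
  have hvan : ∀ x ∈ S, ∀ y, aevalAeval x y (artinSchreierPoly q α c) = 0 →
      aevalAeval x y G = 0 := by
    intro x _ y hxy
    have h1 : φ (aevalAeval x y G) = 0 := by
      have h2 : aevalAeval x y (∑ i, C (C (u i)) * (poleMonomial F q (q ^ 2 + i.2) ^ R *
          poleMonomial F q (q ^ 2 + i.1))) = 0 := by
        obtain ⟨t, ht⟩ := hdvd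
        rw [ht, map_mul, hxy, zero_mul]
      rw [← h2, hG]
      have h3 : ∀ z : k, φ z ^ R = z := fun z => by rw [hφ_apply, hRR]
      simp only [map_sum, map_mul, map_pow, aevalAeval_C, aeval_C, AlgHom.commutes, h3]
      simp only [hφ_apply]
    rw [hφ_apply] at h1
    exact eq_zero_of_pow_eq_zero h1
  -- Over `x` there are `q` values of `y`, but the reduced `G` has degree less than `q` in `y`; so
  -- each of its coefficients vanishes at `x`.
  have hroot : ∀ x ∈ S, aeval x p = 0 := by
    intro x hx
    obtain ⟨T, hT, hTx⟩ := hS x hx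
    have h1 : ((G %ₘ artinSchreierPoly q α c).map (aeval x : F[X] →ₐ[F] k).toRingHom) = 0 := by
      refine eq_zero_of_natDegree_lt_card_of_eval_eq_zero' _ T ?_ ?_
      · intro y hy
        have h2 := aevalAeval_modByMonic (hTx y hy) G
        rw [hvan x hx y (hTx y hy)] at h2
        rw [← h2, eval_map, aevalAeval_eq_eval₂]
      · rw [hT]
        exact natDegree_map_le.trans_lt (natDegree_modByMonic_lt_card hq α c G)
    have := congr_arg (coeff · j) h1
    simpa [coeff_map] using this
  have hcard : S.card ≤ p.natDegree := by
    have hp0 : p.map (algebraMap F k) ≠ 0 := (Polynomial.map_ne_zero_iff (algebraMap F k).injective).2 hj0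
    calc S.card ≤ (p.map (algebraMap F k)).roots.toFinset.card := by
          refine Finset.card_le_card fun x hx => ?_
          rw [Multiset.mem_toFinset, mem_roots hp0, IsRoot.def, eval_map_algebraMap, hroot x hx]
      _ ≤ (p.map (algebraMap F k)).natDegree := (Multiset.toFinset_card_le _).trans (card_roots' _)
      _ = p.natDegree := natDegree_map _
  calc q * S.card ≤ q * p.natDegree := Nat.mul_le_mul_left _ hcard
    _ ≤ _ := hj
    _ ≤ _ := by rw [ha]; nlinarith

end Stepanov

/-! ### Artin–Schreier points and a first bound for Kloosterman sums -/

section ArtinSchreier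

open Polynomial Polynomial.Bivariate

variable {F k : Type*} [Field F] [Finite F] [Field k] [Algebra F k] [Finite k]

theorem trace_pow_card (x : k) :
    Algebra.trace F k (x ^ Nat.card F) = Algebra.trace F k x := by
  let := Fintype.ofFinite F
  have h := Algebra.trace_eq_of_algEquiv (FiniteField.frobeniusAlgEquivOfAlgebraic F k) x
  rwa [FiniteField.coe_frobeniusAlgEquivOfAlgebraic, ← Nat.card_eq_fintype_card] at h

/-- The additive form of Hilbert's Theorem 90 for finite fields. -/
theorem exists_pow_card_sub_self_eq {β : k} (hβ : Algebra.trace F k β = 0) :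
    ∃ z : k, z ^ Nat.card F - z = β := by
  classical
  let := Fintype.ofFinite F
  let := Fintype.ofFinite k
  set φ : k →ₗ[F] k := (FiniteField.frobeniusAlgHom F k).toLinearMap - LinearMap.id with hφ
  have hφ_apply : ∀ z, φ z = z ^ Nat.card F - z := by
    intro z
    simp [hφ, Nat.card_eq_fintype_card]
  have hle : LinearMap.range φ ≤ LinearMap.ker (Algebra.trace F k) := by
    rintro _ ⟨z, rfl⟩
    rw [LinearMap.mem_ker, hφ_apply, map_sub, trace_pow_card, sub_self]
  -- The kernel consists of roots of `X^q - X`, so it has at most `q` elements. The range then has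
  -- the dimension of the kernel of the trace.
  have hker : Module.finrank F (LinearMap.ker φ) ≤ 1 := by
    have h1 : Nat.card (LinearMap.ker φ) ≤ Nat.card F ^ 1 := by
      have hp0 : (X ^ Nat.card F - X : k[X]) ≠ 0 :=
        FiniteField.X_pow_card_sub_X_ne_zero k Finite.one_lt_card
      have hp1 : (X ^ Nat.card F - X : k[X]).natDegree = Nat.card F :=
        FiniteField.X_pow_card_sub_X_natDegree_eq k Finite.one_lt_card
      rw [pow_one, Nat.card_eq_fintype_card, ← hp1]
      refine le_trans ?_ ((Multiset.toFinset_card_le _).trans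
        (card_roots' (X ^ Nat.card F - X : k[X])))
      rw [Fintype.card_subtype]
      refine Finset.card_le_card fun z hz => ?_
      rw [Finset.mem_filter, LinearMap.mem_ker, hφ_apply] at hz
      rw [Multiset.mem_toFinset, mem_roots hp0]
      simpa using hz.2
    rw [Module.natCard_eq_pow_finrank (K := F)] at h1
    exact (Nat.pow_le_pow_iff_right Finite.one_lt_card).1 h1
  have h1 := φ.finrank_range_add_finrank_ker
  have h2 := (Algebra.trace F k).finrank_range_add_finrank_ker
  rw [LinearMap.range_eq_top.2 (Algebra.trace_surjective F k), finrank_top,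
    Module.finrank_self] at h2
  have h3 := Submodule.eq_of_le_of_finrank_le hle (by omega)
  have h4 : β ∈ LinearMap.range φ := h3 ▸ LinearMap.mem_ker.2 hβ
  obtain ⟨z, hz⟩ := h4
  exact ⟨z, hφ_apply z ▸ hz⟩

open Classical in
/-- The number of `x` with a given value of the trace of `x + α / x`. -/
theorem card_trace_eq_le [Fintype k] (α c : F) {r : ℕ} (hr0 : ((2 * r : ℕ) : F) ≠ 0)
    (hr : 2 * Nat.card F ^ 2 + 1 < Nat.card F ^ r) (hk : Module.finrank F k = 2 * r) :
    Nat.card F * Finset.card {x : k | x ≠ 0 ∧ Algebra.trace F k (x + algebraMap F k α / x) = c} ≤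
      (Nat.card F ^ r) ^ 2 + (2 * Nat.card F ^ 2 + 5) * Nat.card F ^ r := by
  refine card_mul_card_le α (c / (2 * r : ℕ)) hr hk _ fun x hx => ?_
  obtain ⟨hx0, hx⟩ := (Finset.mem_filter.1 hx).2
  -- The constant `c / (2 r)` has trace `c` from the extension of degree `2 r`, hence the need for
  -- `2 r ≠ 0` in `F`. The translates of `z` by `F` then give `q` points over `x`.
  obtain ⟨z, hz⟩ := exists_pow_card_sub_self_eq (F := F)
    (β := x + algebraMap F k α / x - algebraMap F k (c / (2 * r : ℕ))) (by
      rw [map_sub, hx, Algebra.trace_algebraMap, hk, nsmul_eq_mul, mul_div_cancel₀ _ hr0, sub_self])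
  let := Fintype.ofFinite F
  refine ⟨Finset.univ.image fun e : F => x * (z + algebraMap F k e), ?_, ?_⟩
  · rw [Finset.card_image_of_injective, Finset.card_univ, Nat.card_eq_fintype_card]
    intro e e' h
    exact (algebraMap F k).injective (add_left_cancel (mul_left_cancel₀ hx0 h))
  · intro y hy
    obtain ⟨e, -, rfl⟩ := Finset.mem_image.1 hy
    refine aevalAeval_artinSchreierPoly Finite.one_lt_card α _ hx0 ?_
    have h1 : (z + algebraMap F k e) ^ Nat.card F = z ^ Nat.card F + algebraMap F k e := by
      have h2 := map_add (FiniteField.frobeniusAlgHom F k) z (algebraMap F k e)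
      rw [AlgHom.commutes] at h2
      simpa [Nat.card_eq_fintype_card] using h2
    rw [h1]
    linear_combination hz

theorem norm_addChar_apply {A : Type*} [AddCommGroup A] [Finite A] (ψ : AddChar A ℂ) (x : A) :
    ‖ψ x‖ = 1 := by
  have h : ψ x ^ Nat.card A = 1 := by
    rw [← AddChar.map_nsmul_eq_pow, card_nsmul_eq_zero', AddChar.map_zero_eq_one]
  exact Complex.norm_eq_one_of_pow_eq_one h Nat.card_pos.ne'

/-- An estimate of square root order for the Kloosterman sum over an extension. -/
theorem norm_kloostermanSum_le {ψ : AddChar F ℂ} (hψ : ψ ≠ 1) (α : F) {r : ℕ}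
    (hr0 : ((2 * r : ℕ) : F) ≠ 0) (hr : 2 * Nat.card F ^ 2 + 1 < Nat.card F ^ r)
    (hk : Module.finrank F k = 2 * r) :
    ‖kloostermanSum (traceChar ψ k) (algebraMap F k α)‖ ≤
      (2 * (Nat.card F : ℝ) ^ 2 + 5) * (Nat.card F : ℝ) ^ r + 1 := by
  classical
  let := Fintype.ofFinite F
  let := Fintype.ofFinite k
  set q := Nat.card F with hq
  set S : F → Finset k :=
    fun c => {x : k | x ≠ 0 ∧ Algebra.trace F k (x + algebraMap F k α / x) = c} with hS
  have h1 : kloostermanSum (traceChar ψ k) (algebraMap F k α) = -∑ c, ψ c * (S c).card := by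
    rw [kloostermanSum_eq]
    simp only [← ite_not _ _ (0 : ℂ)]
    rw [← Finset.sum_filter,
      ← Finset.sum_fiberwise _ (fun x => Algebra.trace F k (x + algebraMap F k α / x))]
    congr 1
    refine Finset.sum_congr rfl fun c _ => ?_
    rw [Finset.sum_congr rfl (g := fun _ => ψ c), Finset.sum_const, nsmul_eq_mul, mul_comm, hS,
      Finset.filter_filter]
    intro x hx
    rw [traceChar_apply, (Finset.mem_filter.1 hx).2]
  have h2 : ∑ c, ((S c).card : ℝ) = ((q : ℝ) ^ r) ^ 2 - 1 := by
    have h3 : ∑ c, (S c).card = Fintype.card k - 1 := by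
      rw [← Finset.card_univ, ← Finset.card_erase_of_mem (Finset.mem_univ (0 : k)),
        Finset.card_eq_sum_card_fiberwise (t := Finset.univ)
          (f := fun x => Algebra.trace F k (x + algebraMap F k α / x)) (by simp)]
      refine Finset.sum_congr rfl fun c _ => congr_arg _ ?_
      ext x
      simp [hS]
    have h4 : Fintype.card k = (q ^ r) ^ 2 := by
      rw [← Nat.card_eq_fintype_card, Module.natCard_eq_pow_finrank (K := F), hk, ← pow_mul,
        mul_comm]
    rw [← Nat.cast_sum, h3, Nat.cast_sub Fintype.card_pos, h4]
    push_cast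
    rfl
  set B : ℝ := (((q : ℝ) ^ r) ^ 2 + (2 * (q : ℝ) ^ 2 + 5) * (q : ℝ) ^ r) / q with hB
  have hq0 : (0 : ℝ) < q := by exact_mod_cast Nat.card_pos
  have h5 : ∀ c, ((S c).card : ℝ) ≤ B := by
    intro c
    rw [hB, le_div_iff₀ hq0, mul_comm]
    exact_mod_cast card_trace_eq_le α c hr0 hr hk
  -- As `ψ` sums to zero, each count may be replaced by its defect from the upper bound `B`. The
  -- defects are nonnegative, so the sum of norms is `q B` minus the known total.
  have h6 : ∑ c, ψ c * (S c).card = -∑ c, ψ c * ((B - (S c).card : ℝ) : ℂ) := by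
    push_cast
    simp only [mul_sub, Finset.sum_sub_distrib]
    rw [← Finset.sum_mul, AddChar.sum_eq_zero_of_ne_one hψ]
    ring
  rw [h1, h6, neg_neg]
  refine (norm_sum_le _ _).trans ?_
  have h7 : ∀ c, ‖ψ c * ((B - (S c).card : ℝ) : ℂ)‖ = B - (S c).card := by
    intro c
    rw [norm_mul, norm_addChar_apply, one_mul, Complex.norm_real, Real.norm_eq_abs,
      abs_of_nonneg (sub_nonneg.2 (h5 c))]
  rw [Finset.sum_congr rfl fun c _ => h7 c, Finset.sum_sub_distrib, h2, Finset.sum_const,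
    Finset.card_univ, ← Nat.card_eq_fintype_card, ← hq, nsmul_eq_mul, hB, mul_div_cancel₀ _ hq0.ne']
  linarith

end ArtinSchreier

/-! ### Weil's bound for Kloosterman sums, and its strictness -/

section Weil

theorem exists_extension (F : Type*) [Field F] [Finite F] {n : ℕ} (hn : 0 < n) :
    ∃ (k : Type) (_ : Field k) (_ : Algebra F k) (_ : Finite k), Module.finrank F k = n := by
  have : NeZero n := ⟨hn.ne'⟩
  have : Fact (ringChar F).Prime := ⟨CharP.char_is_prime F _⟩
  exact ⟨FiniteField.Extension F (ringChar F) n, inferInstance, inferInstance, inferInstance,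
    FiniteField.finrank_extension F (ringChar F) n⟩

variable {F : Type*} [Field F] [Finite F]

/-- If `|ω|² = ρ q` with `ρ > 1`, then `ω^(2r) + ω'^(2r)` grows like `(ρ q)^r`, while it is a
Kloosterman sum over the extension of degree `2 r` and is bounded by a constant times `q^r` for
infinitely many `r`. -/
theorem norm_sq_le_of_kloostermanSum (hF : ringChar F ≠ 2) {ψ : AddChar F ℂ} (hψ : ψ ≠ 1) {α : F}
    (hα : α ≠ 0) {ω ω' : ℂ} (h1 : ω + ω' = kloostermanSum ψ α) (h2 : ω * ω' = Nat.card F) :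
    ‖ω‖ ^ 2 ≤ Nat.card F := by
  set q := Nat.card F with hq
  have hq1 : 1 < q := Finite.one_lt_card
  have hq0 : (0 : ℝ) < q := by exact_mod_cast (by omega : 0 < q)
  by_contra! hlt
  set ρ : ℝ := ‖ω‖ ^ 2 / q with hρ
  have hρ1 : 1 < ρ := (one_lt_div hq0).2 hlt
  have hω : ‖ω‖ ^ 2 = q * ρ := by rw [hρ, mul_div_cancel₀ _ hq0.ne']
  have hω' : ‖ω'‖ ^ 2 ≤ q := by
    have h3 : ‖ω‖ ^ 2 * ‖ω'‖ ^ 2 = q * q := by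
      rw [← mul_pow, ← norm_mul, h2]
      simp [sq]
    by_contra! h4
    exact (mul_lt_mul'' hlt h4 hq0.le hq0.le).ne' h3
  -- Taking `r` to be 1 modulo the odd characteristic ensures `2 r ≠ 0` in `F`; `r ≥ 3` and `q ≥ 3`
  -- give the size condition.
  have hbound : ∀ r : ℕ, 3 ≤ r → (r : F) = 1 → ρ ^ r ≤ 2 * (q : ℝ) ^ 2 + 7 := by
    intro r hr hr1
    obtain ⟨k, _, _, _, hk⟩ := exists_extension F (n := 2 * r) (by omega)
    have h20 : ((2 * r : ℕ) : F) ≠ 0 := by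
      rw [Nat.cast_mul, hr1, mul_one]
      exact_mod_cast Ring.two_ne_zero hF
    have hqr : 2 * q ^ 2 + 1 < q ^ r := by
      have h5 : q ≠ 2 := by
        intro h
        apply hF
        have := Fintype.ofFinite F
        have h6 : (Fintype.card F) = 2 := by rw [← Nat.card_eq_fintype_card, ← hq, h]
        have h7 : ((2 : ℕ) : F) = 0 := by rw [← h6]; exact FiniteField.cast_card_eq_zero F
        exact absurd h7 (by exact_mod_cast Ring.two_ne_zero hF)
      calc 2 * q ^ 2 + 1 < 3 * q ^ 2 := by nlinarith
        _ ≤ q * q ^ 2 := by gcongr; omega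
        _ = q ^ 3 := by ring
        _ ≤ q ^ r := Nat.pow_le_pow_right (by omega) hr
    have h8 := norm_kloostermanSum_le hψ α h20 hqr hk
    rw [kloostermanSum_extension hψ hα h1 h2 k, hk] at h8
    have h9 : ‖ω‖ ^ (2 * r) ≤ ‖ω ^ (2 * r) + ω' ^ (2 * r)‖ + ‖ω'‖ ^ (2 * r) := by
      have := norm_sub_le (ω ^ (2 * r) + ω' ^ (2 * r)) (ω' ^ (2 * r))
      rwa [add_sub_cancel_right, norm_pow, norm_pow] at this
    rw [pow_mul ‖ω‖, hω, mul_pow, pow_mul ‖ω'‖] at h9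
    have h10 : (‖ω'‖ ^ 2) ^ r ≤ (q : ℝ) ^ r := by gcongr
    have hqr0 : (1 : ℝ) ≤ (q : ℝ) ^ r := one_le_pow₀ (by exact_mod_cast hq1.le)
    have h11 : (q : ℝ) ^ r * ρ ^ r ≤ (q : ℝ) ^ r * (2 * (q : ℝ) ^ 2 + 7) := by linarith
    exact le_of_mul_le_mul_left h11 (by positivity)
  obtain ⟨N, hN⟩ := pow_unbounded_of_one_lt (2 * (q : ℝ) ^ 2 + 7) hρ1
  have hp : 0 < ringChar F := (CharP.char_is_prime F (ringChar F)).pos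
  have h12 := hbound (ringChar F * (N + 3) + 1) (by nlinarith) (by simp)
  have h13 : ρ ^ N ≤ ρ ^ (ringChar F * (N + 3) + 1) := by
    gcongr
    · exact hρ1.le
    · nlinarith
  linarith

theorem isIntegral_addChar_apply {A : Type*} [AddCommGroup A] [Finite A] (ψ : AddChar A ℂ) (x : A) :
    IsIntegral ℤ (ψ x) := by
  have h : ψ x ^ Nat.card A = 1 := by
    rw [← AddChar.map_nsmul_eq_pow, card_nsmul_eq_zero', AddChar.map_zero_eq_one]
  exact IsIntegral.of_pow Nat.card_pos (h ▸ isIntegral_one)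

theorem isIntegral_kloostermanSum (ψ : AddChar F ℂ) (α : F) :
    IsIntegral ℤ (kloostermanSum ψ α) := by
  rw [kloostermanSum]
  exact (IsIntegral.sum _ fun x _ => isIntegral_addChar_apply ψ _).neg

/-- A Kloosterman sum does not attain the extremal values in Weil's bound. -/
theorem kloostermanSum_sq_ne (ψ : AddChar F ℂ) (α : F) :
    kloostermanSum ψ α ^ 2 ≠ 4 * Nat.card F := by
  intro h
  set p := ringChar F with hp
  have hpp : p.Prime := CharP.char_is_prime F p
  let O := integralClosure ℤ ℂ
  have hpu : (p : O) ∈ nonunits O := by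
    intro hu
    obtain ⟨b, hb⟩ := hu.exists_right_inv
    have h2 : (p : ℂ) * (b : ℂ) = 1 := by
      have := congr_arg (algebraMap O ℂ) hb
      rwa [map_mul, map_natCast, map_one] at this
    have h3 : (b : ℂ) = algebraMap ℚ ℂ (p : ℚ)⁻¹ := by
      rw [eq_inv_of_mul_eq_one_right h2]
      simp
    have h4 : IsIntegral ℤ (p : ℚ)⁻¹ :=
      (isIntegral_algebraMap_iff (algebraMap ℚ ℂ).injective).1 (h3 ▸ b.2)
    obtain ⟨y, hy⟩ := IsIntegrallyClosed.isIntegral_iff.1 h4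
    have h5 : (p : ℤ) * y = 1 := by
      have h6 : (p : ℚ) * algebraMap ℤ ℚ y = 1 := by
        rw [hy, mul_inv_cancel₀ (by exact_mod_cast hpp.ne_zero)]
      rw [eq_intCast] at h6
      exact_mod_cast h6
    exact hpp.one_lt.ne' (by exact_mod_cast Int.eq_one_of_mul_eq_one_right (by positivity) h5)
  -- Modulo a maximal ideal of the algebraic integers containing `p`, every `p`-th root of unity is
  -- 1. So the Kloosterman sum becomes `-(q - 1) = 1`, whereas `4 q` becomes 0.
  obtain ⟨M, hM, hpM⟩ := exists_max_ideal_of_mem_nonunits hpu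
  let φ : O →+* O ⧸ M := Ideal.Quotient.mk M
  have hfield : IsField (O ⧸ M) := (Ideal.Quotient.maximal_ideal_iff_isField_quotient M).1 hM
  have hp0 : ((p : ℕ) : O ⧸ M) = 0 := by
    rw [← map_natCast φ]
    exact Ideal.Quotient.eq_zero_iff_mem.2 hpM
  have hdom : IsDomain (O ⧸ M) := hfield.isDomain
  have : CharP (O ⧸ M) p := (CharP.charP_iff_prime_eq_zero hpp).2 hp0
  have : Fact p.Prime := ⟨hpp⟩
  have hq0 : ((Nat.card F : ℕ) : O ⧸ M) = 0 := by
    let := Fintype.ofFinite F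
    obtain ⟨m, hm⟩ := (CharP.cast_eq_zero_iff F p (Nat.card F)).1
      (by rw [Nat.card_eq_fintype_card, FiniteField.cast_card_eq_zero])
    rw [hm, Nat.cast_mul, hp0, zero_mul]
  let e : F → O := fun x => ⟨ψ x, isIntegral_addChar_apply ψ x⟩
  have he : ∀ x, φ (e x) = 1 := by
    intro x
    have h1 : e x ^ p = 1 := by
      refine Subtype.ext ?_
      change ψ x ^ p = 1
      rw [← AddChar.map_nsmul_eq_pow, nsmul_eq_mul, hp, ringChar.Nat.cast_ringChar, zero_mul,
        AddChar.map_zero_eq_one]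
    have h2 : (φ (e x) - 1) ^ p = 0 := by
      rw [sub_pow_char, ← map_pow, h1, map_one, one_pow, sub_self]
    exact sub_eq_zero.1 (pow_eq_zero_iff hpp.ne_zero |>.1 h2)
  let := Fintype.ofFinite Fˣ
  let K : O := -∑ x : Fˣ, e ((x : F) + α / (x : F))
  have hK : (K : ℂ) = kloostermanSum ψ α := by
    simp [K, e, kloostermanSum]
  have hφK : φ K = 1 := by
    simp only [K, map_neg, map_sum, he, Finset.sum_const, Finset.card_univ, nsmul_eq_mul, mul_one]
    rw [← Nat.card_eq_fintype_card, Nat.card_units, Nat.cast_sub Finite.card_pos, hq0]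
    simp
  have hK2 : K ^ 2 = 4 * (Nat.card F : O) := by
    refine Subtype.ext ?_
    push_cast
    rw [hK, h]
    norm_cast
  have h9 := congr_arg φ hK2
  rw [map_pow, hφK, map_mul, map_natCast, hq0] at h9
  simp at h9

end Weil

/-! ### Absolute values, conjugates and angles -/

section Angles

variable {F : Type*} [Field F]

theorem FinitePlace.ringChar_residueField (v : FinitePlace F) :
    ringChar v.residueField = ringChar F :=
  (Algebra.ringChar_eq F v.residueField).symm

theorem FinitePlace.root_ne_zero {v : FinitePlace F} (hv : v.poly ≠ Polynomial.X) :
    AdjoinRoot.root v.poly ≠ 0 := by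
  intro h
  apply hv
  have h1 : v.poly ∣ Polynomial.X := by
    rw [← AdjoinRoot.mk_eq_zero, AdjoinRoot.mk_X, h]
  exact Polynomial.eq_of_monic_of_associated v.monic Polynomial.monic_X
    (v.irreducible.associated_of_dvd Polynomial.irreducible_X h1)

theorem kl_parameter_ne_zero {γ : F} (hγ : γ ≠ 0) {v : FinitePlace F} (hv : v.poly ≠ Polynomial.X) :
    algebraMap F v.residueField γ * AdjoinRoot.root v.poly ^ 2 ≠ 0 :=
  mul_ne_zero ((_root_.map_ne_zero _).2 hγ) (pow_ne_zero 2 (v.root_ne_zero hv))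

variable [Finite F]

/-- The upper bound applies to both `ω` and `ω'`, and their product is `q`. -/
theorem norm_sq_eq_of_kloostermanSum (hF : ringChar F ≠ 2) {ψ : AddChar F ℂ} (hψ : ψ ≠ 1) {α : F}
    (hα : α ≠ 0) {ω ω' : ℂ} (h1 : ω + ω' = kloostermanSum ψ α) (h2 : ω * ω' = Nat.card F) :
    ‖ω‖ ^ 2 = Nat.card F := by
  have h3 := norm_sq_le_of_kloostermanSum hF hψ hα h1 h2
  have h4 := norm_sq_le_of_kloostermanSum hF hψ hα ((add_comm _ _).trans h1)
    ((mul_comm _ _).trans h2)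
  have hq0 : (0 : ℝ) < Nat.card F := by exact_mod_cast Nat.card_pos
  have h5 : ‖ω‖ ^ 2 * ‖ω'‖ ^ 2 = Nat.card F * Nat.card F := by
    rw [← mul_pow, ← norm_mul, h2]
    simp [sq]
  refine h3.antisymm (le_of_mul_le_mul_right ?_ hq0)
  rw [← h5]
  gcongr

theorem eq_conj_of_kloostermanSum (hF : ringChar F ≠ 2) {ψ : AddChar F ℂ} (hψ : ψ ≠ 1) {α : F}
    (hα : α ≠ 0) {ω ω' : ℂ} (h1 : ω + ω' = kloostermanSum ψ α) (h2 : ω * ω' = Nat.card F) :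
    ω' = starRingEnd ℂ ω := by
  have h0 : ω ≠ 0 := by
    rintro rfl
    rw [zero_mul] at h2
    exact Nat.card_pos.ne (by exact_mod_cast h2)
  refine mul_left_cancel₀ h0 ?_
  rw [h2, Complex.mul_conj, Complex.normSq_eq_norm_sq,
    norm_sq_eq_of_kloostermanSum hF hψ hα h1 h2]
  simp

theorem isIntegral_of_kloostermanSum {ψ : AddChar F ℂ} {α : F}
    {ω ω' : ℂ} (h1 : ω + ω' = kloostermanSum ψ α) (h2 : ω * ω' = Nat.card F) :
    IsIntegral ℤ ω := by
  have hK : kloostermanSum ψ α ∈ integralClosure ℤ ℂ := isIntegral_kloostermanSum ψ α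
  have hω : IsIntegral (integralClosure ℤ ℂ) ω := by
    refine ⟨Polynomial.X ^ 2 - (Polynomial.C ⟨_, hK⟩ * Polynomial.X
      - Polynomial.C (Nat.card F : integralClosure ℤ ℂ)), ?_, ?_⟩
    · exact Polynomial.monic_X_pow_sub (by compute_degree!)
    · simp only [Polynomial.eval₂_sub, Polynomial.eval₂_pow, Polynomial.eval₂_X,
        Polynomial.eval₂_mul, Polynomial.eval₂_C, map_natCast, Polynomial.eval₂_natCast]
      change ω ^ 2 - (kloostermanSum ψ α * ω - _) = 0
      rw [← h1, ← h2]
      ring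
  exact isIntegral_trans (R := ℤ) (A := integralClosure ℤ ℂ) _ hω

theorem exists_add_eq_mul_eq (s p : ℂ) : ∃ ω ω' : ℂ, ω + ω' = s ∧ ω * ω' = p := by
  obtain ⟨z, hz⟩ := IsAlgClosed.exists_pow_nat_eq (s ^ 2 - 4 * p) (n := 2) (by norm_num)
  refine ⟨(s + z) / 2, (s - z) / 2, by ring, ?_⟩
  linear_combination -hz / 4

/-- The sum is twice the real part of `ω`, a number of absolute value `√q`. Equality is excluded by
`kloostermanSum_sq_ne`, so the cosine is strictly between -1 and 1. -/
theorem exists_angle_kloostermanSum (hF : ringChar F ≠ 2) {ψ : AddChar F ℂ} (hψ : ψ ≠ 1) {α : F}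
    (hα : α ≠ 0) :
    ∃ θ ∈ Set.Ioo 0 Real.pi,
      kloostermanSum ψ α = ((2 * √(Nat.card F) * Real.cos θ : ℝ) : ℂ) := by
  obtain ⟨ω, ω', h1, h2⟩ := exists_add_eq_mul_eq (kloostermanSum ψ α) (Nat.card F)
  have hq0 : (0 : ℝ) < Nat.card F := by exact_mod_cast Nat.card_pos
  have hs0 : 0 < √(Nat.card F : ℝ) := Real.sqrt_pos.2 hq0
  have h3 := norm_sq_eq_of_kloostermanSum hF hψ hα h1 h2
  have h4 : kloostermanSum ψ α = ((2 * ω.re : ℝ) : ℂ) := by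
    rw [← h1, eq_conj_of_kloostermanSum hF hψ hα h1 h2, Complex.add_conj]
  have h5 : ω.re ^ 2 < Nat.card F := by
    refine lt_of_le_of_ne ?_ ?_
    · rw [← h3, ← sq_abs]
      gcongr
      exact Complex.abs_re_le_norm ω
    · intro h6
      refine kloostermanSum_sq_ne ψ α ?_
      rw [h4]
      have h7 : (2 * ω.re) ^ 2 = 4 * (Nat.card F : ℝ) := by rw [← h6]; ring
      exact_mod_cast h7
  have h8 : (ω.re / √(Nat.card F : ℝ)) ^ 2 < 1 := by
    rw [div_pow, Real.sq_sqrt hq0.le, div_lt_one hq0]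
    exact h5
  obtain ⟨h9, h10⟩ := abs_lt.1 (sq_lt_one_iff_abs_lt_one _ |>.1 h8)
  refine ⟨Real.arccos (ω.re / √(Nat.card F : ℝ)), ⟨Real.arccos_pos.2 h10, ?_⟩, ?_⟩
  · refine lt_of_le_of_ne (Real.arccos_le_pi _) fun h => ?_
    exact absurd (Real.arccos_eq_pi.1 h) (not_le.2 h9)
  · rw [Real.cos_arccos h9.le h10.le, h4]
    congr 1
    field_simp

theorem FinitePlace.natCard_residueField (v : FinitePlace F) :
    Nat.card v.residueField = Nat.card F ^ v.degree := by
  rw [Module.natCard_eq_pow_finrank (K := F), finrank_residueField]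

theorem liftChar_ne_one {ψ : AddChar F ℂ} (hψ : ψ ≠ 1) (v : FinitePlace F) : liftChar ψ v ≠ 1 :=
  traceChar_ne_one hψ v.residueField

theorem sqrt_natCard_residueField (v : FinitePlace F) :
    √(Nat.card v.residueField : ℝ) = (Nat.card F : ℝ) ^ ((v.degree : ℝ) / 2) := by
  rw [v.natCard_residueField, Real.sqrt_eq_rpow, Nat.cast_pow, ← Real.rpow_natCast,
    ← Real.rpow_mul (by positivity)]
  congr 1
  ring

theorem kl_roots (hF : ringChar F ≠ 2) {ψ : AddChar F ℂ} (hψ : ψ ≠ 1) {γ : F} (hγ : γ ≠ 0)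
    {v : FinitePlace F} (hv : v.poly ≠ Polynomial.X) {ω ω' : ℂ} (h1 : ω + ω' = kl ψ γ v)
    (h2 : ω * ω' = (Nat.card F : ℂ) ^ v.degree) :
    IsIntegral ℤ ω ∧ IsIntegral ℤ ω' ∧ ω' = starRingEnd ℂ ω ∧
      ‖ω‖ = (Nat.card F : ℝ) ^ ((v.degree : ℝ) / 2) := by
  have h3 : ω * ω' = Nat.card v.residueField := by
    rw [h2, v.natCard_residueField, Nat.cast_pow]
  have hF' : ringChar v.residueField ≠ 2 := by rwa [v.ringChar_residueField]
  have hψ' := liftChar_ne_one hψ v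
  have hα := kl_parameter_ne_zero hγ hv
  refine ⟨isIntegral_of_kloostermanSum h1 h3,
    isIntegral_of_kloostermanSum ((add_comm _ _).trans h1) ((mul_comm _ _).trans h3),
    eq_conj_of_kloostermanSum hF' hψ' hα h1 h3, ?_⟩
  rw [← sqrt_natCard_residueField, ← norm_sq_eq_of_kloostermanSum hF' hψ' hα h1 h3,
    Real.sqrt_sq (norm_nonneg _)]

theorem exists_angle_kl (hF : ringChar F ≠ 2) {ψ : AddChar F ℂ} (hψ : ψ ≠ 1) {γ : F} (hγ : γ ≠ 0)
    {v : FinitePlace F} (hv : v.poly ≠ Polynomial.X) :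
    ∃ θ ∈ Set.Ioo 0 Real.pi, kl ψ γ v =
      ((2 * (Nat.card F : ℝ) ^ ((v.degree : ℝ) / 2) * Real.cos θ : ℝ) : ℂ) := by
  rw [← sqrt_natCard_residueField]
  exact exists_angle_kloostermanSum (by rwa [v.ringChar_residueField]) (liftChar_ne_one hψ v)
    (kl_parameter_ne_zero hγ hv)

end Angles

/-! ### Sums of the quadratic character at quadratic polynomials -/

section LegendreSum

theorem sum_comp_eq_sum_card {ι κ M : Type*} [Fintype κ] [DecidableEq κ] [CommRing M]
    (s : Finset ι) (h : ι → κ) (f : κ → M) :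
    ∑ x ∈ s, f (h x) = ∑ p, (Finset.card {x ∈ s | h x = p} : M) * f p := by
  rw [← Finset.sum_fiberwise _ h]
  refine Finset.sum_congr rfl fun p _ => ?_
  rw [Finset.sum_congr rfl (g := fun _ => f p), Finset.sum_const, nsmul_eq_mul]
  intro x hx
  rw [(Finset.mem_filter.1 hx).2]

variable {k : Type*} [Field k] [Fintype k] [DecidableEq k]

theorem card_quadratic_roots (hk : ringChar k ≠ 2) {a : k} (ha : a ≠ 0) (b c : k) :
    (Finset.card {t : k | a * t ^ 2 + b * t + c = 0} : ℤ) =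
      1 + quadraticChar k (b ^ 2 - 4 * a * c) := by
  have h2 : (2 : k) ≠ 0 := Ring.two_ne_zero hk
  rw [add_comm, ← quadraticChar_card_sqrts hk, Nat.cast_inj]
  refine Finset.card_nbij' (fun t => 2 * a * t + b) (fun s => (s - b) / (2 * a)) ?_ ?_ ?_ ?_
  · intro t ht
    simp only [Finset.coe_filter, Finset.mem_univ, true_and, Set.mem_ofPred_eq,
      Set.coe_toFinset] at ht ⊢
    linear_combination 4 * a * ht
  · intro s hs
    simp only [Finset.coe_filter, Finset.mem_univ, true_and, Set.mem_ofPred_eq,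
      Set.coe_toFinset] at hs ⊢
    field_simp
    have h4 : (4 : k) = 2 * 2 := by norm_num
    linear_combination hs
  · intro t _
    field_simp
    ring
  · intro s _
    field_simp
    ring

theorem card_sq_eq (hk : ringChar k ≠ 2) (c : k) :
    (Finset.card {t : k | t ^ 2 = c} : ℤ) = 1 + quadraticChar k c := by
  rw [add_comm, ← quadraticChar_card_sqrts hk, Nat.cast_inj]
  congr 1
  ext
  simp

theorem quadraticChar_mul_sq {c : k} (hc : c ≠ 0) (x : k) :
    quadraticChar k (x * c ^ 2) = quadraticChar k x := by
  rw [map_mul, quadraticChar_sq_one' hc, mul_one]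

theorem sum_quadraticChar_add (hk : ringChar k ≠ 2) (c : k) :
    ∑ x, quadraticChar k (x + c) = 0 := by
  rw [← quadraticChar_sum_zero hk]
  exact Fintype.sum_equiv (Equiv.addRight c) _ _ fun _ => rfl

/-- For `x ≠ 0` the argument is `x² (1 + c / x)`, and `1 + c / x` takes every value except 1 once.
-/
theorem sum_quadraticChar_mul_add (hk : ringChar k ≠ 2) {c : k} (hc : c ≠ 0) :
    ∑ x, quadraticChar k (x * (x + c)) = -1 := by
  have h1 : ∑ x, quadraticChar k (x * (x + c)) =
      ∑ x ∈ Finset.univ.erase (0 : k), quadraticChar k (x * (x + c)) := by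
    rw [← Finset.add_sum_erase _ _ (Finset.mem_univ (0 : k))]
    simp
  have h2 : ∑ x ∈ Finset.univ.erase (0 : k), quadraticChar k (x * (x + c)) =
      ∑ u ∈ Finset.univ.erase (1 : k), quadraticChar k u := by
    refine Finset.sum_nbij' (fun x => 1 + c / x) (fun u => c / (u - 1)) ?_ ?_ ?_ ?_ ?_
    · intro x hx
      have hx : x ≠ 0 := by simpa using hx
      simp [hx, hc]
    · intro u hu
      have hu : u ≠ 1 := by simpa using hu
      simp [hc, sub_eq_zero, hu]
    · intro x hx
      have hx : x ≠ 0 := by simpa using hx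
      field_simp
      simp [hc]
    · intro u hu
      have hu : u - 1 ≠ 0 := sub_ne_zero.2 (by simpa using hu)
      field_simp
      ring
    · intro x hx
      have hx : x ≠ 0 := by simpa using hx
      rw [← quadraticChar_mul_sq hx (1 + c / x)]
      congr 1
      field_simp
  have h3 := quadraticChar_sum_zero hk
  rw [← Finset.add_sum_erase _ _ (Finset.mem_univ (1 : k)), map_one] at h3
  rw [h1, h2]
  linarith

theorem sum_quadraticChar_add_mul_add (hk : ringChar k ≠ 2) (u v : k) :
    ∑ x, quadraticChar k ((x + u) * (x + v)) = if u = v then (Nat.card k : ℤ) - 1 else -1 := by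
  rw [← Fintype.sum_equiv (Equiv.subRight u) (fun x => quadraticChar k (x * (x + (v - u))))
    (fun x => quadraticChar k ((x + u) * (x + v)))
    (fun x => by simp only [Equiv.subRight_apply]; congr 1; ring)]
  split_ifs with h
  · subst h
    rw [← Finset.add_sum_erase _ _ (Finset.mem_univ (0 : k)), Finset.sum_congr rfl
      (g := fun _ => (1 : ℤ)), Finset.sum_const, Finset.card_erase_of_mem (Finset.mem_univ _),
      Finset.card_univ, nsmul_eq_mul, mul_one, Nat.cast_sub Fintype.card_pos,
      Nat.card_eq_fintype_card]
    · simp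
    · intro x hx
      have hx : x ≠ 0 := by simpa using hx
      rw [sub_self, add_zero, ← sq, quadraticChar_sq_one' hx]
  · exact sum_quadraticChar_mul_add hk (sub_ne_zero.2 (Ne.symm h))

theorem sum_quadraticChar_sq_add (hk : ringChar k ≠ 2) {c : k} (hc : c ≠ 0) :
    ∑ w, quadraticChar k (w ^ 2 + c) = -1 := by
  rw [sum_comp_eq_sum_card Finset.univ (fun w : k => w ^ 2) (fun y => quadraticChar k (y + c))]
  simp only [card_sq_eq hk, add_mul, one_mul, Finset.sum_add_distrib, ← map_mul]
  rw [sum_quadraticChar_add hk, sum_quadraticChar_mul_add hk hc, zero_add]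

end LegendreSum

/-! ### The character sum of the cubic `x (x + A) (x + B)` -/

section LegendreSumDef

open Classical in
/-- The sum of the values of the quadratic character at `x * (x + A) * (x + B)`. -/
def legendreSum {k : Type*} [Field k] [Finite k] (A B : k) : ℤ :=
  let := Fintype.ofFinite k
  ∑ x : k, quadraticChar k (x * (x + A) * (x + B))

variable {k : Type*} [Field k]

theorem legendreSum_eq [Fintype k] [DecidableEq k] (A B : k) :
    legendreSum A B = ∑ x : k, quadraticChar k (x * (x + A) * (x + B)) := by
  rw [legendreSum]
  convert rfl

/-- The square factor `x²` only removes the term at 0 from a complete character sum. This is the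
nodal case, where minus the sum is the sign of the node. -/
theorem legendreSum_zero_right [Fintype k] [DecidableEq k] (hk : ringChar k ≠ 2) (A : k) :
    legendreSum A 0 = -quadraticChar k A := by
  have h0 := sum_quadraticChar_add hk A
  rw [← Finset.add_sum_erase _ _ (Finset.mem_univ (0 : k)), zero_add] at h0
  rw [legendreSum_eq, ← Finset.add_sum_erase _ _ (Finset.mem_univ (0 : k))]
  rw [Finset.sum_congr rfl (g := fun x => quadraticChar k (x + A))]
  · rw [zero_mul, zero_mul, quadraticChar_zero, zero_add]
    linarith
  · intro x hx
    rw [← quadraticChar_mul_sq (c := x) (by simpa using hx) (x + A)]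
    congr 1
    ring

theorem legendreSum_self [Fintype k] [DecidableEq k] (hk : ringChar k ≠ 2) (A : k) :
    legendreSum A A = -quadraticChar k (-A) := by
  rw [← legendreSum_zero_right hk, legendreSum_eq, legendreSum_eq]
  refine Fintype.sum_equiv (Equiv.addRight A) _ _ fun x => ?_
  simp only [Equiv.coe_addRight]
  congr 1
  ring

/-- Summing over `w` first gives -1 for each `x ≠ 0`, which leaves minus the sum of the character at
`x (x + A)`. This is the Fourier coefficient at 0, which will cancel the place at infinity. -/
theorem sum_legendreSum [Fintype k] (hk : ringChar k ≠ 2) {A : k} (hA : A ≠ 0) :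
    ∑ w : k, legendreSum A (w ^ 2) = 1 := by
  classical
  simp only [legendreSum_eq, map_mul _ (_ * _)]
  rw [Finset.sum_comm]
  simp only [← Finset.mul_sum]
  rw [← neg_neg (1 : ℤ), ← sum_quadraticChar_mul_add hk hA, ← Finset.sum_neg_distrib]
  refine Finset.sum_congr rfl fun x _ => ?_
  by_cases hx : x = 0
  · simp [hx]
  · simp only [add_comm x (_ ^ 2)]
    rw [sum_quadraticChar_sq_add hk hx]
    ring

theorem legendreSum_mul [Finite k] {c : k} (hc : c ≠ 0) (A B : k) :
    legendreSum (A * c ^ 2) (B * c ^ 2) = legendreSum A B := by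
  classical
  let := Fintype.ofFinite k
  rw [legendreSum_eq, legendreSum_eq]
  symm
  refine Fintype.sum_equiv (Equiv.mulRight₀ (c ^ 2) (pow_ne_zero 2 hc)) _ _ fun x => ?_
  rw [← quadraticChar_mul_sq (pow_ne_zero 3 hc)]
  congr 1
  simp
  ring

end LegendreSumDef

/-! ### Norms and quadratic characters in extensions of finite fields -/

section Norm

open Polynomial

variable {F k : Type*} [Field F] [Field k] [Algebra F k] [Finite k]

theorem norm_eq_minpoly_coeff_zero (x : k) :
    Algebra.norm F x = ((-1) ^ (minpoly F x).natDegree * (minpoly F x).coeff 0) ^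
      (Module.finrank F k / (minpoly F x).natDegree) := by
  have hint := Algebra.IsIntegral.isIntegral (R := F) x
  have h := Algebra.PowerBasis.norm_gen_eq_coeff_zero_minpoly
    (IntermediateField.adjoin.powerBasis hint)
  rw [IntermediateField.adjoin.powerBasis_gen, IntermediateField.adjoin.powerBasis_dim,
    IntermediateField.minpoly_gen] at h
  rw [Algebra.norm_eq_norm_adjoin, h, finrank_div_natDegree_minpoly]

theorem norm_algebraMap_sub (a : F) (x : k) :
    Algebra.norm F (algebraMap F k a - x) =
      (minpoly F x).eval a ^ (Module.finrank F k / (minpoly F x).natDegree) := by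
  have h1 := norm_eq_minpoly_coeff_zero (F := F) (x - algebraMap F k a)
  rw [minpoly.sub_algebraMap, natDegree_comp, natDegree_X_add_C, mul_one, coeff_zero_eq_eval_zero,
    eval_comp, eval_add, eval_X, eval_C, zero_add] at h1
  have hd : (minpoly F x).natDegree ∣ Module.finrank F k := degree_placeOf_dvd x
  rw [← neg_sub, neg_eq_neg_one_mul, map_mul, h1, mul_pow, ← pow_mul, Nat.mul_div_cancel' hd,
    ← map_one (algebraMap F k), ← map_neg, Algebra.norm_algebraMap, ← mul_assoc, ← mul_pow]
  simp

/-- Euler's criterion in both fields, together with the norm being the power with exponent `(#k - 1)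
/ (#F - 1)`, gives `x^((#k - 1) / 2)` on both sides. The signs agree because `1 ≠ -1` in `k`. -/
theorem quadraticChar_norm [Fintype F] [Fintype k] [DecidableEq F] [DecidableEq k]
    (hF : ringChar F ≠ 2) (x : k) :
    quadraticChar F (Algebra.norm F x) = quadraticChar k x := by
  by_cases hx : x = 0
  · simp [hx]
  have hk : ringChar k ≠ 2 := by rwa [← Algebra.ringChar_eq F k]
  have h0 : Algebra.norm F x ≠ 0 := Algebra.norm_ne_zero_iff.2 hx
  have key : algebraMap F k (quadraticChar F (Algebra.norm F x) : ℤ) = (quadraticChar k x : ℤ) := by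
    rw [quadraticChar_eq_pow_of_char_ne_two' hF, quadraticChar_eq_pow_of_char_ne_two' hk, map_pow,
      FiniteField.algebraMap_norm_eq_pow, ← pow_mul, Nat.card_eq_fintype_card,
      Nat.card_eq_fintype_card]
    congr 1
    have hq := FiniteField.odd_card_of_char_ne_two hF
    have hQ := FiniteField.odd_card_of_char_ne_two hk
    have hdvd : Fintype.card F - 1 ∣ Fintype.card k - 1 := by
      rw [Module.card_eq_pow_finrank (K := F) (V := k)]
      exact Nat.sub_one_dvd_pow_sub_one _ _
    obtain ⟨m, hm⟩ := hdvd
    have hq1 : 1 < Fintype.card F := Fintype.one_lt_card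
    rw [hm, Nat.mul_div_cancel_left _ (by omega)]
    have e1 : Fintype.card F / 2 * 2 = Fintype.card F - 1 := by omega
    have e2 : Fintype.card k / 2 * 2 = Fintype.card k - 1 := by omega
    have : (m * (Fintype.card F / 2)) * 2 = Fintype.card k / 2 * 2 := by
      rw [mul_assoc, e1, e2, hm, mul_comm]
    omega
  rw [map_intCast] at key
  have h1 : (1 : k) ≠ -1 := (Ring.neg_one_ne_one_of_char_ne_two hk).symm
  rcases quadraticChar_dichotomy hx with h | h <;> rcases quadraticChar_dichotomy h0 with h' | h' <;>
    rw [h, h'] at key ⊢ <;> push_cast at key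
  · exact absurd key.symm h1
  · exact absurd key h1

theorem quadraticChar_algebraMap [Fintype F] [Fintype k] [DecidableEq F] [DecidableEq k]
    (hF : ringChar F ≠ 2) (a : F) :
    quadraticChar k (algebraMap F k a) = quadraticChar F a ^ Module.finrank F k := by
  rw [← quadraticChar_norm (F := F) hF, Algebra.norm_algebraMap, map_pow]

end Norm

/-! ### The Hasse–Davenport relation for Legendre sums -/

section HasseDavenport

open Polynomial

variable {F : Type*} [Field F] [Fintype F] [DecidableEq F]

/-- The multiplicative function on polynomials with generating series the numerator of the zeta
function of the curve `y ^ 2 = x (x + A) (x + B)`. -/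
def legendreLambda (A B : F) (f : F[X]) : ℤ :=
  quadraticChar F (f.eval 0 * f.eval A * f.eval B)

theorem isMonicMul_legendreLambda (A B : F) : IsMonicMul (legendreLambda A B) where
  map_one := by simp [legendreLambda]
  map_mul f g _ _ := by
    simp only [legendreLambda, eval_mul, ← map_mul]
    congr 1
    ring

theorem legendreLambda_minpoly (hF : ringChar F ≠ 2) (A B : F) {k : Type*} [Field k] [Algebra F k]
    [Fintype k] [DecidableEq k] (x : k) :
    legendreLambda A B (minpoly F x) ^ (Module.finrank F k / (minpoly F x).natDegree) =
      quadraticChar k (-x * (algebraMap F k A - x) * (algebraMap F k B - x)) := by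
  rw [legendreLambda, ← map_pow, mul_pow, mul_pow, ← norm_algebraMap_sub, ← norm_algebraMap_sub,
    ← norm_algebraMap_sub, ← map_mul, ← map_mul, quadraticChar_norm hF, map_zero, zero_sub]

theorem monicSum_legendreLambda_one (A B : F) :
    monicSum (legendreLambda A B) 1 = legendreSum A B := by
  rw [monicSum, sum_monics_one, legendreSum_eq]
  refine Fintype.sum_equiv (Equiv.neg F) _ _ fun b => ?_
  simp [legendreLambda]
  ring_nf

/-- For `X² + b X + c` the values at `A` and `B` are linear in `b`, with a common root exactly when
`c = A B`. The sum over `b` is `q` in that case and 0 otherwise, minus the character at `c A B`, and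
the latter sums to 0 over `c`. -/
theorem monicSum_legendreLambda_two (hF : ringChar F ≠ 2) {A B : F} (hA : A ≠ 0) (hB : B ≠ 0)
    (hAB : A ≠ B) : monicSum (legendreLambda A B) 2 = Nat.card F := by
  rw [monicSum, sum_monics_two]
  have h1 : ∀ c : F, ∑ b : F, legendreLambda A B (X ^ 2 + C b * X + C c) =
      (if c = A * B then (Nat.card F : ℤ) else 0) - quadraticChar F (c * (A * B)) := by
    intro c
    have h2 : ∀ b : F, legendreLambda A B (X ^ 2 + C b * X + C c) = quadraticChar F (c * (A * B)) *
        quadraticChar F ((b + (A ^ 2 + c) / A) * (b + (B ^ 2 + c) / B)) := by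
      intro b
      rw [legendreLambda, ← map_mul]
      congr 1
      simp
      field_simp
      ring
    simp only [h2]
    rw [← Finset.mul_sum, sum_quadraticChar_add_mul_add hF]
    have h3 : (A ^ 2 + c) / A = (B ^ 2 + c) / B ↔ c = A * B := by
      rw [div_eq_div_iff hA hB]
      constructor
      · intro h
        refine mul_left_cancel₀ (sub_ne_zero.2 hAB) ?_
        linear_combination -h
      · rintro rfl
        ring
    simp only [h3]
    split_ifs with h
    · rw [h, ← sq (A * B), quadraticChar_sq_one' (mul_ne_zero hA hB), one_mul]
    · ring
  rw [Finset.sum_congr rfl fun c _ => h1 c, Finset.sum_sub_distrib]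
  simp only [map_mul, ← Finset.sum_mul]
  rw [quadraticChar_sum_zero hF]
  simp

/-- Adding a multiple of `(X - A) (X - B)`, of degree 2 and hence less than `n`, can multiply the
value at 0 by a nonresidue `u` and keep the values at `A` and `B`. So the sum equals its own
negative. -/
theorem monicSum_legendreLambda_of_three_le (hF : ringChar F ≠ 2) {A B : F} (hA : A ≠ 0)
    (hB : B ≠ 0) {n : ℕ} (hn : 3 ≤ n) : monicSum (legendreLambda A B) n = 0 := by
  obtain ⟨u, hu⟩ := quadraticChar_exists_neg_one hF
  have hu0 : u ≠ 0 := by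
    rintro rfl
    simp at hu
  let p : F[X] := (X - C A) * (X - C B)
  have hp0 : p.eval 0 = A * B := by simp [p]
  have hpA : p.eval A = 0 := by simp [p]
  have hpB : p.eval B = 0 := by simp [p]
  have hpd : p.degree < (n : ℕ) := by
    have : p.degree = 2 := by simp [p, degree_mul]; rfl
    rw [this]
    exact_mod_cast (by omega : 2 < n)
  let T : F → F[X] → F[X] := fun u f => f + C ((u - 1) * f.eval 0 / (A * B)) * p
  have hdeg : ∀ u f, f ∈ monics F n → T u f ∈ monics F n := by
    intro u f hf
    obtain ⟨hf, hd⟩ := mem_monics.1 hf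
    have hlt : (C ((u - 1) * f.eval 0 / (A * B)) * p).degree < f.degree := by
      rw [degree_eq_natDegree hf.ne_zero, hd]
      exact ((degree_mul_le _ _).trans (add_le_add_left degree_C_le _)).trans_lt (by simpa)
    exact mem_monics.2 ⟨hf.add_of_left hlt, by rw [natDegree_add_eq_left_of_degree_lt hlt, hd]⟩
  have hT0 : ∀ u f, (T u f).eval 0 = u * f.eval 0 := by
    intro u f
    simp only [T, eval_add, eval_mul, eval_C, hp0]
    field_simp
    ring
  have hTT : ∀ u v f, u * v = 1 → T u (T v f) = f := by
    intro u v f huv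
    change T v f + C ((u - 1) * (T v f).eval 0 / (A * B)) * p = f
    rw [hT0, add_assoc, ← add_mul, ← C_add, ← add_div,
      show (v - 1) * f.eval 0 + (u - 1) * (v * f.eval 0) = 0 by linear_combination f.eval 0 * huv]
    simp
  have key : monicSum (legendreLambda A B) n = -monicSum (legendreLambda A B) n := by
    rw [monicSum, ← Finset.sum_neg_distrib]
    refine Finset.sum_nbij' (T u) (T u⁻¹) (fun f hf => hdeg u f hf)
      (fun f hf => hdeg u⁻¹ f hf) (fun f _ => hTT _ _ f (inv_mul_cancel₀ hu0))
      (fun f _ => hTT _ _ f (mul_inv_cancel₀ hu0)) ?_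
    intro f _
    have e1 : (T u f).eval A = f.eval A := by simp [T, hpA]
    have e2 : (T u f).eval B = f.eval B := by simp [T, hpB]
    rw [legendreLambda, legendreLambda, hT0, e1, e2, mul_assoc u, mul_assoc u, map_mul _ u, hu,
      neg_one_mul, neg_neg]
  omega

/-- The Hasse–Davenport relation for the number of points of `y ^ 2 = x (x + A) (x + B)`. -/
theorem legendreSum_extension (hF : ringChar F ≠ 2) {A B : F} (hA : A ≠ 0) (hB : B ≠ 0)
    (hAB : A ≠ B) {ω ω' : ℂ} (h1 : ω + ω' = -(legendreSum A B : ℤ)) (h2 : ω * ω' = Nat.card F)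
    (k : Type*) [Field k] [Algebra F k] [Finite k] :
    -(legendreSum (algebraMap F k A) (algebraMap F k B) : ℂ) =
      ω ^ Module.finrank F k + ω' ^ Module.finrank F k := by
  classical
  let := Fintype.ofFinite k
  let Λ : F[X] → ℂ := fun f => (legendreLambda A B f : ℤ)
  have hΛ : IsMonicMul Λ := by
    have h := isMonicMul_legendreLambda A B
    exact ⟨by simp only [Λ, h.map_one, Int.cast_one],
      fun f g hf hg => by simp only [Λ, h.map_mul f g hf hg, Int.cast_mul]⟩
  have hm : ∀ n, monicSum Λ n = (monicSum (legendreLambda A B) n : ℤ) := by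
    intro n
    simp [monicSum, Λ]
  have := sum_extension_eq_neg hΛ
    (fun n hn => by rw [hm, monicSum_legendreLambda_of_three_le hF hA hB hn, Int.cast_zero])
    (by rw [h1, hm, monicSum_legendreLambda_one])
    (by rw [h2, hm, monicSum_legendreLambda_two hF hA hB hAB, Int.cast_natCast]) (k := k)
  rw [eq_neg_iff_add_eq_zero, ← eq_neg_iff_add_eq_zero, ← neg_eq_iff_eq_neg] at this
  rw [← this, neg_inj, legendreSum_eq, Int.cast_sum]
  symm
  refine Fintype.sum_equiv (Equiv.neg k) _ _ fun x => ?_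
  simp only [Λ, ← Int.cast_pow, legendreLambda_minpoly hF, Equiv.neg_apply]
  congr 2
  ring

theorem legendreSum_extension_zero_right (hF : ringChar F ≠ 2) (A : F)
    (k : Type*) [Field k] [Algebra F k] [Finite k] :
    -legendreSum (algebraMap F k A) 0 = quadraticChar F A ^ Module.finrank F k := by
  classical
  let := Fintype.ofFinite k
  rw [legendreSum_zero_right (by rwa [← Algebra.ringChar_eq F k]), neg_neg,
    quadraticChar_algebraMap hF]

theorem legendreSum_extension_self (hF : ringChar F ≠ 2) (A : F)
    (k : Type*) [Field k] [Algebra F k] [Finite k] :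
    -legendreSum (algebraMap F k A) (algebraMap F k A) =
      quadraticChar F (-A) ^ Module.finrank F k := by
  classical
  let := Fintype.ofFinite k
  rw [legendreSum_self (by rwa [← Algebra.ringChar_eq F k]), neg_neg, ← map_neg,
    quadraticChar_algebraMap hF]

end HasseDavenport

/-! ### The Fourier transform of Legendre sums is a square of Kloosterman sums -/

section Fourier

variable {k : Type*} [Field k]

theorem kloostermanSum_sq_eq [Fintype k] [DecidableEq k] (ψ : AddChar k ℂ) (γ : k) :
    kloostermanSum ψ γ ^ 2 =
      ∑ x : k, ∑ y : k, if x * y = 0 then 0 else ψ ((x + y) * (1 + γ / (x * y))) := by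
  rw [kloostermanSum_eq, neg_sq, sq, Finset.sum_mul_sum]
  refine Finset.sum_congr rfl fun x _ => Finset.sum_congr rfl fun y _ => ?_
  by_cases hx : x = 0
  · simp [hx]
  by_cases hy : y = 0
  · simp [hy]
  rw [if_neg hx, if_neg hy, if_neg (mul_ne_zero hx hy), ← AddChar.map_add_eq_mul]
  congr 1
  field_simp
  ring

/-- The pairs with sum `s` and product `p` correspond to the roots of `t² - s t + p`, whose number
is given by its discriminant. -/
theorem sum_add_mul_eq [Fintype k] [DecidableEq k] (hk : ringChar k ≠ 2) (G : k → k → ℂ) :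
    ∑ x : k, ∑ y : k, G (x + y) (x * y) =
      ∑ p : k, ∑ s : k, (1 + (quadraticChar k (s ^ 2 - 4 * p) : ℂ)) * G s p := by
  have h1 : ∀ x : k, ∑ y : k, G (x + y) (x * y) = ∑ s : k, G s (x * (s - x)) := fun x =>
    Fintype.sum_equiv (Equiv.addLeft x) _ _ fun y => by simp
  rw [Finset.sum_congr rfl fun x _ => h1 x, Finset.sum_comm]
  conv_rhs => rw [Finset.sum_comm]
  refine Finset.sum_congr rfl fun s _ => ?_
  rw [sum_comp_eq_sum_card Finset.univ (fun x : k => x * (s - x))]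
  refine Finset.sum_congr rfl fun p _ => ?_
  congr 1
  have h2 := card_quadratic_roots hk one_ne_zero (-s) p
  rw [neg_sq, mul_one] at h2
  rw [← Int.cast_one, ← Int.cast_add, ← h2, Int.cast_natCast]
  congr 3
  ext x
  constructor <;> intro h <;> linear_combination -h

/-- The substitution `w = s (1 + γ / p)` multiplies `s² - 4 p` by the square of `(p + γ) / p`. It
degenerates at `p = -γ`: there the left side is `q - 1` and the sum over `w` is -1, whence the
correction `q`. -/
theorem sum_one_add_quadraticChar_mul [Fintype k] [DecidableEq k] (hk : ringChar k ≠ 2)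
    {ψ : AddChar k ℂ} (hψ : ψ ≠ 1) {γ p : k} (hγ : γ ≠ 0) (hp : p ≠ 0) :
    ∑ s : k, (1 + (quadraticChar k (s ^ 2 - 4 * p) : ℂ)) * ψ (s * (1 + γ / p)) =
      ∑ w : k, (quadraticChar k (w ^ 2 - 4 * (p + γ) ^ 2 / p) : ℂ) * ψ w +
        if p = -γ then (Nat.card k : ℂ) else 0 := by
  have h4 : (4 : k) ≠ 0 := by
    rw [show (4 : k) = 2 * 2 by norm_num]
    exact mul_ne_zero (Ring.two_ne_zero hk) (Ring.two_ne_zero hk)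
  split_ifs with h
  · subst h
    have h6 : ∀ w : k, w ^ 2 - 4 * (-γ + γ) ^ 2 / -γ = w ^ 2 := fun w => by simp
    have e1 : ∑ w : k, (quadraticChar k (w ^ 2) : ℂ) * ψ w = -1 := by
      have h5 := AddChar.sum_eq_zero_of_ne_one hψ
      rw [← Finset.add_sum_erase _ _ (Finset.mem_univ (0 : k)), AddChar.map_zero_eq_one] at h5
      rw [← Finset.add_sum_erase _ _ (Finset.mem_univ (0 : k)),
        Finset.sum_congr rfl (g := fun w => ψ w), zero_pow two_ne_zero, quadraticChar_zero]
      · linear_combination h5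
      · intro w hw
        rw [quadraticChar_sq_one' (by simpa using hw), Int.cast_one, one_mul]
    have e2 := sum_quadraticChar_sq_add hk (mul_ne_zero h4 hγ)
    have h7 : ∀ s : k, s ^ 2 - 4 * -γ = s ^ 2 + 4 * γ := fun s => by ring
    have h8 : ∀ s : k, s * (1 + γ / -γ) = 0 := fun s => by
      rw [div_neg, div_self hγ]
      ring
    simp only [h6, h7, h8, e1, AddChar.map_zero_eq_one, mul_one]
    rw [Finset.sum_add_distrib, ← Int.cast_sum, e2]
    simp
    ring
  · have hpγ : p + γ ≠ 0 := fun h' => h (eq_neg_of_add_eq_zero_left h')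
    have e1 : ∑ s : k, (1 + (quadraticChar k (s ^ 2 - 4 * p) : ℂ)) * ψ (s * (1 + γ / p)) =
        ∑ w : k, (1 + (quadraticChar k (w ^ 2 - 4 * (p + γ) ^ 2 / p) : ℂ)) * ψ w := by
      refine Fintype.sum_equiv
        (Equiv.mulRight₀ (1 + γ / p) (by rw [one_add_div hp]; exact div_ne_zero hpγ hp))
        _ _ fun s => ?_
      rw [Equiv.mulRight₀_apply, ← quadraticChar_mul_sq (div_ne_zero hpγ hp)]
      congr 4
      field_simp
    rw [e1]
    simp only [add_mul, one_mul, Finset.sum_add_distrib]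
    rw [AddChar.sum_eq_zero_of_ne_one hψ, zero_add, add_zero]

/-- The fibre of `p ↦ -4 (p + γ)² / p` over `x` is the root set of `4 p² + (8 γ + x) p + 4 γ²`,
whose discriminant is `x (x + 16 γ)`. This is the source of the constant 16 in the curve. -/
theorem sum_quadraticChar_eq_legendreSum [Fintype k] [DecidableEq k] (hk : ringChar k ≠ 2)
    {γ : k} (hγ : γ ≠ 0) (w : k) :
    ∑ p ∈ {p : k | p ≠ 0}, quadraticChar k (w ^ 2 - 4 * (p + γ) ^ 2 / p) =
      legendreSum (16 * γ) (w ^ 2) := by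
  have h4 : (4 : k) ≠ 0 := by
    rw [show (4 : k) = 2 * 2 by norm_num]
    exact mul_ne_zero (Ring.two_ne_zero hk) (Ring.two_ne_zero hk)
  have h1 : ∀ x : k,
      (Finset.card {p ∈ ({p : k | p ≠ 0} : Finset k) | -(4 * (p + γ) ^ 2 / p) = x} : ℤ) =
      1 + quadraticChar k (x * (x + 16 * γ)) := by
    intro x
    rw [show x * (x + 16 * γ) = (8 * γ + x) ^ 2 - 4 * 4 * (4 * γ ^ 2) by ring,
      ← card_quadratic_roots hk h4]
    congr 2
    ext p
    simp only [Finset.mem_filter, Finset.mem_univ, true_and]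
    constructor
    · rintro ⟨hp, rfl⟩
      field_simp
      ring
    · intro h
      have hp : p ≠ 0 := by
        rintro rfl
        refine mul_ne_zero h4 (pow_ne_zero 2 hγ) ?_
        linear_combination h
      refine ⟨hp, ?_⟩
      field_simp
      linear_combination -h
  simp only [sub_eq_add_neg]
  rw [sum_comp_eq_sum_card _ (fun p : k => -(4 * (p + γ) ^ 2 / p))
    (fun x => quadraticChar k (w ^ 2 + x)), legendreSum_eq]
  simp only [h1, add_mul, one_mul, Finset.sum_add_distrib, ← map_mul]
  simp only [add_comm (w ^ 2)]
  rw [sum_quadraticChar_add hk, zero_add]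

theorem sum_legendreSum_mul_addChar [Fintype k] (hk : ringChar k ≠ 2) {ψ : AddChar k ℂ}
    (hψ : ψ ≠ 1) {γ : k} (hγ : γ ≠ 0) :
    ∑ w : k, (legendreSum (16 * γ) (w ^ 2) : ℂ) * ψ w = kloostermanSum ψ γ ^ 2 - Nat.card k := by
  classical
  rw [kloostermanSum_sq_eq,
    sum_add_mul_eq hk (fun s p => if p = 0 then 0 else ψ (s * (1 + γ / p)))]
  have h1 : ∑ p : k, ∑ s : k, (1 + (quadraticChar k (s ^ 2 - 4 * p) : ℂ)) *
      (if p = 0 then 0 else ψ (s * (1 + γ / p))) = ∑ p ∈ {p : k | p ≠ 0},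
      (∑ w : k, (quadraticChar k (w ^ 2 - 4 * (p + γ) ^ 2 / p) : ℂ) * ψ w +
        if p = -γ then (Nat.card k : ℂ) else 0) := by
    rw [Finset.sum_filter]
    refine Finset.sum_congr rfl fun p _ => ?_
    by_cases hp : p = 0
    · simp [hp]
    · simp only [hp, if_false, ne_eq, not_false_eq_true, if_true]
      exact sum_one_add_quadraticChar_mul hk hψ hγ hp
  rw [h1, Finset.sum_add_distrib, Finset.sum_comm]
  simp only [← Finset.sum_mul, ← Int.cast_sum, sum_quadraticChar_eq_legendreSum hk hγ]
  rw [Finset.sum_ite_eq', if_pos (by simpa using hγ)]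
  ring

/-- The Fourier transform of the traces of Frobenius of the curves
`y ^ 2 = x (x + 16 γ) (x + w ^ 2)`. -/
theorem sum_legendreSum_mul_addChar_mul [Fintype k] (hk : ringChar k ≠ 2) {ψ : AddChar k ℂ}
    (hψ : ψ ≠ 1) {γ : k} (hγ : γ ≠ 0) {c : k} (hc : c ≠ 0) :
    ∑ w : k, (legendreSum (16 * γ) (w ^ 2) : ℂ) * ψ (c * w) =
      kloostermanSum ψ (γ * c ^ 2) ^ 2 - Nat.card k := by
  rw [← sum_legendreSum_mul_addChar hk hψ (mul_ne_zero hγ (pow_ne_zero 2 hc))]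
  refine Fintype.sum_equiv (Equiv.mulLeft₀ c hc) _ _ fun w => ?_
  rw [Equiv.mulLeft₀_apply, ← legendreSum_mul hc]
  congr 3 <;> ring

end Fourier

/-! ### Minimal models over a discrete valuation ring in which 2 is a unit -/

section MinimalModel

open IsDiscreteValuationRing IsDedekindDomain.HeightOneSpectrum

theorem exists_algebraMap_eq_of_two_mul {R K : Type*} [CommRing R] [Field K] [Algebra R K]
    (h2 : IsUnit (2 : R)) {x : K} {r : R}
    (h : 2 * x = algebraMap R K r) : ∃ s, algebraMap R K s = x := by
  obtain ⟨u, hu⟩ := h2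
  refine ⟨↑u⁻¹ * r, ?_⟩
  rw [map_mul, ← h, ← mul_assoc, ← map_ofNat (algebraMap R K) 2, ← map_mul, ← hu, Units.inv_mul,
    map_one, one_mul]

variable {R : Type*} [CommRing R] [IsDomain R] [IsDiscreteValuationRing R]
  {K : Type*} [Field K] [Algebra R K] [IsFractionRing R K]

theorem valuation_algebraMap_eq_one_iff (r : R) :
    (maximalIdeal R).valuation K (algebraMap R K r) = 1 ↔ IsUnit r := by
  rw [valuation_eq_one_iff_notMem]
  exact IsLocalRing.notMem_maximalIdeal

theorem valuation_algebraMap_lt_one_iff (r : R) :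
    (maximalIdeal R).valuation K (algebraMap R K r) < 1 ↔ ¬ IsUnit r := by
  rw [valuation_lt_one_iff_mem]
  exact IsLocalRing.mem_maximalIdeal r

theorem exists_algebraMap_eq_of_cubic (h2 : IsUnit (2 : R)) {x : K} {a b c : R}
    (h : 4 * x ^ 3 + algebraMap R K a * x ^ 2 + algebraMap R K b * x + algebraMap R K c = 0) :
    ∃ s, algebraMap R K s = x := by
  obtain ⟨u, hu⟩ := h2
  refine (IsIntegrallyClosed.isIntegral_iff (R := R) (K := K)).1 ?_
  have h4 : algebraMap R K (↑u⁻¹ ^ 2) * 4 = 1 := by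
    rw [show (4 : K) = algebraMap R K (2 ^ 2) by rw [map_pow, map_ofNat]; norm_num, ← map_mul,
      ← hu, ← mul_pow, Units.inv_mul, one_pow, map_one]
  refine ⟨Polynomial.X ^ 3 + (Polynomial.C (↑u⁻¹ ^ 2 * a) * Polynomial.X ^ 2 +
    Polynomial.C (↑u⁻¹ ^ 2 * b) * Polynomial.X + Polynomial.C (↑u⁻¹ ^ 2 * c)), ?_, ?_⟩
  · refine Polynomial.monic_X_pow_add ?_
    refine lt_of_le_of_lt (b := (2 : WithBot ℕ)) (by compute_degree) (by norm_num)
  · simp only [Polynomial.eval₂_add, Polynomial.eval₂_pow, Polynomial.eval₂_X,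
      Polynomial.eval₂_mul, Polynomial.eval₂_C]
    rw [map_mul, map_mul _ _ b, map_mul _ _ c]
    linear_combination (algebraMap R K (↑u⁻¹ ^ 2)) * h - x ^ 3 * h4

/-- The minimal model of a curve over a discrete valuation ring in which `2` is a unit is obtained
by an integral change of variables from any integral model for which the discriminant or `c₄` is a
unit. -/
theorem exists_integralModel_minimal_eq (h2 : IsUnit (2 : R)) (W : WeierstrassCurve K)
    (W₀ : WeierstrassCurve R) (D : WeierstrassCurve.VariableChange K)
    (hD : D • W = W₀.baseChange K) (hΔ : W₀.Δ ≠ 0) (hW₀ : IsUnit W₀.Δ ∨ IsUnit W₀.c₄) :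
    ∃ E : WeierstrassCurve.VariableChange R, (W.minimal R).integralModel R = E • W₀ := by
  let v := (maximalIdeal R).valuation K
  obtain ⟨C, hC⟩ : ∃ C : WeierstrassCurve.VariableChange K, W.minimal R = C • W := ⟨_, rfl⟩
  let I := (W.minimal R).integralModel R
  have hI : I.baseChange K = W.minimal R := (W.minimal R).baseChange_integralModel_eq R
  let G := C * D⁻¹
  have hG : G • W₀.baseChange K = I.baseChange K := by
    rw [← hD, smul_smul, inv_mul_cancel_right, hI, hC]
  have hGI : G⁻¹ • I.baseChange K = W₀.baseChange K := by rw [← hG, inv_smul_smul]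
  have hΔ' : algebraMap R K W₀.Δ ≠ 0 := by
    rwa [ne_eq, FaithfulSMul.algebraMap_eq_zero_iff]
  have hmin : v (algebraMap R K W₀.Δ) ≤ v (algebraMap R K I.Δ) := by
    have h1 := (inferInstance : (W.minimal R).IsMinimal R).val_Δ_maximal
    have e1 : G⁻¹ • W.minimal R = W₀.baseChange K := by rw [← hI, hGI]
    have i1 : (G⁻¹ • W.minimal R).IsIntegral R := ⟨W₀, e1⟩
    have h3 := le_of_not_gt (h1.not_gt i1)
    rw [← Subtype.coe_le_coe, WeierstrassCurve.valuation_Δ_aux_eq_of_isIntegral] at h3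
    have i2 : ((1 : WeierstrassCurve.VariableChange K) • W.minimal R).IsIntegral R := by
      rw [one_smul]; infer_instance
    rw [WeierstrassCurve.valuation_Δ_aux_eq_of_isIntegral, e1, one_smul, ← hI,
      WeierstrassCurve.baseChange, WeierstrassCurve.baseChange, WeierstrassCurve.map_Δ, WeierstrassCurve.map_Δ] at h3
    exact h3
  have eΔ : algebraMap R K I.Δ = G.u⁻¹ ^ 12 * algebraMap R K W₀.Δ := by
    rw [← WeierstrassCurve.map_Δ, ← WeierstrassCurve.map_Δ, ← WeierstrassCurve.variableChange_Δ]
    exact congr_arg _ hG.symm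
  have ec₄ : algebraMap R K I.c₄ = G.u⁻¹ ^ 4 * algebraMap R K W₀.c₄ := by
    rw [← WeierstrassCurve.map_c₄, ← WeierstrassCurve.map_c₄, ← WeierstrassCurve.variableChange_c₄]
    exact congr_arg _ hG.symm
  have hu0 : (G.u : K) ≠ 0 := G.u.ne_zero
  -- Minimality of `I` prevents its discriminant from being more divisible than that of `W₀`; the
  -- two differ by the twelfth power of `u`.
  have hvu1 : v (G.u : K) ≤ 1 := by
    by_contra! hlt
    have h5 : v (algebraMap R K I.Δ) * v (G.u : K) ^ 12 = v (algebraMap R K W₀.Δ) := by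
      rw [eΔ, ← map_pow, ← map_mul, mul_right_comm, Units.val_inv_eq_inv_val, ← mul_pow,
        inv_mul_cancel₀ hu0, one_pow, one_mul]
    have h6 : v (algebraMap R K I.Δ) ≠ 0 := by
      rw [v.ne_zero_iff, eΔ]
      exact mul_ne_zero (pow_ne_zero _ (Units.ne_zero _)) hΔ'
    have h7 : 1 < v (G.u : K) ^ 12 := one_lt_pow₀ hlt (by norm_num)
    have h8 : v (algebraMap R K I.Δ) * 1 < v (algebraMap R K I.Δ) * v (G.u : K) ^ 12 :=
      mul_lt_mul_of_pos_left h7 (zero_lt_iff.2 h6)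
    rw [mul_one, h5] at h8
    exact not_lt.2 hmin h8
  -- Conversely `I` has integral `Δ` and `c₄`, and one of these invariants of `W₀` is a unit. So `u`
  -- is a unit of `R`.
  have hvu2 : v ((G.u⁻¹ : Kˣ) : K) ≤ 1 := by
    rcases hW₀ with h | h
    · have h5 : v ((G.u⁻¹ : Kˣ) : K) ^ 12 ≤ 1 := by
        have : v (algebraMap R K I.Δ) ≤ 1 := valuation_le_one (maximalIdeal R) I.Δ
        rwa [eΔ, map_mul, (valuation_algebraMap_eq_one_iff _).2 h, mul_one, map_pow] at this
      exact (pow_le_one_iff (by norm_num)).1 h5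
    · have h5 : v ((G.u⁻¹ : Kˣ) : K) ^ 4 ≤ 1 := by
        have : v (algebraMap R K I.c₄) ≤ 1 := valuation_le_one (maximalIdeal R) I.c₄
        rwa [ec₄, map_mul, (valuation_algebraMap_eq_one_iff _).2 h, mul_one, map_pow] at this
      exact (pow_le_one_iff (by norm_num)).1 h5
  obtain ⟨u, hu⟩ := exists_lift_of_le_one hvu1
  obtain ⟨u', hu'⟩ := exists_lift_of_le_one hvu2
  have hinj : Function.Injective (algebraMap R K) := IsFractionRing.injective R K
  have huu : u * u' = 1 := hinj (by rw [map_mul, hu, hu', Units.mul_inv, map_one])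
  have hinv : ∀ x : K, (G.u : K) * (((G.u⁻¹ : Kˣ) : K) * x) = x := fun x => by
    rw [← mul_assoc, Units.mul_inv, one_mul]
  have e6 : algebraMap R K I.b₆ = G.u⁻¹ ^ 6 * (algebraMap R K W₀.b₆ +
      2 * G.r * algebraMap R K W₀.b₄ + G.r ^ 2 * algebraMap R K W₀.b₂ + 4 * G.r ^ 3) := by
    rw [← WeierstrassCurve.map_b₆, ← WeierstrassCurve.map_b₆, ← WeierstrassCurve.map_b₄,
      ← WeierstrassCurve.map_b₂, ← WeierstrassCurve.variableChange_b₆]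
    exact congr_arg _ hG.symm
  -- The transformation of `b₆` is a cubic equation for `r` with leading coefficient 4, a unit.
  -- Those of `a₁` and `a₃` then determine `s` and `t` after division by 2.
  obtain ⟨r, hr⟩ : ∃ r, algebraMap R K r = G.r := by
    refine exists_algebraMap_eq_of_cubic h2 (a := W₀.b₂) (b := 2 * W₀.b₄)
      (c := W₀.b₆ - u ^ 6 * I.b₆) ?_
    have h5 : (G.u : K) ^ 6 * ((G.u⁻¹ : Kˣ) : K) ^ 6 = 1 := by
      rw [← mul_pow, Units.mul_inv, one_pow]
    rw [map_sub, map_mul, map_mul, map_pow, hu, e6, map_ofNat]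
    linear_combination -(algebraMap R K W₀.b₆ + 2 * G.r * algebraMap R K W₀.b₄ +
      G.r ^ 2 * algebraMap R K W₀.b₂ + 4 * G.r ^ 3) * h5
  have e1 : algebraMap R K I.a₁ = G.u⁻¹ * (algebraMap R K W₀.a₁ + 2 * G.s) :=
    congr_arg WeierstrassCurve.a₁ hG.symm
  have e3 : algebraMap R K I.a₃ =
      G.u⁻¹ ^ 3 * (algebraMap R K W₀.a₃ + G.r * algebraMap R K W₀.a₁ + 2 * G.t) :=
    congr_arg WeierstrassCurve.a₃ hG.symm
  obtain ⟨s, hs⟩ : ∃ s, algebraMap R K s = G.s := by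
    refine exists_algebraMap_eq_of_two_mul h2 (r := u * I.a₁ - W₀.a₁) ?_
    rw [map_sub, map_mul, hu, e1, hinv]
    ring
  obtain ⟨t, ht⟩ : ∃ t, algebraMap R K t = G.t := by
    refine exists_algebraMap_eq_of_two_mul h2 (r := u ^ 3 * I.a₃ - W₀.a₃ - r * W₀.a₁) ?_
    have h5 : (G.u : K) ^ 3 * ((G.u⁻¹ : Kˣ) : K) ^ 3 = 1 := by
      rw [← mul_pow, Units.mul_inv, one_pow]
    rw [map_sub, map_sub, map_mul, map_pow, hu, map_mul, hr, e3]
    linear_combination -(algebraMap R K W₀.a₃ + G.r * algebraMap R K W₀.a₁ + 2 * G.t) * h5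
  let E : WeierstrassCurve.VariableChange R :=
    ⟨⟨u, u', huu, (mul_comm _ _).trans huu⟩, r, s, t⟩
  have hE : E.map (algebraMap R K) = G := by
    refine WeierstrassCurve.VariableChange.ext (Units.ext hu) hr hs ht
  refine ⟨E, WeierstrassCurve.map_injective hinj ?_⟩
  change I.map _ = (E • W₀).map _
  rw [← WeierstrassCurve.map_variableChange, hE]
  exact hG.symm

end MinimalModel

/-! ### Invariants of `y² = x (x + A) (x + B)` -/

section LegendreCurve

/-- The curve `y² = x (x + A) (x + B)`. -/
def legendreCurve {R : Type*} [CommRing R] (A B : R) : WeierstrassCurve R :=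
  ⟨0, A + B, 0, A * B, 0⟩

variable {R : Type*} [CommRing R] (A B : R)

theorem legendreCurve_b₂ : (legendreCurve A B).b₂ = 4 * (A + B) := by
  simp [legendreCurve, WeierstrassCurve.b₂]

theorem legendreCurve_b₄ : (legendreCurve A B).b₄ = 2 * (A * B) := by
  simp [legendreCurve, WeierstrassCurve.b₄]

theorem legendreCurve_b₆ : (legendreCurve A B).b₆ = 0 := by
  simp [legendreCurve, WeierstrassCurve.b₆]

theorem legendreCurve_Δ : (legendreCurve A B).Δ = 16 * A ^ 2 * B ^ 2 * (A - B) ^ 2 := by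
  simp [legendreCurve, WeierstrassCurve.Δ, WeierstrassCurve.b₂, WeierstrassCurve.b₄,
    WeierstrassCurve.b₆, WeierstrassCurve.b₈]
  ring

theorem legendreCurve_c₄ : (legendreCurve A B).c₄ = 16 * (A ^ 2 - A * B + B ^ 2) := by
  rw [WeierstrassCurve.c₄, legendreCurve_b₂, legendreCurve_b₄]
  ring

theorem legendreCurve_c₆ :
    (legendreCurve A B).c₆ = -64 * (A + B) ^ 3 + 288 * (A + B) * (A * B) := by
  rw [WeierstrassCurve.c₆, legendreCurve_b₂, legendreCurve_b₄, legendreCurve_b₆]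
  ring

theorem legendreCurve_map {S : Type*} [CommRing S] (f : R →+* S) :
    (legendreCurve A B).map f = legendreCurve (f A) (f B) := by
  ext <;> simp [legendreCurve]

end LegendreCurve

/-! ### Point counts by quadratic characters -/

section PointCount

variable {k : Type*} [Field k] [Fintype k] [DecidableEq k]

/-- The cubic in the character is the discriminant of the Weierstrass equation as a quadratic in
`y`. As `Δ ≠ 0`, all affine solutions are nonsingular, and the extra 1 is the point at infinity. -/
theorem card_point_eq (hk : ringChar k ≠ 2) (W : WeierstrassCurve k) (hΔ : W.Δ ≠ 0) :
    (Nat.card W.toAffine.Point : ℤ) = Nat.card k + 1 +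
      ∑ x : k, quadraticChar k (4 * x ^ 3 + W.b₂ * x ^ 2 + 2 * W.b₄ * x + W.b₆) := by
  classical
  have : W.toAffine.IsElliptic := ⟨hΔ.isUnit⟩
  rw [Nat.card_congr (WeierstrassCurve.Affine.pointEquiv W.toAffine)]
  change (Nat.card (Option _) : ℤ) = _
  rw [Finite.card_option, Nat.card_eq_fintype_card, Fintype.card_subtype, Nat.cast_add,
    Nat.cast_one, Finset.card_filter, Nat.cast_sum, Fintype.sum_prod_type, add_right_comm,
    add_left_inj]
  have h1 : ∀ x : k, ∑ y : k, ((if W.toAffine.Equation x y then 1 else 0 : ℕ) : ℤ) =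
      1 + quadraticChar k (4 * x ^ 3 + W.b₂ * x ^ 2 + 2 * W.b₄ * x + W.b₆) := by
    intro x
    have h2 := card_quadratic_roots hk one_ne_zero (W.a₁ * x + W.a₃)
      (-(x ^ 3 + W.a₂ * x ^ 2 + W.a₄ * x + W.a₆))
    rw [show 4 * x ^ 3 + W.b₂ * x ^ 2 + 2 * W.b₄ * x + W.b₆ = (W.a₁ * x + W.a₃) ^ 2 -
      4 * 1 * -(x ^ 3 + W.a₂ * x ^ 2 + W.a₄ * x + W.a₆) by
        simp only [WeierstrassCurve.b₂, WeierstrassCurve.b₄, WeierstrassCurve.b₆]; ring, ← h2,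
      ← Nat.cast_sum, ← Finset.card_filter]
    congr 2
    ext y
    simp only [Finset.mem_filter, Finset.mem_univ, true_and]
    rw [WeierstrassCurve.Affine.equation_iff']
    ring_nf
  simp only [h1, Finset.sum_add_distrib]
  simp

theorem card_point_smul_legendreCurve (hk : ringChar k ≠ 2) (A B : k)
    (E : WeierstrassCurve.VariableChange k) (hΔ : (legendreCurve A B).Δ ≠ 0) :
    (Nat.card (E • legendreCurve A B).toAffine.Point : ℤ) =
      Nat.card k + 1 + legendreSum A B := by
  have hΔ' : (E • legendreCurve A B).Δ ≠ 0 := by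
    rw [WeierstrassCurve.variableChange_Δ]
    exact mul_ne_zero (pow_ne_zero _ (Units.ne_zero _)) hΔ
  rw [card_point_eq hk _ hΔ', legendreSum_eq, add_right_inj]
  refine Fintype.sum_equiv ((Equiv.mulLeft₀ ((E.u : k) ^ 2) (pow_ne_zero _ E.u.ne_zero)).trans
    (Equiv.addRight E.r)) _ _ fun x => ?_
  rw [WeierstrassCurve.variableChange_b₂, WeierstrassCurve.variableChange_b₄,
    WeierstrassCurve.variableChange_b₆, legendreCurve_b₂, legendreCurve_b₄, legendreCurve_b₆,
    -- The square of `2 u⁻³` accounts for the leading coefficient 4 and for the scaling of the cubic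
    -- by `u⁻⁶`.
    ← quadraticChar_mul_sq (c := 2 * ((E.u⁻¹ : kˣ) : k) ^ 3)
      (mul_ne_zero (Ring.two_ne_zero hk) (pow_ne_zero _ (Units.ne_zero _)))
      (((Equiv.mulLeft₀ _ _).trans _) x * _ * _)]
  congr 1
  simp only [Equiv.trans_apply, Equiv.mulLeft₀_apply, Equiv.coe_addRight]
  have hu : (E.u : k) ≠ 0 := E.u.ne_zero
  rw [Units.val_inv_eq_inv_val]
  field_simp
  ring

end PointCount

/-! ### Splitting of quadratic polynomials -/

section SplitReduction

open Polynomial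

theorem splits_quadratic_iff {k : Type*} [Field k] (h2 : (2 : k) ≠ 0) {a b c : k} (ha : a ≠ 0) :
    (C a * X ^ 2 + C b * X + C c).Splits ↔ IsSquare (discrim a b c) := by
  have : NeZero (2 : k) := ⟨h2⟩
  have hd : (C a * X ^ 2 + C b * X + C c).natDegree = 2 := natDegree_quadratic ha
  constructor
  · intro h
    obtain ⟨x, hx⟩ := h.exists_eval_eq_zero (by
      rw [degree_quadratic ha]
      norm_num)
    refine ⟨2 * a * x + b, ?_⟩
    rw [← sq]
    refine discrim_eq_sq_of_quadratic_eq_zero ?_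
    simpa [sq] using hx
  · rintro ⟨s, hs⟩
    obtain ⟨x, hx⟩ := exists_quadratic_eq_zero ha ⟨s, hs⟩
    refine Splits.of_natDegree_eq_two (x := x) hd ?_
    simpa [sq] using hx

end SplitReduction

/-! ### Local polynomials of good and multiplicative reduction -/

section LocalPolynomial

open IsDiscreteValuationRing IsLocalRing Polynomial

variable {R : Type*} [CommRing R] [IsDomain R] [IsDiscreteValuationRing R]
  {K : Type*} [Field K] [Algebra R K] [IsFractionRing R K]

/-- The change of variables to the minimal model is integral, so it reduces to one over the residue
field and preserves the point count there. -/
theorem localPolynomial_of_isUnit_Δ [Finite (ResidueField R)] (h2 : IsUnit (2 : R))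
    (W : WeierstrassCurve K) {A B : R} (D : WeierstrassCurve.VariableChange K)
    (hD : D • W = (legendreCurve A B).baseChange K) (hΔ : IsUnit (legendreCurve A B).Δ) :
    W.localPolynomial R = 1 + C (legendreSum (residue R A) (residue R B)) * X +
      C (Nat.card (ResidueField R) : ℤ) * X ^ 2 := by
  classical
  let := Fintype.ofFinite (ResidueField R)
  obtain ⟨E, hE⟩ := exists_integralModel_minimal_eq h2 W _ D hD hΔ.ne_zero (Or.inl hΔ)
  have hk : ringChar (ResidueField R) ≠ 2 := by
    intro h
    have h3 : (residue R) 2 = 0 := by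
      rw [map_ofNat]
      exact_mod_cast h ▸ ringChar.Nat.cast_ringChar (R := ResidueField R)
    exact (h2.map (residue R)).ne_zero h3
  have hgood : (W.minimal R).HasGoodReduction R := by
    refine (WeierstrassCurve.hasGoodReduction_iff _ _).2 ⟨inferInstance, ?_⟩
    rw [← WeierstrassCurve.integralModel_Δ_eq R, hE, valuation_algebraMap_eq_one_iff,
      WeierstrassCurve.variableChange_Δ]
    exact (E.u⁻¹.isUnit.pow _).mul hΔ
  have hred : (W.minimal R).reduction R =
      E.map (residue R) • legendreCurve (residue R A) (residue R B) := by
    rw [WeierstrassCurve.reduction, hE, ← WeierstrassCurve.map_variableChange, legendreCurve_map]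
  rw [WeierstrassCurve.localPolynomial, if_pos hgood, hred, card_point_smul_legendreCurve hk]
  · simp only [sub_add_cancel_left, map_neg]
    ring
  · rw [← legendreCurve_map, WeierstrassCurve.map_Δ]
    exact (hΔ.map (residue R)).ne_zero

-- The tangent directions at the node are the roots of a quadratic polynomial with discriminant `-c₄
-- c₆`. Under an integral change of variables this is multiplied by the square of a unit, so
-- splitness can be tested on `W₀`.
open Classical in
theorem localPolynomial_of_isUnit_c₄ (h2 : IsUnit (2 : R))
    (W : WeierstrassCurve K) (W₀ : WeierstrassCurve R) (D : WeierstrassCurve.VariableChange K)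
    (hD : D • W = W₀.baseChange K) (hΔ0 : W₀.Δ ≠ 0) (hΔ : ¬ IsUnit W₀.Δ) (hc : IsUnit W₀.c₄) :
    W.localPolynomial R =
      if IsSquare (residue R (-(W₀.c₄ * W₀.c₆))) then 1 - X else 1 + X := by
  obtain ⟨E, hE⟩ := exists_integralModel_minimal_eq h2 W _ D hD hΔ0 (Or.inr hc)
  have hbad : (IsDiscreteValuationRing.maximalIdeal R).valuation K (W.minimal R).Δ < 1 := by
    rw [← WeierstrassCurve.integralModel_Δ_eq R, hE, valuation_algebraMap_lt_one_iff,
      WeierstrassCurve.variableChange_Δ]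
    exact fun h => hΔ (isUnit_of_mul_isUnit_right h)
  have hc' : IsUnit (E • W₀).c₄ := by
    rw [WeierstrassCurve.variableChange_c₄]
    exact (E.u⁻¹.isUnit.pow _).mul hc
  have hmult : (W.minimal R).HasMultiplicativeReduction R := by
    refine (WeierstrassCurve.hasMultiplicativeReduction_iff _ _).2 ⟨inferInstance, hbad, ?_⟩
    rw [← WeierstrassCurve.integralModel_c₄_eq R, hE, valuation_algebraMap_eq_one_iff]
    exact hc'
  have hgood : ¬ (W.minimal R).HasGoodReduction R := hmult.not_hasGoodReduction R
  have h2' : (2 : ResidueField R) ≠ 0 := by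
    rw [← map_ofNat (residue R)]
    exact (h2.map (residue R)).ne_zero
  have hsplit : (W.minimal R).HasSplitMultiplicativeReduction R ↔
      IsSquare (residue R (-(W₀.c₄ * W₀.c₆))) := by
    rw [WeierstrassCurve.hasSplitMultiplicativeReduction_iff, exists_prop_of_true hmult, hE]
    set I := E • W₀ with hI
    have e1 : (C I.c₄ * X ^ 2 + C (I.a₁ * I.c₄) * X -
        C (54 * I.b₆ - 3 * I.b₂ * I.b₄ + I.a₂ * I.c₄)).map (algebraMap R (ResidueField R)) =
        C (residue R I.c₄) * X ^ 2 + C (residue R (I.a₁ * I.c₄)) * X +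
          C (residue R (-(54 * I.b₆ - 3 * I.b₂ * I.b₄ + I.a₂ * I.c₄))) := by
      rw [map_neg (residue R), map_neg C, ← sub_eq_add_neg]
      simp only [Polynomial.map_sub, Polynomial.map_add, Polynomial.map_mul, Polynomial.map_pow,
        Polynomial.map_C, Polynomial.map_X]
      rfl
    have e2 : discrim I.c₄ (I.a₁ * I.c₄) (-(54 * I.b₆ - 3 * I.b₂ * I.b₄ + I.a₂ * I.c₄)) =
        -(I.c₄ * I.c₆) := by
      have e3 : -I.c₆ = I.b₂ * I.c₄ + 216 * I.b₆ - 12 * I.b₂ * I.b₄ := by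
        rw [WeierstrassCurve.c₆, WeierstrassCurve.c₄]
        ring
      rw [← mul_neg, e3, WeierstrassCurve.b₂, discrim]
      ring
    have e4 : -(W₀.c₄ * W₀.c₆) = -(I.c₄ * I.c₆) * ((E.u : R) ^ 5) ^ 2 := by
      rw [hI, WeierstrassCurve.variableChange_c₄, WeierstrassCurve.variableChange_c₆]
      have e5 : ((E.u⁻¹ : Rˣ) : R) ^ 10 * (E.u : R) ^ 10 = 1 := by
        rw [← mul_pow, Units.inv_mul, one_pow]
      linear_combination (W₀.c₄ * W₀.c₆) * e5
    rw [e1, splits_quadratic_iff h2' (hc'.map (residue R)).ne_zero]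
    have e6 : discrim (residue R I.c₄) (residue R (I.a₁ * I.c₄))
        (residue R (-(54 * I.b₆ - 3 * I.b₂ * I.b₄ + I.a₂ * I.c₄))) =
        residue R (-(I.c₄ * I.c₆)) := by
      rw [← e2]
      simp only [discrim, map_sub, map_pow, map_mul, map_ofNat]
    rw [e6, e4, map_mul, map_pow]
    have hu : residue R (E.u ^ 5) ≠ 0 := ((E.u.isUnit.pow 5).map (residue R)).ne_zero
    constructor
    · rintro ⟨s, hs⟩
      exact ⟨s * residue R (E.u ^ 5), by rw [hs]; ring⟩
    · rintro ⟨s, hs⟩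
      refine ⟨s / residue R (E.u ^ 5), ?_⟩
      rw [div_mul_div_comm, ← hs, ← sq, mul_div_cancel_right₀ _ (pow_ne_zero 2 hu)]
  rw [WeierstrassCurve.localPolynomial, if_neg hgood]
  simp only [hsplit, hmult, if_true]

end LocalPolynomial

/-! ### Local rings and residue fields of finite places -/

section FinitePlaces

open Polynomial IsLocalRing

variable {F : Type*} [Field F]

theorem Place.isUnit_iff (v : Place F) (x : v.localRing) :
    IsUnit x ↔ v.valuation (x : RatFunc F) = 1 := by
  have h := Valuation.Integer.not_isUnit_iff_valuation_lt_one (v := v.valuation) (x := x)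
  have h1 : v.valuation (x : RatFunc F) ≤ 1 := x.2
  constructor
  · intro hx
    by_contra hne
    exact h.2 (lt_of_le_of_ne h1 hne) hx
  · intro hx
    by_contra hne
    exact (h.1 hne).ne hx

/-- The inclusion of `F[t]` in the local ring of a finite place. -/
def FinitePlace.toLocalRing (v : FinitePlace F) : F[X] →+* (Place.finite v).localRing :=
  (algebraMap F[X] (RatFunc F)).codRestrict (Place.finite v).localRing.toSubring
    fun p => v.primeIdeal.valuation_le_one p

theorem FinitePlace.coe_toLocalRing (v : FinitePlace F) (p : F[X]) :
    ((v.toLocalRing p : (Place.finite v).localRing) : RatFunc F) = algebraMap F[X] (RatFunc F) p :=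
  rfl

theorem FinitePlace.isUnit_toLocalRing_iff (v : FinitePlace F) (p : F[X]) :
    IsUnit (v.toLocalRing p) ↔ ¬ v.poly ∣ p := by
  rw [Place.isUnit_iff, coe_toLocalRing, ← Ideal.mem_span_singleton]
  exact v.primeIdeal.valuation_eq_one_iff_notMem

theorem FinitePlace.residue_toLocalRing_eq_zero_iff (v : FinitePlace F) (p : F[X]) :
    residue _ (v.toLocalRing p) = 0 ↔ v.poly ∣ p := by
  rw [← not_iff_not, ← isUnit_toLocalRing_iff]
  exact residue_ne_zero_iff_isUnit _

/-- In lowest terms an element integral at `v` has denominator prime to `v`, and such a denominator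
is invertible modulo `v` by a polynomial. -/
theorem FinitePlace.residue_toLocalRing_surjective (v : FinitePlace F) :
    Function.Surjective ((residue (Place.finite v).localRing).comp v.toLocalRing) := by
  intro y
  obtain ⟨x, rfl⟩ := residue_surjective y
  set a := (x : RatFunc F).num
  set b := (x : RatFunc F).denom with hb
  have hxb : (x : RatFunc F) * algebraMap F[X] (RatFunc F) b = algebraMap F[X] (RatFunc F) a := by
    exact ((div_eq_iff (RatFunc.algebraMap_ne_zero (RatFunc.denom_ne_zero _))).1
      (RatFunc.num_div_denom (x : RatFunc F))).symm
  have hxb' : x * v.toLocalRing b = v.toLocalRing a := Subtype.ext hxb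
  have hbv : ¬ v.poly ∣ b := by
    intro hdvd
    have h1 : v.poly ∣ a := by
      rw [← residue_toLocalRing_eq_zero_iff] at hdvd ⊢
      rw [← hxb', map_mul, hdvd, mul_zero]
    exact v.irreducible.not_isUnit
      ((RatFunc.isCoprime_num_denom (x : RatFunc F)).isUnit_of_dvd' h1 hdvd)
  obtain ⟨c, d, hcd⟩ := (v.irreducible.coprime_iff_not_dvd.2 hbv)
  refine ⟨a * d, ?_⟩
  have hv : residue _ (v.toLocalRing v.poly) = 0 :=
    (v.residue_toLocalRing_eq_zero_iff _).2 dvd_rfl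
  have h1 := congr_arg (fun p => residue _ (v.toLocalRing p)) hcd
  simp only [map_add, map_mul, hv, mul_zero, zero_add, map_one] at h1
  rw [RingHom.comp_apply, map_mul, ← hxb', map_mul, map_mul, mul_assoc,
    mul_comm (residue _ (v.toLocalRing b)), h1, mul_one]

/-- The residue field of the local ring of a finite place `v` is `F[t] / (B_v)`. -/
def FinitePlace.residueFieldEquiv (v : FinitePlace F) :
    v.residueField ≃+* ResidueField (Place.finite v).localRing :=
  (Ideal.quotEquivOfEq (by
    ext p
    rw [Ideal.mem_span_singleton, RingHom.mem_ker, RingHom.comp_apply,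
      v.residue_toLocalRing_eq_zero_iff])).trans
    (RingHom.quotientKerEquivOfSurjective v.residue_toLocalRing_surjective)

theorem FinitePlace.residueFieldEquiv_mk (v : FinitePlace F) (p : F[X]) :
    v.residueFieldEquiv (AdjoinRoot.mk v.poly p) = residue _ (v.toLocalRing p) :=
  rfl

end FinitePlaces

/-! ### Local factors at the finite places -/

section LocalFactor

open Polynomial IsLocalRing

variable {F : Type*} [Field F]

theorem quadraticChar_ringEquiv {k l : Type*} [Field k] [Fintype k] [DecidableEq k] [Field l]
    [Fintype l] [DecidableEq l] (e : k ≃+* l) (x : k) : quadraticChar l (e x) = quadraticChar k x := by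
  have h : IsSquare (e x) ↔ IsSquare x :=
    ⟨fun hx => by simpa using hx.map e.symm, fun hx => hx.map e⟩
  simp only [quadraticChar_apply, quadraticCharFun, EmbeddingLike.map_eq_zero_iff, h]

theorem legendreSum_ringEquiv {k l : Type*} [Field k] [Finite k] [Field l] [Finite l]
    (e : k ≃+* l) (A B : k) : legendreSum (e A) (e B) = legendreSum A B := by
  classical
  let := Fintype.ofFinite k
  let := Fintype.ofFinite l
  rw [legendreSum_eq, legendreSum_eq]
  symm
  refine Fintype.sum_equiv e.toEquiv _ _ fun x => ?_
  rw [← quadraticChar_ringEquiv e]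
  simp

variable (F) in
/-- The polynomial `t ^ (q ^ a) - t`. -/
def wpPoly (a : ℕ) : F[X] := X ^ (Nat.card F ^ a) - X

theorem curve_eq (a : ℕ) (γ : F) :
    curve a γ = (legendreCurve (C (16 * γ)) (wpPoly F a ^ 2)).map (algebraMap F[X] (RatFunc F)) := by
  have h : (RatFunc.C (16 : F)) = 16 := map_ofNat _ _
  ext <;> simp [curve, legendreCurve, wpPoly, wp, h]

section

variable [Finite F]

theorem natDegree_wpPoly {a : ℕ} (ha : 1 ≤ a) : (wpPoly F a).natDegree = Nat.card F ^ a := by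
  have h1 : 1 < Nat.card F ^ a := Nat.one_lt_pow (by omega) Finite.one_lt_card
  rw [wpPoly, natDegree_sub_eq_left_of_natDegree_lt, natDegree_X_pow]
  simpa using h1

theorem natDegree_wpPoly_pos {a : ℕ} (ha : 1 ≤ a) : 0 < (wpPoly F a).natDegree := by
  rw [natDegree_wpPoly ha]
  exact pow_pos Nat.card_pos _

theorem wpPoly_ne_zero {a : ℕ} (ha : 1 ≤ a) : wpPoly F a ≠ 0 :=
  ne_zero_of_natDegree_gt (natDegree_wpPoly_pos ha)

theorem wpPoly_sq_ne_C {a : ℕ} (ha : 1 ≤ a) (c : F) : wpPoly F a ^ 2 ≠ C c := by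
  intro h
  have h1 := congr_arg natDegree h
  rw [natDegree_pow, natDegree_C] at h1
  have := natDegree_wpPoly_pos (F := F) ha
  omega

theorem sixteen_mul_ne_zero {k : Type*} [Field k] (hk : ringChar k ≠ 2) {γ : k} (hγ : γ ≠ 0) :
    16 * γ ≠ 0 := by
  rw [show (16 : k) = 2 ^ 4 by norm_num]
  exact mul_ne_zero (pow_ne_zero _ (Ring.two_ne_zero hk)) hγ

theorem curve_Δ_ne_zero (hF : ringChar F ≠ 2) {γ : F} (hγ : γ ≠ 0) {a : ℕ} (ha : 1 ≤ a) :
    (legendreCurve (C (16 * γ)) (wpPoly F a ^ 2)).Δ ≠ 0 := by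
  have h16 : (16 : F[X]) ≠ 0 := by
    rw [show (16 : F[X]) = C 16 from (map_ofNat C 16).symm, Ne, C_eq_zero, ← mul_one (16 : F)]
    exact sixteen_mul_ne_zero hF one_ne_zero
  rw [legendreCurve_Δ]
  refine mul_ne_zero (mul_ne_zero (mul_ne_zero h16 (pow_ne_zero _ ?_))
    (pow_ne_zero _ (pow_ne_zero _ (wpPoly_ne_zero ha)))) (pow_ne_zero _ ?_)
  · rw [Ne, C_eq_zero]
    exact sixteen_mul_ne_zero hF hγ
  · rw [sub_ne_zero]
    exact (wpPoly_sq_ne_C ha _).symm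

theorem curve_isElliptic (hF : ringChar F ≠ 2) {γ : F} (hγ : γ ≠ 0) {a : ℕ} (ha : 1 ≤ a) :
    (curve a γ).IsElliptic := by
  refine ⟨?_⟩
  rw [curve_eq, WeierstrassCurve.map_Δ, isUnit_iff_ne_zero]
  exact RatFunc.algebraMap_ne_zero (curve_Δ_ne_zero hF hγ ha)

end

/-- The value of `℘_a` at the class of `t` in the residue field of a finite place. -/
def FinitePlace.wpAt (v : FinitePlace F) (a : ℕ) : v.residueField :=
  AdjoinRoot.root v.poly ^ (Nat.card F ^ a) - AdjoinRoot.root v.poly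

theorem isUnit_two_localRing (hF : ringChar F ≠ 2) (v : FinitePlace F) :
    IsUnit (2 : (Place.finite v).localRing) := by
  rw [← map_ofNat v.toLocalRing, ← map_ofNat C]
  exact (((Ring.two_ne_zero hF).isUnit).map C).map v.toLocalRing

theorem curve_eq_baseChange (a : ℕ) (γ : F) (v : FinitePlace F) :
    (1 : WeierstrassCurve.VariableChange (RatFunc F)) • curve a γ =
      (legendreCurve (v.toLocalRing (C (16 * γ))) (v.toLocalRing (wpPoly F a ^ 2))).baseChange
        (RatFunc F) := by
  rw [one_smul, curve_eq, ← legendreCurve_map]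
  rfl

theorem residue_toLocalRing_C (v : FinitePlace F) (c : F) :
    residue _ (v.toLocalRing (C c)) = v.residueFieldEquiv (algebraMap F v.residueField c) := rfl

theorem residue_toLocalRing_wpPoly_sq (v : FinitePlace F) (a : ℕ) :
    residue _ (v.toLocalRing (wpPoly F a ^ 2)) = v.residueFieldEquiv (v.wpAt a ^ 2) := by
  rw [← v.residueFieldEquiv_mk]
  simp [wpPoly, FinitePlace.wpAt]

variable [Finite F]

/-- The reciprocal roots of the local polynomial at a finite place, and the point counts over the
extensions of the residue field. -/
theorem exists_localPolynomial_roots (hF : ringChar F ≠ 2) {γ : F} (hγ : γ ≠ 0) {a : ℕ}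
    (ha : 1 ≤ a) (v : FinitePlace F) :
    ∃ l l' : ℂ, ((curve a γ).localPolynomial (Place.finite v).localRing).map (Int.castRingHom ℂ) =
      (1 - C l * X) * (1 - C l' * X) ∧
      ∀ (k : Type) [Field k] [Algebra v.residueField k] [Finite k],
        -(legendreSum (algebraMap v.residueField k (algebraMap F _ (16 * γ)))
          (algebraMap v.residueField k (v.wpAt a ^ 2)) : ℂ) =
          l ^ Module.finrank v.residueField k + l' ^ Module.finrank v.residueField k := by
  classical
  let := Fintype.ofFinite v.residueField
  have : Finite (ResidueField (Place.finite v).localRing) :=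
    Finite.of_equiv _ v.residueFieldEquiv.toEquiv
  have h2 := isUnit_two_localRing hF v
  have hk : ringChar v.residueField ≠ 2 := by rwa [v.ringChar_residueField]
  set A : v.residueField := algebraMap F _ (16 * γ) with hA
  set B : v.residueField := v.wpAt a ^ 2 with hB
  set A' := v.toLocalRing (C (16 * γ)) with hA'
  set B' := v.toLocalRing (wpPoly F a ^ 2) with hB'
  have eA : residue _ A' = v.residueFieldEquiv A := residue_toLocalRing_C v _
  have eB : residue _ B' = v.residueFieldEquiv B := residue_toLocalRing_wpPoly_sq v a
  have hA0 : A ≠ 0 := (_root_.map_ne_zero _).2 (sixteen_mul_ne_zero hF hγ)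
  have h16 : (16 : v.residueField) ≠ 0 := by
    rw [← mul_one (16 : v.residueField)]
    exact sixteen_mul_ne_zero hk one_ne_zero
  have hres : ∀ x : (Place.finite v).localRing, IsUnit x ↔ residue _ x ≠ 0 :=
    fun x => (residue_ne_zero_iff_isUnit x).symm
  have eΔ : residue _ (legendreCurve A' B').Δ =
      v.residueFieldEquiv (16 * A ^ 2 * B ^ 2 * (A - B) ^ 2) := by
    rw [legendreCurve_Δ]
    simp only [map_mul, map_pow, map_sub, eA, eB, map_ofNat]
  have ec₄ : residue _ (legendreCurve A' B').c₄ =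
      v.residueFieldEquiv (16 * (A ^ 2 - A * B + B ^ 2)) := by
    rw [legendreCurve_c₄]
    simp only [map_mul, map_pow, map_sub, map_add, eA, eB, map_ofNat]
  have ec₆ : residue _ (legendreCurve A' B').c₆ =
      v.residueFieldEquiv (-64 * (A + B) ^ 3 + 288 * (A + B) * (A * B)) := by
    rw [legendreCurve_c₆]
    simp only [map_mul, map_pow, map_neg, map_add, eA, eB, map_ofNat]
  have hΔ0 : (legendreCurve A' B').Δ ≠ 0 := by
    intro h
    have h1 := congr_arg (algebraMap _ (RatFunc F)) h
    rw [← WeierstrassCurve.map_Δ] at h1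
    have h3 := curve_eq_baseChange a γ v
    rw [one_smul] at h3
    change (WeierstrassCurve.baseChange _ (RatFunc F)).Δ = _ at h1
    rw [← h3, map_zero] at h1
    exact (curve_isElliptic hF hγ ha).isUnit.ne_zero h1
  -- The discriminant is `16 A² B² (A - B)²` with `16` and `A` nonzero, so this is the condition for
  -- good reduction.
  by_cases hgood : B ≠ 0 ∧ A ≠ B
  · have hΔ : IsUnit (legendreCurve A' B').Δ := by
      rw [hres, eΔ, EmbeddingLike.map_ne_zero_iff]
      exact mul_ne_zero (mul_ne_zero (mul_ne_zero h16 (pow_ne_zero _ hA0))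
        (pow_ne_zero _ hgood.1)) (pow_ne_zero _ (sub_ne_zero.2 hgood.2))
    obtain ⟨l, l', h3, h4⟩ := exists_add_eq_mul_eq (-(legendreSum A B : ℤ))
      (Nat.card v.residueField)
    refine ⟨l, l', ?_, fun k _ _ _ => legendreSum_extension hk hA0 hgood.1 hgood.2 h3 h4 k⟩
    rw [localPolynomial_of_isUnit_Δ h2 (curve a γ) 1 (curve_eq_baseChange a γ v) hΔ, eA, eB,
      legendreSum_ringEquiv, ← Nat.card_congr v.residueFieldEquiv.toEquiv]
    have h5 : (1 - C l * X) * (1 - C l' * X) = 1 - C (l + l') * X + C (l * l') * X ^ 2 := by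
      rw [map_add, map_mul]
      ring
    rw [h5, h3, h4]
    simp
  · have hΔ : ¬ IsUnit (legendreCurve A' B').Δ := by
      rw [hres, eΔ, not_not, EmbeddingLike.map_eq_zero_iff]
      rw [not_and_or, not_not, not_not] at hgood
      rcases hgood with h | h <;> simp [h]
    -- In both degenerate cases `c₄` reduces to `16 A²`, so the reduction is never additive.
    have hc : IsUnit (legendreCurve A' B').c₄ := by
      rw [hres, ec₄, EmbeddingLike.map_ne_zero_iff]
      refine mul_ne_zero h16 ?_
      rw [not_and_or, not_not, not_not] at hgood
      rcases hgood with h | h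
      · rw [h]
        simpa using hA0
      · rw [← h]
        ring_nf
        exact pow_ne_zero _ hA0
    have hloc := localPolynomial_of_isUnit_c₄ h2 (curve a γ) _ 1 (curve_eq_baseChange a γ v)
      hΔ0 hΔ hc
    -- Here `-c₄ c₆` reduces to `D (32 A²)²` with `D = A` if `B = 0` and `D = -A` if `A = B`. The
    -- Legendre sums see the same `D`.
    have key : ∃ D : v.residueField, D ≠ 0 ∧
        (IsSquare (residue _ (-((legendreCurve A' B').c₄ * (legendreCurve A' B').c₆))) ↔
          IsSquare D) ∧
        ∀ (k : Type) [Field k] [Algebra v.residueField k] [Finite k],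
        -(legendreSum (algebraMap v.residueField k A) (algebraMap v.residueField k B)) =
          quadraticChar v.residueField D ^ Module.finrank v.residueField k := by
      have h32 : ∀ D : v.residueField, IsSquare (v.residueFieldEquiv (D * (32 * A ^ 2) ^ 2)) ↔
          IsSquare D := by
        intro D
        have h0 : (32 * A ^ 2) ≠ 0 := by
          rw [show (32 : v.residueField) = 16 * 2 by norm_num]
          exact mul_ne_zero (mul_ne_zero h16 (Ring.two_ne_zero hk)) (pow_ne_zero _ hA0)
        constructor
        · intro h
          obtain ⟨s, hs⟩ := h.map v.residueFieldEquiv.symm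
          rw [RingEquiv.symm_apply_apply] at hs
          refine ⟨s / (32 * A ^ 2), ?_⟩
          rw [div_mul_div_comm, ← hs, ← sq, mul_div_cancel_right₀ _ (pow_ne_zero 2 h0)]
        · rintro ⟨s, rfl⟩
          exact IsSquare.map v.residueFieldEquiv ⟨s * (32 * A ^ 2), by ring⟩
      rw [map_neg, map_mul, ec₄, ec₆, ← map_mul, ← map_neg]
      rw [not_and_or, not_not, not_not] at hgood
      rcases hgood with h | h
      · refine ⟨A, hA0, ?_, fun k _ _ _ => ?_⟩
        · rw [← h32, h]
          ring_nf
        · rw [h, map_zero]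
          exact legendreSum_extension_zero_right hk A k
      · refine ⟨-A, neg_ne_zero.2 hA0, ?_, fun k _ _ _ => ?_⟩
        · rw [← h32, ← h]
          ring_nf
        · rw [← h]
          exact legendreSum_extension_self hk A k
    obtain ⟨D, hD0, hD, hsum⟩ := key
    -- The local polynomial has degree 1; the missing root is set to 0, whose positive powers
    -- contribute nothing.
    refine ⟨(quadraticChar v.residueField D : ℤ), 0, ?_, fun k _ _ _ => ?_⟩
    · rw [hloc]
      split_ifs with h
      · rw [(quadraticChar_one_iff_isSquare hD0).2 (hD.1 h)]
        simp
      · rw [quadraticChar_neg_one_iff_not_isSquare.2 fun h' => h (hD.2 h')]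
        simp
    · have := Module.finrank_pos (R := v.residueField) (M := k)
      rw [zero_pow this.ne', add_zero]
      exact_mod_cast hsum k

end LocalFactor

/-! ### Split multiplicative reduction at infinity -/

section Infinity

open Polynomial IsLocalRing

variable {F : Type*} [Field F]

theorem algebraMap_wpPoly (a : ℕ) : algebraMap F[X] (RatFunc F) (wpPoly F a) = wp F a := by
  simp [wpPoly, wp]

theorem valuation_infinity_C {c : F} (hc : c ≠ 0) :
    (Place.infinity : Place F).valuation (RatFunc.C c) = 1 := by
  classical
  exact RatFunc.inftyValuation.C F hc

theorem isUnit_two_localRing_infinity (hF : ringChar F ≠ 2) :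
    IsUnit (2 : (Place.infinity : Place F).localRing) := by
  rw [Place.isUnit_iff]
  rw [← valuation_infinity_C (Ring.two_ne_zero hF), map_ofNat]
  rfl

variable [Finite F]

theorem wp_ne_zero {a : ℕ} (ha : 1 ≤ a) : wp F a ≠ 0 := by
  rw [← algebraMap_wpPoly]
  exact RatFunc.algebraMap_ne_zero (wpPoly_ne_zero ha)

theorem one_lt_valuation_wp {a : ℕ} (ha : 1 ≤ a) :
    1 < (Place.infinity : Place F).valuation (wp F a) := by
  classical
  rw [← algebraMap_wpPoly]
  change 1 < RatFunc.inftyValuationDef F _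
  rw [RatFunc.inftyValuation.polynomial F (wpPoly_ne_zero ha), ← WithZero.exp_zero,
    WithZero.exp_lt_exp]
  exact_mod_cast natDegree_wpPoly_pos ha

theorem valuation_div_wp_sq_lt_one (hF : ringChar F ≠ 2) {γ : F} (hγ : γ ≠ 0) {a : ℕ}
    (ha : 1 ≤ a) :
    (Place.infinity : Place F).valuation (RatFunc.C (16 * γ) / wp F a ^ 2) < 1 := by
  rw [map_div₀, valuation_infinity_C (sixteen_mul_ne_zero hF hγ), map_pow, one_div]
  exact inv_lt_one_of_one_lt₀ (one_lt_pow₀ (one_lt_valuation_wp ha) two_ne_zero)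

/-- Scaling by `u = ℘_a` gives `y² = x (x + A) (x + 1)` with `A = 16 γ / ℘_a²` zero at infinity. Its
reduction has a node with `-c₄ c₆ = 32²`, a square. -/
theorem localPolynomial_infinity (hF : ringChar F ≠ 2) {γ : F} (hγ : γ ≠ 0) {a : ℕ} (ha : 1 ≤ a) :
    (curve a γ).localPolynomial (Place.infinity : Place F).localRing = 1 - X := by
  let R := (Place.infinity : Place F).localRing
  have hw := wp_ne_zero (F := F) ha
  have hA := valuation_div_wp_sq_lt_one hF hγ ha
  let A : R := ⟨RatFunc.C (16 * γ) / wp F a ^ 2, hA.le⟩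
  have hres : residue R A = 0 := by
    rw [residue_eq_zero_iff]
    exact (Valuation.mem_maximalIdeal_iff _ (Place.infinity : Place F).valuation).2 hA
  have h2 : IsUnit (2 : R) := isUnit_two_localRing_infinity hF
  let D : WeierstrassCurve.VariableChange (RatFunc F) := ⟨Units.mk0 (wp F a) hw, 0, 0, 0⟩
  have hD : D • curve a γ = (legendreCurve A 1).baseChange (RatFunc F) := by
    have e1 : algebraMap R (RatFunc F) A = RatFunc.C (16 * γ) / wp F a ^ 2 := rfl
    have e2 : RatFunc.C (16 * γ) = 16 * RatFunc.C γ := by rw [map_mul, map_ofNat]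
    rw [WeierstrassCurve.baseChange, legendreCurve_map, e1, map_one, e2,
      WeierstrassCurve.variableChange_def]
    ext <;> simp [curve, legendreCurve, D] <;> field_simp
  have hA0 : A ≠ 0 := by
    intro h
    have h1 : RatFunc.C (16 * γ) / wp F a ^ 2 = 0 := congr_arg Subtype.val h
    refine div_ne_zero ?_ (pow_ne_zero 2 hw) h1
    rw [Ne, map_eq_zero_iff _ RatFunc.C_injective]
    exact sixteen_mul_ne_zero hF hγ
  have h16 : IsUnit (16 : R) := by
    rw [show (16 : R) = 2 ^ 4 by norm_num]
    exact h2.pow 4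
  have hΔ : ¬ IsUnit (legendreCurve A (1 : R)).Δ := by
    rw [← residue_ne_zero_iff_isUnit, not_not, legendreCurve_Δ]
    simp [hres]
  have hΔ0 : (legendreCurve A (1 : R)).Δ ≠ 0 := by
    rw [legendreCurve_Δ]
    refine mul_ne_zero (mul_ne_zero (mul_ne_zero h16.ne_zero (pow_ne_zero _ hA0)) (by simp))
      (pow_ne_zero _ (sub_ne_zero.2 fun h => ?_))
    rw [h, map_one] at hres
    exact one_ne_zero hres
  have hc : IsUnit (legendreCurve A (1 : R)).c₄ := by
    rw [← residue_ne_zero_iff_isUnit, legendreCurve_c₄]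
    simpa [hres] using (h16.map (residue R)).ne_zero
  rw [localPolynomial_of_isUnit_c₄ h2 (curve a γ) _ D hD hΔ0 hΔ hc, if_pos]
  rw [legendreCurve_c₄, legendreCurve_c₆]
  refine ⟨32, ?_⟩
  simp only [map_neg, map_mul, map_add, map_sub, map_pow, hres, map_one, map_ofNat]
  ring

end Infinity

/-! ### Sums over the values of `x^(q^a) - x` -/

section ArtinSchreierSums

open Polynomial

variable {F k : Type*} [Field F] [Field k] [Algebra F k]

theorem placeOf_poly_eq_X_iff [Finite k] (c : k) : (placeOf F c).poly = X ↔ c = 0 := by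
  change minpoly F c = X ↔ _
  exact ⟨fun h => by simpa [h] using minpoly.aeval F c, fun h => by rw [h, minpoly.zero]⟩

variable [Finite F]

theorem pow_card_pow_eq_iff [Finite k] (c : k) (a : ℕ) :
    c ^ Nat.card F ^ a = c ↔ (placeOf F c).degree ∣ a := by
  change _ ↔ (placeOf F c).poly.natDegree ∣ a
  rw [(placeOf F c).irreducible.natDegree_dvd_iff_dvd_X_pow_card_pow_sub_X]
  change _ ↔ minpoly F c ∣ _
  rw [minpoly.dvd_iff]
  simp [sub_eq_zero]

theorem traceChar_pow_card_pow [Finite k] (ψ : AddChar F ℂ) (a : ℕ) (x : k) :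
    traceChar ψ k (x ^ Nat.card F ^ a) = traceChar ψ k x := by
  induction a with
  | zero => simp
  | succ a ih => rw [← ih, pow_succ, pow_mul, traceChar_apply, trace_pow_card, traceChar_apply]

theorem sub_pow_card_pow (x y : k) (a : ℕ) :
    (x - y) ^ Nat.card F ^ a = x ^ Nat.card F ^ a - y ^ Nat.card F ^ a := by
  let := Fintype.ofFinite F
  obtain ⟨n, hp, hn⟩ := FiniteField.card F (ringChar F)
  have : Fact (ringChar F).Prime := ⟨hp⟩
  have : CharP k (ringChar F) := charP_of_injective_algebraMap (algebraMap F k).injective _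
  rw [Nat.card_eq_fintype_card, hn, ← pow_mul]
  exact sub_pow_char_pow x y _

theorem pow_card_pow_bijective [Finite k] (a : ℕ) :
    Function.Bijective fun x : k => x ^ Nat.card F ^ a := by
  rw [← Finite.injective_iff_bijective]
  intro x y hxy
  have h := sub_pow_card_pow (F := F) x y a
  rw [show x ^ Nat.card F ^ a = y ^ Nat.card F ^ a from hxy, sub_self] at h
  exact sub_eq_zero.1 (eq_zero_of_pow_eq_zero h)

/-- The sum of a function over the values of `x ^ (q ^ a) - x`, in terms of its Fourier
transform. -/
theorem sum_comp_pow_sub [Fintype k] [DecidableEq k] {ψ : AddChar F ℂ} (hψ : ψ ≠ 1) (a : ℕ)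
    (f : k → ℂ) :
    ∑ x : k, f (x ^ Nat.card F ^ a - x) =
      ∑ c : k with c ^ Nat.card F ^ a = c, ∑ w : k, f w * traceChar ψ k (c * w) := by
  set Ψ := traceChar ψ k with hΨ
  have hprim : Ψ.IsPrimitive := AddChar.IsPrimitive.of_ne_one (traceChar_ne_one hψ k)
  have hQ : (Fintype.card k : ℂ) ≠ 0 := by exact_mod_cast Fintype.card_ne_zero
  refine mul_left_cancel₀ hQ ?_
  -- Fourier inversion on `k`.
  have h1 : ∀ x : k, (Fintype.card k : ℂ) * f (x ^ Nat.card F ^ a - x) =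
      ∑ b : k, ∑ w : k, f w * Ψ (b * (w - (x ^ Nat.card F ^ a - x))) := by
    intro x
    rw [Finset.sum_comm]
    simp only [← Finset.mul_sum]
    simp only [AddChar.sum_mulShift _ hprim, sub_eq_zero]
    simp [mul_comm]
  -- The trace is invariant under the `q^a`-power map, which therefore moves from `x` to the dual
  -- variable. For this the latter is written as `c^(q^a)`, every element being of that form.
  have h2 : ∀ c x : k, Ψ (-(c ^ Nat.card F ^ a * (x ^ Nat.card F ^ a - x))) =
      Ψ (x * (c ^ Nat.card F ^ a - c)) := by
    intro c x
    rw [show -(c ^ Nat.card F ^ a * (x ^ Nat.card F ^ a - x)) =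
      x * c ^ Nat.card F ^ a - (c * x) ^ Nat.card F ^ a by rw [mul_pow]; ring,
      sub_eq_add_neg, AddChar.map_add_eq_mul, AddChar.map_neg_eq_inv, hΨ, traceChar_pow_card_pow,
      ← AddChar.map_neg_eq_inv, ← AddChar.map_add_eq_mul]
    congr 1
    ring
  rw [Finset.mul_sum, Finset.sum_congr rfl fun x _ => h1 x, Finset.sum_comm,
    ← (Equiv.ofBijective _ (pow_card_pow_bijective (F := F) (k := k) a)).sum_comp,
    Finset.sum_filter, Finset.mul_sum]
  refine Finset.sum_congr rfl fun c _ => ?_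
  simp only [Equiv.ofBijective_apply]
  rw [Finset.sum_comm]
  have h3 : ∀ w : k, ∑ x : k,
      f w * Ψ (c ^ Nat.card F ^ a * (w - (x ^ Nat.card F ^ a - x))) =
      f w * Ψ (c ^ Nat.card F ^ a * w) *
        if c ^ Nat.card F ^ a = c then (Fintype.card k : ℂ) else 0 := by
    intro w
    have h4 := AddChar.sum_mulShift (c ^ Nat.card F ^ a - c) hprim
    simp only [sub_eq_zero] at h4
    push_cast at h4
    rw [← h4, Finset.mul_sum]
    refine Finset.sum_congr rfl fun x _ => ?_
    rw [← h2, mul_assoc, ← AddChar.map_add_eq_mul]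
    congr 2
    ring
  rw [Finset.sum_congr rfl fun w _ => h3 w, ← Finset.sum_mul]
  split_ifs with h
  · rw [h, mul_comm]
  · rw [mul_zero, mul_zero]

/-- The sum of the traces of Frobenius of the fibres over the points of an extension of the
constant field. -/
theorem sum_legendreSum_pow_sub [Fintype k] [DecidableEq k] (hF : ringChar F ≠ 2) {ψ : AddChar F ℂ}
    (hψ : ψ ≠ 1) {γ : F} (hγ : γ ≠ 0) (a : ℕ) :
    ∑ x : k, (legendreSum (16 * algebraMap F k γ) ((x ^ Nat.card F ^ a - x) ^ 2) : ℂ) =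
      1 + ∑ c : k, if c ^ Nat.card F ^ a = c ∧ c ≠ 0 then
        kloostermanSum (traceChar ψ k) (algebraMap F k γ * c ^ 2) ^ 2 - Nat.card k else 0 := by
  have hk : ringChar k ≠ 2 := by rwa [← Algebra.ringChar_eq F k]
  have hγ' : algebraMap F k γ ≠ 0 := (_root_.map_ne_zero _).2 hγ
  rw [sum_comp_pow_sub hψ a (fun w : k => (legendreSum (16 * algebraMap F k γ) (w ^ 2) : ℂ)),
    ← Finset.add_sum_erase _ _ (a := (0 : k))
      (by simp [(Nat.card_pos (α := F)).ne'])]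
  congr 1
  · simp only [zero_mul, AddChar.map_zero_eq_one, mul_one]
    rw [← Int.cast_sum, sum_legendreSum hk (sixteen_mul_ne_zero hk hγ'), Int.cast_one]
  · rw [← Finset.sum_filter]
    refine Finset.sum_congr ?_ fun c hc => ?_
    · ext c
      simp [and_comm]
    · exact sum_legendreSum_mul_addChar_mul hk (traceChar_ne_one hψ k) hγ'
        (Finset.mem_filter.1 hc).2.2

end ArtinSchreierSums

/-! ### The identity between power sums over places -/

section PlaceSums

open Polynomial

theorem traceChar_traceChar {F : Type*} [Field F] (ψ : AddChar F ℂ) (E k : Type*) [Field E] [Field k] [Algebra F E]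
    [Algebra F k] [Algebra E k] [IsScalarTower F E k] [Finite k] :
    traceChar (traceChar ψ E) k = traceChar ψ k := by
  have : Finite E := Finite.of_injective _ (algebraMap E k).injective
  ext x
  rw [traceChar_apply, traceChar_apply, traceChar_apply, Algebra.trace_trace]

variable {F : Type*} [Field F] [Finite F]

/-- The residue field of the place below `x` embeds in the field containing `x`, with the class of
`t` mapping to `x`. -/
theorem exists_algebra_residueField {k : Type*} [Field k] [Algebra F k] [Finite k] (x : k) :
    ∃ (_ : Algebra (placeOf F x).residueField k) (_ : IsScalarTower F (placeOf F x).residueField k),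
      algebraMap (placeOf F x).residueField k (AdjoinRoot.root _) = x ∧
      Module.finrank (placeOf F x).residueField k =
        Module.finrank F k / (placeOf F x).degree := by
  let f := (algHomEquivPlaceOf (placeOf F x)).symm ⟨x, rfl⟩
  let : Algebra (placeOf F x).residueField k := f.toRingHom.toAlgebra
  have ht : IsScalarTower F (placeOf F x).residueField k :=
    IsScalarTower.of_algebraMap_eq fun y => (f.commutes y).symm
  refine ⟨inferInstance, ht, AdjoinRoot.liftAlgHom_root _ _ _ _, ?_⟩
  rw [← Module.finrank_mul_finrank F (placeOf F x).residueField k, finrank_residueField,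
    Nat.mul_div_cancel_left _ (placeOf F x).degree_pos]

open Classical in
/-- The vanishing of the power sums of the reciprocal zeros and poles attached to the places. -/
theorem sum_places_eq (hF : ringChar F ≠ 2) {ψ : AddChar F ℂ} (hψ : ψ ≠ 1) {γ : F} (hγ : γ ≠ 0)
    (a : ℕ) {l l' : FinitePlace F → ℂ}
    (hl : ∀ v : FinitePlace F, ∀ (k : Type) [Field k] [Algebra v.residueField k] [Finite k],
        -(legendreSum (algebraMap v.residueField k (algebraMap F _ (16 * γ)))
          (algebraMap v.residueField k (v.wpAt a ^ 2)) : ℂ) =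
          l v ^ Module.finrank v.residueField k + l' v ^ Module.finrank v.residueField k)
    {ω ω' : FinitePlace F → ℂ}
    (hω : ∀ v : FinitePlace F, v.poly ≠ X →
      ω v + ω' v = kl ψ γ v ∧ ω v * ω' v = (Nat.card F : ℂ) ^ v.degree)
    {n N : ℕ} (hn : 0 < n) (hN : n ≤ N) :
    ∑ v ∈ placesUpTo F N with v.degree ∣ n, v.degree •
      (l v ^ (n / v.degree) + l' v ^ (n / v.degree) +
        if v.degree ∣ a ∧ v.poly ≠ X then
          ((Nat.card F : ℂ) ^ v.degree) ^ (n / v.degree) + (ω v ^ 2) ^ (n / v.degree) +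
            (ω' v ^ 2) ^ (n / v.degree) else 0) = -1 := by
  classical
  obtain ⟨k, _, _, _, rfl⟩ := exists_extension F hn
  let := Fintype.ofFinite k
  rw [← sum_placeOf (k := k) _ hN, Finset.sum_add_distrib]
  have h1 : ∀ x : k, l (placeOf F x) ^ (Module.finrank F k / (placeOf F x).degree) +
      l' (placeOf F x) ^ (Module.finrank F k / (placeOf F x).degree) =
      -(legendreSum (16 * algebraMap F k γ) ((x ^ Nat.card F ^ a - x) ^ 2) : ℂ) := by
    intro x
    obtain ⟨_, _, hx, hd⟩ := exists_algebra_residueField (F := F) x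
    rw [← hd, ← hl (placeOf F x) k, ← IsScalarTower.algebraMap_apply, map_mul, map_ofNat, map_pow,
      FinitePlace.wpAt, map_sub, map_pow, hx]
  have h2 : ∀ c : k, (if (placeOf F c).degree ∣ a ∧ (placeOf F c).poly ≠ X then
      ((Nat.card F : ℂ) ^ (placeOf F c).degree) ^ (Module.finrank F k / (placeOf F c).degree) +
        (ω (placeOf F c) ^ 2) ^ (Module.finrank F k / (placeOf F c).degree) +
        (ω' (placeOf F c) ^ 2) ^ (Module.finrank F k / (placeOf F c).degree) else 0) =
      if c ^ Nat.card F ^ a = c ∧ c ≠ 0 then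
        kloostermanSum (traceChar ψ k) (algebraMap F k γ * c ^ 2) ^ 2 - Nat.card k else 0 := by
    intro c
    simp only [← pow_card_pow_eq_iff, Ne, placeOf_poly_eq_X_iff]
    split_ifs with hc
    · have hv : (placeOf F c).poly ≠ X := (placeOf_poly_eq_X_iff c).not.2 hc.2
      obtain ⟨_, _, hx, hd⟩ := exists_algebra_residueField (F := F) c
      obtain ⟨h3, h4⟩ := hω _ hv
      have hQ : (Nat.card k : ℂ) = ((Nat.card F : ℂ) ^ (placeOf F c).degree) ^
          (Module.finrank F k / (placeOf F c).degree) := by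
        rw [← pow_mul, Nat.mul_div_cancel' (degree_placeOf_dvd c),
          Module.natCard_eq_pow_finrank (K := F) (V := k), Nat.cast_pow]
      have h5 := kloostermanSum_extension (liftChar_ne_one hψ (placeOf F c))
        (kl_parameter_ne_zero hγ hv) h3
        (by rw [h4, FinitePlace.natCard_residueField, Nat.cast_pow]) k
      rw [map_mul, map_pow, hx, ← IsScalarTower.algebraMap_apply, hd] at h5
      change kloostermanSum (traceChar (traceChar ψ (placeOf F c).residueField) k) _ = _ at h5
      rw [traceChar_traceChar] at h5
      -- In the square of `ω^m + ω'^m` the cross term is `2 (ω ω')^m = 2 #k`, so subtracting `#k`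
      -- leaves the three power sums of the factor at the place.
      rw [h5, hQ, ← h4, mul_pow]
      ring
    · rfl
  rw [Finset.sum_congr rfl fun x _ => h1 x, Finset.sum_congr rfl fun x _ => h2 x,
    Finset.sum_neg_distrib, sum_legendreSum_pow_sub hF hψ hγ]
  ring

end PlaceSums

/-! ### Power sums and logarithmic derivatives of power series -/

section LogDerivative

open PowerSeries

/-- The power sums `∑ d λ ^ (n / d) T ^ n` attached to the polynomial `1 - λ T ^ d`. -/
def logSeries (d : ℕ) (l : ℂ) : PowerSeries ℂ :=
  .mk fun n => if 0 < n ∧ d ∣ n then d * l ^ (n / d) else 0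

/-- The power series `f` has the power sums `s`. -/
def HasPowerSums (f s : PowerSeries ℂ) : Prop :=
  constantCoeff f = 1 ∧ X * derivative ℂ f = -(f * s)

theorem hasPowerSums_one : HasPowerSums 1 0 := by
  simp [HasPowerSums]

theorem HasPowerSums.mul {f g s t : PowerSeries ℂ} (hf : HasPowerSums f s)
    (hg : HasPowerSums g t) : HasPowerSums (f * g) (s + t) := by
  refine ⟨by rw [map_mul, hf.1, hg.1, one_mul], ?_⟩
  rw [Derivation.leibniz, smul_eq_mul, smul_eq_mul]
  linear_combination f * hg.2 + g * hf.2

theorem HasPowerSums.prod {ι : Type*} (I : Finset ι) {f s : ι → PowerSeries ℂ}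
    (h : ∀ i ∈ I, HasPowerSums (f i) (s i)) :
    HasPowerSums (∏ i ∈ I, f i) (∑ i ∈ I, s i) := by
  classical
  induction I using Finset.induction_on with
  | empty => simpa using hasPowerSums_one
  | insert i I hi ih =>
    rw [Finset.prod_insert hi, Finset.sum_insert hi]
    exact (h i (Finset.mem_insert_self _ _)).mul
      (ih fun j hj => h j (Finset.mem_insert_of_mem hj))

theorem hasPowerSums_one_sub {d : ℕ} (hd : 0 < d) (l : ℂ) :
    HasPowerSums (1 - C l * X ^ d) (logSeries d l) := by
  refine ⟨by simp [hd.ne'], ?_⟩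
  ext n
  have e : -((1 - C l * X ^ d) * logSeries d l) = C l * (X ^ d * logSeries d l) - logSeries d l := by
    ring
  have h1 : coeff n (X * derivative ℂ (1 - C l * X ^ d)) = if n = d then -(d * l : ℂ) else 0 := by
    cases n with
    | zero => simp [hd.ne]
    | succ n =>
      rw [coeff_succ_X_mul, coeff_derivative, map_sub, coeff_one, if_neg n.succ_ne_zero,
        coeff_C_mul, coeff_X_pow]
      split_ifs with h
      · rw [← h]
        push_cast
        ring
      · simp
  rw [h1, e, map_sub, coeff_C_mul, coeff_X_pow_mul', logSeries, coeff_mk, coeff_mk]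
  rcases lt_trichotomy n d with h | h | h
  · rw [if_neg h.ne, if_neg h.not_ge, if_neg fun h' => h.not_ge (Nat.le_of_dvd h'.1 h'.2)]
    simp
  · subst h
    simp [hd, Nat.div_self hd]
  · rw [if_neg h.ne', if_pos h.le]
    have h2 : d ∣ n - d ↔ d ∣ n :=
      ⟨fun h' => by simpa [Nat.sub_add_cancel h.le] using h'.add (dvd_refl d),
        fun h' => Nat.dvd_sub h' dvd_rfl⟩
    by_cases hdn : d ∣ n
    · rw [if_pos ⟨by omega, h2.2 hdn⟩, if_pos ⟨by omega, hdn⟩]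
      obtain ⟨m, rfl⟩ := hdn
      have hm : 1 ≤ m := by
        by_contra hm
        simp [show m = 0 by omega] at h
      obtain ⟨m, rfl⟩ := Nat.exists_eq_add_of_le' hm
      rw [show d * (m + 1) - d = d * m by rw [mul_add, mul_one, Nat.add_sub_cancel],
        Nat.mul_div_cancel_left _ hd, Nat.mul_div_cancel_left _ hd]
      ring
    · rw [if_neg fun h' => hdn (h2.1 h'.2), if_neg fun h' => hdn h'.2]
      simp

/-- A power series whose first `N` power sums vanish is `1` modulo `T ^ (N + 1)`. -/
theorem HasPowerSums.dvd_sub_one {f s : PowerSeries ℂ} (h : HasPowerSums f s) {N : ℕ}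
    (hs : ∀ n ≤ N, coeff n s = 0) : X ^ (N + 1) ∣ f - 1 := by
  rw [X_pow_dvd_iff]
  intro n hn
  cases n with
  | zero => simp [h.1]
  | succ n =>
    have h1 := congr_arg (coeff (n + 1)) h.2
    rw [coeff_succ_X_mul, coeff_derivative, map_neg, coeff_mul, Finset.sum_eq_zero, neg_zero,
      mul_eq_zero] at h1
    · rw [map_sub, coeff_one, if_neg n.succ_ne_zero, sub_zero]
      exact h1.resolve_right (by exact_mod_cast n.succ_ne_zero)
    · intro x hx
      rw [hs, mul_zero]
      have := Finset.HasAntidiagonal.mem_antidiagonal.1 hx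
      omega

end LogDerivative

/-! ### Infinite products of power series -/

section InfiniteProduct

open PowerSeries Filter

variable {R : Type*} [CommRing R] {ι : Type*}

theorem coeff_eq_of_dvd_sub {f g : PowerSeries R} {n : ℕ} (h : X ^ (n + 1) ∣ f - g) {m : ℕ}
    (hm : m ≤ n) : coeff m f = coeff m g := by
  have := X_pow_dvd_iff.1 h m (by omega)
  rwa [map_sub, sub_eq_zero] at this

/-- In the quotient by `X^n` the factors outside `S` are equal to 1. -/
theorem dvd_prod_sub_prod {f : ι → PowerSeries R} {S T : Finset ι} (hST : S ⊆ T) {n : ℕ}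
    (h : ∀ i ∉ S, X ^ n ∣ f i - 1) : X ^ n ∣ ∏ i ∈ T, f i - ∏ i ∈ S, f i := by
  let φ := Ideal.Quotient.mk (Ideal.span {(X : PowerSeries R) ^ n})
  have hφ : ∀ x, φ x = 0 ↔ X ^ n ∣ x := fun x =>
    Ideal.Quotient.eq_zero_iff_mem.trans Ideal.mem_span_singleton
  rw [← hφ, map_sub, sub_eq_zero, map_prod, map_prod]
  symm
  refine Finset.prod_subset hST fun i _ hi => ?_
  have h1 := (hφ _).2 (h i hi)
  rwa [map_sub, map_one, sub_eq_zero] at h1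

/-- An infinite product of power series, almost all factors of which are `1` modulo any given power
of `T`, converges coefficientwise. -/
theorem hasProd_of_dvd_sub_one [TopologicalSpace R] {f : ι → PowerSeries R} (S : ℕ → Finset ι)
    (h : ∀ n, ∀ i ∉ S n, X ^ (n + 1) ∣ f i - 1) :
    HasProd f (.mk fun n => coeff n (∏ i ∈ S n, f i)) := by
  rw [HasProd, WithPiTopology.tendsto_iff_coeff_tendsto]
  intro n
  refine tendsto_const_nhds.congr' ?_
  filter_upwards [Filter.eventually_ge_atTop (S n)] with T hT
  rw [coeff_mk]
  exact (coeff_eq_of_dvd_sub (dvd_prod_sub_prod hT (h n)) le_rfl).symm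

end InfiniteProduct

/-! ### Convergence and truncation of the Euler product -/

section Euler

open PowerSeries

variable {F : Type*} [Field F]

theorem dvd_sub_one_of_mul_eq_one {R : Type*} [CommRing R] {f g p : R} (hfg : f * g = 1)
    (h : p ∣ f - 1) : p ∣ g - 1 := by
  refine (dvd_neg.2 (h.mul_right g)).trans (dvd_of_eq ?_)
  linear_combination -hfg

theorem localFactor_mul_eulerFactor (W : WeierstrassCurve (RatFunc F)) (v : Place F)
    (hd : 0 < v.degree) (h : (W.localPolynomial v.localRing).coeff 0 = 1) :
    (Polynomial.expand ℤ v.degree (W.localPolynomial v.localRing) : PowerSeries ℤ) *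
      eulerFactor W v = 1 := by
  refine mul_invOfUnit _ _ ?_
  rw [← coeff_zero_eq_constantCoeff_apply, Polynomial.coeff_coe, Polynomial.coeff_expand hd]
  simpa using h

theorem X_pow_dvd_expand_sub_one {d : ℕ} (hd : 0 < d) {p : Polynomial ℤ} (hp : p.coeff 0 = 1) :
    (X : PowerSeries ℤ) ^ d ∣ (Polynomial.expand ℤ d p : PowerSeries ℤ) - 1 := by
  rw [X_pow_dvd_iff]
  intro m hm
  rw [map_sub, Polynomial.coeff_coe, Polynomial.coeff_expand hd, coeff_one]
  rcases Nat.eq_zero_or_pos m with rfl | hm0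
  · simp [hp]
  · rw [if_neg fun h => hm.not_ge (Nat.le_of_dvd hm0 h), if_neg hm0.ne', sub_zero]

theorem X_pow_dvd_eulerFactor_sub_one (W : WeierstrassCurve (RatFunc F)) (v : Place F)
    (hd : 0 < v.degree) (h : (W.localPolynomial v.localRing).coeff 0 = 1) :
    X ^ v.degree ∣ eulerFactor W v - 1 :=
  dvd_sub_one_of_mul_eq_one (localFactor_mul_eulerFactor W v hd h) (X_pow_dvd_expand_sub_one hd h)

theorem Place.degree_pos (v : Place F) : 0 < v.degree := by
  cases v with
  | finite v => exact v.degree_pos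
  | infinity => exact one_pos

variable [Finite F]

variable (F) in
/-- The place `∞` and the finite places of degree at most `n`. -/
def allPlacesUpTo (n : ℕ) : Finset (Place F) :=
  Finset.cons .infinity ((placesUpTo F n).map ⟨.finite, fun _ _ h => Place.finite.inj h⟩)
    (by simp)

theorem finite_mem_allPlacesUpTo {n : ℕ} {v : FinitePlace F} :
    Place.finite v ∈ allPlacesUpTo F n ↔ v.degree ≤ n := by
  simp only [allPlacesUpTo, Finset.mem_cons, reduceCtorEq, Finset.mem_map, mem_placesUpTo, false_or]
  refine ⟨?_, fun h => ⟨v, h, rfl⟩⟩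
  rintro ⟨w, hw, h⟩
  obtain rfl : w = v := Place.finite.inj h
  exact hw

theorem infinity_mem_allPlacesUpTo (n : ℕ) : Place.infinity ∈ allPlacesUpTo F n :=
  Finset.mem_cons_self _ _

theorem lt_degree_of_notMem_allPlacesUpTo {n : ℕ} {v : Place F} (hv : v ∉ allPlacesUpTo F n) :
    n < v.degree := by
  cases v with
  | finite v =>
    by_contra! h
    exact hv (finite_mem_allPlacesUpTo.2 h)
  | infinity => exact absurd (infinity_mem_allPlacesUpTo n) hv

theorem allPlacesUpTo_mono {m n : ℕ} (h : m ≤ n) : allPlacesUpTo F m ⊆ allPlacesUpTo F n := by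
  intro v hv
  by_contra h'
  cases v with
  | finite v =>
    exact h' (finite_mem_allPlacesUpTo.2 ((finite_mem_allPlacesUpTo.1 hv).trans h))
  | infinity => exact h' (infinity_mem_allPlacesUpTo n)

theorem prod_allPlacesUpTo {M : Type*} [CommMonoid M] (f : Place F → M) (n : ℕ) :
    ∏ v ∈ allPlacesUpTo F n, f v = f .infinity * ∏ v ∈ placesUpTo F n, f (.finite v) := by
  rw [allPlacesUpTo, Finset.prod_cons, Finset.prod_map]
  rfl

theorem hasProd_eulerFactor (W : WeierstrassCurve (RatFunc F))
    (h : ∀ v : Place F, (W.localPolynomial v.localRing).coeff 0 = 1) :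
    HasProd (eulerFactor W) (.mk fun n => coeff n (∏ v ∈ allPlacesUpTo F n, eulerFactor W v)) :=
  hasProd_of_dvd_sub_one _ fun _ v hv =>
    (pow_dvd_pow _ (lt_degree_of_notMem_allPlacesUpTo hv)).trans
      (X_pow_dvd_eulerFactor_sub_one W v v.degree_pos (h v))

theorem coeff_LFunction (W : WeierstrassCurve (RatFunc F))
    (h : ∀ v : Place F, (W.localPolynomial v.localRing).coeff 0 = 1) {n N : ℕ} (hN : n ≤ N) :
    coeff n (LFunction W) = coeff n (∏ v ∈ allPlacesUpTo F N, eulerFactor W v) := by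
  rw [LFunction, (hasProd_eulerFactor W h).tprod_eq, coeff_mk]
  refine (coeff_eq_of_dvd_sub (dvd_prod_sub_prod (allPlacesUpTo_mono hN) fun v hv => ?_)
    le_rfl).symm
  exact (pow_dvd_pow _ (lt_degree_of_notMem_allPlacesUpTo hv)).trans
    (X_pow_dvd_eulerFactor_sub_one W v v.degree_pos (h v))

end Euler

/-! ### The formula for the `L`-function -/

section Final

open PowerSeries

variable {F : Type*} [Field F]

theorem coe_map_expand {p : Polynomial ℤ} {d : ℕ} {l l' : ℂ}
    (h : p.map (Int.castRingHom ℂ) = (1 - Polynomial.C l * Polynomial.X) *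
      (1 - Polynomial.C l' * Polynomial.X)) :
    PowerSeries.map (Int.castRingHom ℂ) (Polynomial.expand ℤ d p : PowerSeries ℤ) =
      (1 - C l * X ^ d) * (1 - C l' * X ^ d) := by
  rw [← Polynomial.polynomial_map_coe, Polynomial.map_expand, h]
  simp [Polynomial.coe_mul, Polynomial.coe_sub]

open Classical in
/-- The factor at a place of the polynomial to which the `L`-function is equal. -/
def kloostermanFactor (a : ℕ) (ω ω' : FinitePlace F → ℂ) (v : FinitePlace F) : PowerSeries ℂ :=
  if v.degree ∣ a ∧ v.poly ≠ Polynomial.X then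
    (1 - C ((Nat.card F : ℂ) ^ v.degree) * X ^ v.degree) * (1 - C (ω v ^ 2) * X ^ v.degree) *
      (1 - C (ω' v ^ 2) * X ^ v.degree)
  else 1

open Classical in
/-- The power sums of `kloostermanFactor`. -/
def kloostermanLogSeries (a : ℕ) (ω ω' : FinitePlace F → ℂ) (v : FinitePlace F) : PowerSeries ℂ :=
  if v.degree ∣ a ∧ v.poly ≠ Polynomial.X then
    logSeries v.degree ((Nat.card F : ℂ) ^ v.degree) + logSeries v.degree (ω v ^ 2) +
      logSeries v.degree (ω' v ^ 2)
  else 0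

theorem hasPowerSums_kloostermanFactor (a : ℕ) (ω ω' : FinitePlace F → ℂ) (v : FinitePlace F) :
    HasPowerSums (kloostermanFactor a ω ω' v) (kloostermanLogSeries a ω ω' v) := by
  rw [kloostermanFactor, kloostermanLogSeries]
  split_ifs
  · exact ((hasPowerSums_one_sub v.degree_pos _).mul (hasPowerSums_one_sub v.degree_pos _)).mul
      (hasPowerSums_one_sub v.degree_pos _)
  · exact hasPowerSums_one

open Classical in
theorem coeff_kloostermanLogSeries (a : ℕ) (ω ω' : FinitePlace F → ℂ) (v : FinitePlace F) (n : ℕ) :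
    coeff n (kloostermanLogSeries a ω ω' v) = if 0 < n ∧ v.degree ∣ n then
      v.degree * (if v.degree ∣ a ∧ v.poly ≠ Polynomial.X then
          ((Nat.card F : ℂ) ^ v.degree) ^ (n / v.degree) + (ω v ^ 2) ^ (n / v.degree) +
            (ω' v ^ 2) ^ (n / v.degree) else 0) else 0 := by
  rw [kloostermanLogSeries]
  by_cases h1 : v.degree ∣ a ∧ v.poly ≠ Polynomial.X
  · rw [if_pos h1, if_pos h1, map_add, map_add, logSeries, logSeries, logSeries, coeff_mk, coeff_mk,
      coeff_mk]
    split_ifs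
    · ring
    · ring
  · rw [if_neg h1, if_neg h1]
    simp

variable [Finite F]

theorem coeff_zero_localPolynomial (hF : ringChar F ≠ 2) {γ : F} (hγ : γ ≠ 0) {a : ℕ} (ha : 1 ≤ a)
    (v : Place F) : ((curve a γ).localPolynomial v.localRing).coeff 0 = 1 := by
  cases v with
  | finite v =>
    obtain ⟨l, l', h, -⟩ := exists_localPolynomial_roots hF hγ ha v
    have h1 := congr_arg (Polynomial.coeff · 0) h
    simpa using h1
  | infinity =>
    rw [localPolynomial_infinity hF hγ ha]
    simp

theorem prod_kloostermanFactor {a : ℕ} (ha : 1 ≤ a) (ω ω' : FinitePlace F → ℂ) {N : ℕ}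
    (hN : a ≤ N) :
    ∏ v ∈ placesUpTo F N, kloostermanFactor a ω ω' v =
      ((∏ v ∈ (placesDividing_finite F ha).toFinset,
          ((1 - Polynomial.C ((Nat.card F : ℂ) ^ v.degree) * Polynomial.X ^ v.degree) *
            (1 - Polynomial.C (ω v ^ 2) * Polynomial.X ^ v.degree) *
            (1 - Polynomial.C (ω' v ^ 2) * Polynomial.X ^ v.degree)) : Polynomial ℂ) :
          PowerSeries ℂ) := by
  classical
  rw [← Polynomial.coeToPowerSeries.ringHom_apply, map_prod]
  symm
  refine Finset.prod_subset_one_on_sdiff ?_ ?_ ?_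
  · intro v hv
    have hv : v ∈ placesDividing F a := by simpa using hv
    exact mem_placesUpTo.2 ((Nat.le_of_dvd ha hv.2).trans hN)
  · intro v hv
    rw [Finset.mem_sdiff, Set.Finite.mem_toFinset] at hv
    exact if_neg fun h => hv.2 ⟨h.2, h.1⟩
  · intro v hv
    have hv : v ∈ placesDividing F a := by simpa using hv
    rw [kloostermanFactor, if_pos ⟨hv.2, hv.1⟩]
    simp only [Polynomial.coeToPowerSeries.ringHom_apply, Polynomial.coe_mul, Polynomial.coe_sub,
      Polynomial.coe_one, Polynomial.coe_C, Polynomial.coe_pow, Polynomial.coe_X]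

/-- The truncated product of local factors is inverse to the truncated Euler product `E`, and also
to `M` modulo `T^(N+1)`, since by `sum_places_eq` the power sums up to `N` cancel. Hence `E` and `M`
agree in degrees up to `N`. -/
theorem map_LFunction_eq (hF : ringChar F ≠ 2) {ψ : AddChar F ℂ} (hψ : ψ ≠ 1) {γ : F}
    (hγ : γ ≠ 0) {a : ℕ} (ha : 1 ≤ a) {ω ω' : FinitePlace F → ℂ}
    (hω : ∀ v : FinitePlace F, v.poly ≠ Polynomial.X →
      ω v + ω' v = kl ψ γ v ∧ ω v * ω' v = (Nat.card F : ℂ) ^ v.degree) :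
    (LFunction (curve a γ)).map (Int.castRingHom ℂ) =
      ((∏ v ∈ (placesDividing_finite F ha).toFinset,
          ((1 - Polynomial.C ((Nat.card F : ℂ) ^ v.degree) * Polynomial.X ^ v.degree) *
            (1 - Polynomial.C (ω v ^ 2) * Polynomial.X ^ v.degree) *
            (1 - Polynomial.C (ω' v ^ 2) * Polynomial.X ^ v.degree)) : Polynomial ℂ) :
          PowerSeries ℂ) := by
  classical
  choose l l' hloc hsum using exists_localPolynomial_roots hF hγ ha
  have h0 := coeff_zero_localPolynomial hF hγ ha
  ext n
  -- At least `n`, to capture the coefficient in question, and at least `a`, so that `M` is the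
  -- whole product on the right.
  set N := max n a
  rw [← prod_kloostermanFactor ha ω ω' (le_max_right n a), PowerSeries.coeff_map,
    coeff_LFunction _ h0 (le_max_left n a), ← PowerSeries.coeff_map]
  set E := PowerSeries.map (Int.castRingHom ℂ)
    (∏ v ∈ allPlacesUpTo F N, eulerFactor (curve a γ) v) with hE
  set M := ∏ v ∈ placesUpTo F N, kloostermanFactor a ω ω' v with hM
  let P : FinitePlace F → PowerSeries ℂ := fun v =>
    (1 - C (l v) * X ^ v.degree) * (1 - C (l' v) * X ^ v.degree)
  have hPE : (1 - C 1 * X ^ 1) * (∏ v ∈ placesUpTo F N, P v) * E = 1 := by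
    rw [hE, prod_allPlacesUpTo, map_mul, map_prod]
    have e1 : (1 - C (1 : ℂ) * X ^ 1) *
        PowerSeries.map (Int.castRingHom ℂ) (eulerFactor (curve a γ) .infinity) = 1 := by
      have h1 := congr_arg (PowerSeries.map (Int.castRingHom ℂ))
        (localFactor_mul_eulerFactor (curve a γ) .infinity one_pos (h0 _))
      rw [map_mul, map_one, localPolynomial_infinity hF hγ ha] at h1
      have h2 := coe_map_expand (p := 1 - Polynomial.X) (d := 1) (l := 1) (l' := 0) (by simp)
      rw [map_zero, zero_mul, sub_zero, mul_one] at h2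
      rwa [Place.degree, h2] at h1
    have e2 : (∏ v ∈ placesUpTo F N, P v) * ∏ v ∈ placesUpTo F N,
        PowerSeries.map (Int.castRingHom ℂ) (eulerFactor (curve a γ) (.finite v)) = 1 := by
      rw [← Finset.prod_mul_distrib]
      refine Finset.prod_eq_one fun v _ => ?_
      have h1 := congr_arg (PowerSeries.map (Int.castRingHom ℂ))
        (localFactor_mul_eulerFactor (curve a γ) (.finite v) v.degree_pos (h0 _))
      rwa [map_mul, map_one, coe_map_expand (hloc v)] at h1
    linear_combination (∏ v ∈ placesUpTo F N, P v) * (∏ v ∈ placesUpTo F N,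
        PowerSeries.map (Int.castRingHom ℂ) (eulerFactor (curve a γ) (.finite v))) * e1 + e2
  have hPM : HasPowerSums ((1 - C 1 * X ^ 1) * (∏ v ∈ placesUpTo F N, P v) * M)
      (logSeries 1 1 + ∑ v ∈ placesUpTo F N, (logSeries v.degree (l v) +
        logSeries v.degree (l' v)) + ∑ v ∈ placesUpTo F N, kloostermanLogSeries a ω ω' v) := by
    refine ((hasPowerSums_one_sub one_pos 1).mul (HasPowerSums.prod _ fun v _ => ?_)).mul
      (HasPowerSums.prod _ fun v _ => hasPowerSums_kloostermanFactor a ω ω' v)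
    exact (hasPowerSums_one_sub v.degree_pos _).mul (hasPowerSums_one_sub v.degree_pos _)
  have hdvd := hPM.dvd_sub_one (N := N) (fun m hm => by
    rcases Nat.eq_zero_or_pos m with rfl | hm0
    · simp only [map_add, map_sum, coeff_kloostermanLogSeries, logSeries, coeff_mk, lt_irrefl,
        false_and, if_false, Finset.sum_const_zero, add_zero]
    · have h1 := sum_places_eq hF hψ hγ a (fun v => hsum v) hω hm0 hm
      rw [Finset.sum_filter] at h1
      -- The contribution of `∞`, which cancels the -1 from the finite places.
      have h2 : coeff m (logSeries 1 1) = 1 := by simp [logSeries, hm0]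
      have h3 (v : FinitePlace F) : coeff m (logSeries v.degree (l v) + logSeries v.degree (l' v)) +
          coeff m (kloostermanLogSeries a ω ω' v) = if v.degree ∣ m then v.degree •
            (l v ^ (m / v.degree) + l' v ^ (m / v.degree) +
              if v.degree ∣ a ∧ v.poly ≠ Polynomial.X then
                ((Nat.card F : ℂ) ^ v.degree) ^ (m / v.degree) + (ω v ^ 2) ^ (m / v.degree) +
                  (ω' v ^ 2) ^ (m / v.degree) else 0) else 0 := by
        rw [map_add, coeff_kloostermanLogSeries, logSeries, logSeries, coeff_mk, coeff_mk]
        by_cases hd : v.degree ∣ m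
        · rw [if_pos ⟨hm0, hd⟩, if_pos ⟨hm0, hd⟩, if_pos ⟨hm0, hd⟩, if_pos hd, nsmul_eq_mul]
          ring
        · simp [hd]
      rw [map_add, map_add, map_sum, map_sum, add_assoc, ← Finset.sum_add_distrib, h2,
        Finset.sum_congr rfl fun v _ => h3 v, h1, add_neg_cancel])
  refine coeff_eq_of_dvd_sub (n := N) ?_ (le_max_left n a)
  refine (dvd_neg.2 (hdvd.mul_left E)).trans (dvd_of_eq ?_)
  linear_combination -M * hPE

/-- The formula for the `L`-function in terms of the angles of the Kloosterman sums. -/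
theorem map_LFunction_eq_angles (hF : ringChar F ≠ 2) {ψ : AddChar F ℂ} (hψ : ψ ≠ 1) {γ : F}
    (hγ : γ ≠ 0) {a : ℕ} (ha : 1 ≤ a) {θ : FinitePlace F → ℝ}
    (hθ : ∀ v : FinitePlace F, v.poly ≠ Polynomial.X → kl ψ γ v =
      ((2 * (Nat.card F : ℝ) ^ ((v.degree : ℝ) / 2) * Real.cos (θ v) : ℝ) : ℂ)) :
    (LFunction (curve a γ)).map (Int.castRingHom ℂ) =
      ((∏ v ∈ (placesDividing_finite F ha).toFinset,
          ((1 - (Polynomial.C (Nat.card F : ℂ) * Polynomial.X) ^ v.degree) *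
            (1 - Polynomial.C (Complex.exp (2 * Complex.I * (θ v : ℂ))) *
              (Polynomial.C (Nat.card F : ℂ) * Polynomial.X) ^ v.degree) *
            (1 - Polynomial.C (Complex.exp (-2 * Complex.I * (θ v : ℂ))) *
              (Polynomial.C (Nat.card F : ℂ) * Polynomial.X) ^ v.degree)) : Polynomial ℂ) :
          PowerSeries ℂ) := by
  obtain ⟨r, hr1, hr⟩ : ∃ r : FinitePlace F → ℂ,
      (∀ v, r v = ((Nat.card F : ℝ) ^ ((v.degree : ℝ) / 2) : ℝ)) ∧
        ∀ v, r v ^ 2 = (Nat.card F : ℂ) ^ v.degree := by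
    refine ⟨_, fun v => rfl, fun v => ?_⟩
    have h : ((Nat.card F : ℝ) ^ ((v.degree : ℝ) / 2)) ^ 2 = (Nat.card F : ℝ) ^ v.degree := by
      rw [← Real.rpow_natCast, ← Real.rpow_mul (Nat.cast_nonneg _), ← Real.rpow_natCast]
      congr 1
      push_cast
      ring
    rw [← Complex.ofReal_pow, h, Complex.ofReal_pow, Complex.ofReal_natCast]
  have hexp (v : FinitePlace F) :
      Complex.exp (θ v * Complex.I) * Complex.exp (-θ v * Complex.I) = 1 := by
    rw [← Complex.exp_add, neg_mul, add_neg_cancel, Complex.exp_zero]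
  -- The pair attached to `v` is `q^(d/2) e^(±iθ)`: its sum is the Kloosterman sum by the choice of
  -- `θ`, and its product is `q^d`.
  rw [map_LFunction_eq hF hψ hγ ha (ω := fun v => r v * Complex.exp (θ v * Complex.I))
    (ω' := fun v => r v * Complex.exp (-θ v * Complex.I))]
  · refine congr_arg _ (Finset.prod_congr rfl fun v _ => ?_)
    have h1 : Complex.exp (θ v * Complex.I) ^ 2 = Complex.exp (2 * Complex.I * θ v) := by
      rw [← Complex.exp_nat_mul]
      congr 1
      push_cast
      ring
    have h2 : Complex.exp (-θ v * Complex.I) ^ 2 = Complex.exp (-2 * Complex.I * θ v) := by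
      rw [← Complex.exp_nat_mul]
      congr 1
      push_cast
      ring
    rw [mul_pow, mul_pow, hr, h1, h2, mul_pow, Polynomial.C_mul, Polynomial.C_mul, Polynomial.C_pow]
    simp only [mul_assoc, mul_left_comm]
  · intro v hv
    refine ⟨?_, ?_⟩
    · rw [hθ v hv, ← mul_add, ← Complex.two_cos, Complex.ofReal_mul, Complex.ofReal_mul,
        Complex.ofReal_cos, Complex.ofReal_ofNat, ← hr1]
      ring
    · linear_combination r v ^ 2 * hexp v + hr v

end Final

end

end ArtinSchreierL

theorem mainTheorem3 {F : Type*} [Field F] [Finite F] (hF : ringChar F ≠ 2)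
    (ψ : AddChar F ℂ) (hψ : ψ ≠ 1) (γ : F) (hγ : γ ≠ 0) (a : ℕ) (ha : 1 ≤ a) :
    -- the curve is an elliptic curve, and the Euler product defining its L-function converges
    (ArtinSchreierL.curve a γ).IsElliptic ∧
    Multipliable (ArtinSchreierL.eulerFactor (ArtinSchreierL.curve a γ)) ∧
    -- the formula in terms of the pair of numbers attached to the Kloosterman sum at each place
    (∀ ω ω' : ArtinSchreierL.FinitePlace F → ℂ,
      (∀ v, v.poly ≠ Polynomial.X →
        ω v + ω' v = ArtinSchreierL.kl ψ γ v ∧ ω v * ω' v = (Nat.card F : ℂ) ^ v.degree) →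
      (∀ v, v.poly ≠ Polynomial.X →
        IsIntegral ℤ (ω v) ∧ IsIntegral ℤ (ω' v) ∧ ω' v = starRingEnd ℂ (ω v) ∧
        ‖ω v‖ = (Nat.card F : ℝ) ^ ((v.degree : ℝ) / 2)) ∧
      (ArtinSchreierL.LFunction (ArtinSchreierL.curve a γ)).map (Int.castRingHom ℂ) =
        ((∏ v ∈ (ArtinSchreierL.placesDividing_finite F ha).toFinset,
          ((1 - Polynomial.C ((Nat.card F : ℂ) ^ v.degree) * Polynomial.X ^ v.degree) *
            (1 - Polynomial.C (ω v ^ 2) * Polynomial.X ^ v.degree) *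
            (1 - Polynomial.C (ω' v ^ 2) * Polynomial.X ^ v.degree)) : Polynomial ℂ) :
          PowerSeries ℂ)) ∧
    -- the formula in terms of the angles of the Kloosterman sums
    ∃ θ : ArtinSchreierL.FinitePlace F → ℝ,
      (∀ v, v.poly ≠ Polynomial.X → θ v ∈ Set.Ioo 0 Real.pi ∧
        ArtinSchreierL.kl ψ γ v =
          ((2 * (Nat.card F : ℝ) ^ ((v.degree : ℝ) / 2) * Real.cos (θ v) : ℝ) : ℂ)) ∧
      (ArtinSchreierL.LFunction (ArtinSchreierL.curve a γ)).map (Int.castRingHom ℂ) =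
        ((∏ v ∈ (ArtinSchreierL.placesDividing_finite F ha).toFinset,
          ((1 - (Polynomial.C (Nat.card F : ℂ) * Polynomial.X) ^ v.degree) *
            (1 - Polynomial.C (Complex.exp (2 * Complex.I * (θ v : ℂ))) *
              (Polynomial.C (Nat.card F : ℂ) * Polynomial.X) ^ v.degree) *
            (1 - Polynomial.C (Complex.exp (-2 * Complex.I * (θ v : ℂ))) *
              (Polynomial.C (Nat.card F : ℂ) * Polynomial.X) ^ v.degree)) : Polynomial ℂ) :
          PowerSeries ℂ) := by
  classical
  refine ⟨ArtinSchreierL.curve_isElliptic hF hγ ha,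
    (ArtinSchreierL.hasProd_eulerFactor _
      (ArtinSchreierL.coeff_zero_localPolynomial hF hγ ha)).multipliable,
    fun ω ω' hω => ⟨fun v hv => ArtinSchreierL.kl_roots hF hψ hγ hv (hω v hv).1 (hω v hv).2,
      ArtinSchreierL.map_LFunction_eq hF hψ hγ ha hω⟩, ?_⟩
  have h (v : ArtinSchreierL.FinitePlace F) : ∃ θ : ℝ, v.poly ≠ Polynomial.X →
      θ ∈ Set.Ioo 0 Real.pi ∧ ArtinSchreierL.kl ψ γ v =
        ((2 * (Nat.card F : ℝ) ^ ((v.degree : ℝ) / 2) * Real.cos θ : ℝ) : ℂ) := by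
    by_cases hv : v.poly = Polynomial.X
    -- No condition is imposed at the place `t = 0`, so the angle there is arbitrary.
    · exact ⟨0, fun h => absurd hv h⟩
    · obtain ⟨θ, hθ⟩ := ArtinSchreierL.exists_angle_kl hF hψ hγ hv
      exact ⟨θ, fun _ => hθ⟩
  choose θ hθ using h
  exact ⟨θ, hθ, ArtinSchreierL.map_LFunction_eq_angles hF hψ hγ ha fun v hv => (hθ v hv).2⟩
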